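/- Let $K$ be a field of characteristic different from $2$ and $3$, and let $C/K$ be a nonsingular projective (geometrically integral) curve of genus one. For $i\in\{0,1\}$ let $\mathcal I_i(C)$ be the set of automorphisms $v$ of $C$ with $v^2=\mathrm{id}$ such that the quotient curve $C/\langle v\rangle$ has genus $i$. Let $w\neq u$ be two distinct elements of $\mathcal I_0(C)$ defined over $K$ such that $C/\langle w\rangle\simeq\mathbb P^1_K$ over $K$ and $u\cdot w\in\mathcal I_1(C)$. Let $L=K(\sqrt d)$, $d\in K$, be a quadratic extension of $K$, let $\sigma\in\mathrm{Gal}(L/K)$, $\sigma\ne 1$, and suppose that $P\in C(L)\setminus C(K)$ satisfies $w(P)={}^{\sigma}P$. Write $v(f)=f\circ v$ for the action of an automorphism $v$ of $C$ on the function field $K(C)$. 1. If $u(P)=P$, there exist $x,y\in K(C)$ and $b,c\in K$ such that $K(C)=K(x,y)$, $w(x,y)=(x,-y)$, $u(x,y)=(-x,y)$ and $$y^2=d\,(x^4+b\,x^2+c).$$ Moreover, $Y^2=d\,(X^3+b\,X^2+c\,X)$ is an equation for $C/\langle u\cdot w\rangle$, i.e. the function field of $C/\langle u\cdot w\rangle$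 is $K(X,Y)$ for some functions $X,Y$ satisfying this equation. 2. If $u(P)\neq P$, there exist $x,y\in K(C)$, $\varepsilon\in K^*$ and $b,c\in K$ such that $K(C)=K(x,y)$, $w(x,y)=(x,-y)$, $u(x,y)=(\varepsilon/x,\ \varepsilon y/x^2)$ and $$y^2=d\,(x^4+b\,x^3+c\,x^2+b\,\varepsilon\, x+\varepsilon^2).$$ Moreover, $Y^2=d\,(X^2-4\varepsilon)(X^2+b\,X+c-2\varepsilon)$ is an equation for $C/\langle u\cdot w\rangle$, in the same sense. -/

import Mathlib

open CategoryTheory AlgebraicGeometry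

universe u

namespace GenusOne

noncomputable section

/-- A nonsingular projective curve over `K`: a proper, smooth, geometrically integral `K`-scheme
of dimension one. -/
class IsCurve {K : Type u} [Field K] (C : Over (Spec (.of K))) : Prop where
  isProper : IsProper C.hom
  smooth : SmoothOfRelativeDimension 1 C.hom
  geometricallyIntegral : GeometricallyIntegral C.hom

instance isIntegral_left {K : Type u} [Field K] (C : Over (Spec (.of K))) [IsCurve C] :
    IsIntegral C.left := by
  have := IsCurve.geometricallyIntegral (C := C)
  have : Subsingleton (Spec (.of K)) := inferInstanceAs (Subsingleton (PrimeSpectrum K))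
  exact GeometricallyIntegral.isIntegral_of_subsingleton C.hom

/-- The function field `K(C)`. -/
abbrev FunctionField {K : Type u} [Field K] (C : Over (Spec (.of K))) [IsCurve C] : Type u :=
  C.left.functionField

/-- `K(C)` as an extension of `K`, through the structure morphism `C ⟶ Spec K`. -/
instance functionFieldAlgebra {K : Type u} [Field K] (C : Over (Spec (.of K))) [IsCurve C] :
    Algebra K (FunctionField C) :=
  ((Scheme.ΓSpecIso (.of K)).inv ≫ C.hom.appTop ≫
    C.left.presheaf.germ ⊤ (genericPoint C.left) trivial).hom.toAlgebra

/-- The action `f ↦ f ∘ v` on `K(C)` of an automorphism `v` of `C`. -/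
def pullback {K : Type u} [Field K] {C : Over (Spec (.of K))} [IsCurve C] (v : Aut C) :
    FunctionField C →+* FunctionField C :=
  (C.left.presheaf.stalkSpecializes
      (specializes_of_eq (by
        have : IsIso v.hom := Iso.isIso_hom (X := C) (Y := C) v
        have : IsIso v.hom.left := inferInstanceAs (IsIso ((Over.forget (Spec (.of K))).map v.hom))
        exact genericPoint_eq_of_isOpenImmersion v.hom.left)) ≫
    v.hom.left.stalkMap (genericPoint C.left)).hom

/-- The space `H⁰(C, Ω¹)` of regular differentials: the `ω ∈ Ω_{K(C)/K}` which at every point `P`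
come from `Ω_{O_P/K}`, that is, are sums of differentials `a db` with `a, b ∈ O_P`. -/
def regularDifferentials {K : Type u} [Field K] (C : Over (Spec (.of K))) [IsCurve C] :
    Submodule K (KaehlerDifferential K (FunctionField C)) :=
  ⨅ P : C.left, Submodule.span K
    {ω | ∃ a b : C.left.presheaf.stalk P,
      ω = (algebraMap (C.left.presheaf.stalk P) (FunctionField C) a) •
        KaehlerDifferential.D K (FunctionField C)
          (algebraMap (C.left.presheaf.stalk P) (FunctionField C) b)}

/-- `C` has genus `g`, i.e. `dim_K H⁰(C, Ω¹) = g`. -/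
def HasGenus {K : Type u} [Field K] (C : Over (Spec (.of K))) [IsCurve C] (g : ℕ) : Prop :=
  Module.rank K (regularDifferentials C) = (g : Cardinal)

/-- `π : C ⟶ Q` is the quotient `C ⟶ C/⟨v⟩` by the involution `v`: the fibres of `π` are the orbits
of `v`, `Q` carries the quotient topology, and the functions on an open `U` of `Q` are the
`v`-invariant functions on its preimage. -/
structure IsQuotient {K : Type u} [Field K] {C Q : Over (Spec (.of K))} (v : Aut C) (π : C ⟶ Q) :
    Prop where
  comp_eq : v.hom.left ≫ π.left = π.left
  isQuotientMap : Topology.IsQuotientMap π.left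
  fiber : ∀ x y : C.left, π.left x = π.left y ↔ x = y ∨ x = v.hom.left y
  app_injective : ∀ U : Q.left.Opens, Function.Injective (π.left.app U)
  range_app : ∀ (U : Q.left.Opens) (s : Γ(C.left, π.left ⁻¹ᵁ U)),
    (∃ t : Γ(Q.left, U), π.left.app U t = s) ↔
      v.hom.left.appLE (π.left ⁻¹ᵁ U) (π.left ⁻¹ᵁ U)
        (by rw [← Scheme.Hom.comp_preimage, comp_eq]) s = s

/-- The set of involutions `v` of `C` over `K` (the identity is allowed) such that `C/⟨v⟩` has
genus `i`. -/
def involutions {K : Type u} [Field K] (C : Over (Spec (.of K))) (i : ℕ) : Set (Aut C) :=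
  {v | v * v = 1 ∧ ∃ (Q : Over (Spec (.of K))) (_ : IsCurve Q) (π : C ⟶ Q),
    IsQuotient v π ∧ HasGenus Q i}

/-- The projective line `Proj K[X₀, X₁]` over `K`. -/
def projectiveLine (K : Type u) [Field K] : Over (Spec (.of K)) :=
  letI : GradedAlgebra (MvPolynomial.homogeneousSubmodule (Fin 2) K) :=
    MvPolynomial.gradedAlgebra
  Over.mk (Proj.toSpecZero (MvPolynomial.homogeneousSubmodule (Fin 2) K) ≫
    Spec.map (CommRingCat.ofHom
      (algebraMap K (MvPolynomial.homogeneousSubmodule (Fin 2) K 0))))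

/-- `Spec L` as a `K`-scheme. -/
abbrev specOver (K L : Type u) [Field K] [Field L] [Algebra K L] : Over (Spec (.of K)) :=
  Over.mk (Spec.map (CommRingCat.ofHom (algebraMap K L)))

/-- The set `C(L)` of `L`-rational points. -/
abbrev Points {K : Type u} [Field K] (C : Over (Spec (.of K))) (L : Type u) [Field L]
    [Algebra K L] : Type u :=
  specOver K L ⟶ C

/-- The map `C(L) → C(M)` induced by a `K`-embedding `φ : L → M`. For `φ = σ` an automorphism of
`L` over `K` this is the conjugation `P ↦ ^σP`. -/
def Points.map {K : Type u} [Field K] {C : Over (Spec (.of K))} {L M : Type u} [Field L]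
    [Algebra K L] [Field M] [Algebra K M] (φ : L →ₐ[K] M) (P : Points C L) : Points C M :=
  Over.homMk (U := specOver K M) (V := specOver K L) (Spec.map (CommRingCat.ofHom φ.toRingHom))
    (by
      dsimp [specOver]
      rw [← Spec.map_comp, ← CommRingCat.ofHom_comp]
      congr 2
      exact φ.comp_algebraMap) ≫ P

end

end GenusOne

/-! Everything is moved to the function field `F = K(C)`. Since `C` is smooth and proper, its local
rings are exactly the valuation rings of `F` containing `K`, so the genus depends on `F` alone; a
point becomes a place of `F`, and the function field of a quotient by an involution becomes a fixed
field.

The fixed field of `w` is `K(t)` because the quotient is the projective line. The relation `w(P) =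
^σP` says that the value at `P` of `w g` is the conjugate of that of `g`. Hence invariant functions
take values in `K` at `P`, and a change of `t` gives a generator `x` with a pole at `P`. As `P` is
not rational, some anti-invariant function has value `r = √d` there. Its square is a rational
function of `x`; removing square factors gives `y² = f(x)`, `f` squarefree of degree `2m`, with `y /
x^m` of value `r` at `P`. The leading coefficient of `f` is therefore `r² = d`
(`exists_doubleCover`).

Genus one forces `m = 2`: there is no regular differential for `m ≤ 1`, and `dx/y`, `x dx/y` are
independent regular ones for `m ≥ 3`. Regularity needs `f` prime to `f'`, which over an imperfect
field comes from smoothness of `C` (`isCoprime_derivative`).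

The involution `u` commutes with `w`, so it acts on `K(x)` by a fractional linear involution. A
translation of `x`, which keeps the pole at `P`, brings it to `x ↦ -x` or `x ↦ ε/x`
(`exists_normalized`). Then `u y` is `κ y` or `κ y / x²` with `κ² = 1` or `κ² = ε²`. The sign is
decided by the genus of `C/⟨uw⟩`: a nonzero regular differential of the quotient pulls back to a
multiple of `dx/y`, which `uw` must fix (`eq_one_of_quotient_regDiff_ne_bot`). In the first form `u`
fixes `P`, in the second it does not, so the two forms are the two cases of the theorem. Generators
of the fixed field of `uw` give the equation of the quotient. -/

/-! ### Local rings of smooth algebras of relative dimension one -/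

theorem MvPolynomial.isPrincipalIdealRing_of_unique {σ : Type*} [Unique σ] (K : Type*) [Field K] :
    IsPrincipalIdealRing (MvPolynomial σ K) :=
  IsPrincipalIdealRing.of_surjective (MvPolynomial.uniqueAlgEquiv K σ).symm.toRingHom
    (MvPolynomial.uniqueAlgEquiv K σ).symm.surjective

/-- A local ring of an étale algebra over a principal ideal domain is a valuation ring. -/
theorem valuationRing_of_etale (A S R : Type*) [CommRing A] [IsDomain A] [IsPrincipalIdealRing A]
    [CommRing S] [Algebra A S] [Algebra.Etale A S] [CommRing R] [IsDomain R] [Algebra S R]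
    (q : Ideal S) [q.IsPrime] [IsLocalization.AtPrime R q] : ValuationRing R := by
  have : IsLocalRing R := IsLocalization.AtPrime.isLocalRing R q
  let _ : Algebra A R := ((algebraMap S R).comp (algebraMap A S)).toAlgebra
  have : IsScalarTower A S R := .of_algebraMap_eq' rfl
  let p := q.under A
  have hp : ∀ a : p.primeCompl, IsUnit (algebraMap A R a) := fun a => by
    rw [IsScalarTower.algebraMap_apply A S R]
    exact IsLocalization.map_units R (⟨algebraMap A S a, fun h => a.2 h⟩ : q.primeCompl)
  let _ : Algebra (Localization.AtPrime p) R := (IsLocalization.lift hp).toAlgebra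
  have : IsScalarTower A (Localization.AtPrime p) R :=
    .of_algebraMap_eq fun a => (IsLocalization.lift_eq hp a).symm
  have : IsLocalHom (algebraMap (Localization.AtPrime p) R) := by
    constructor
    intro a ha
    obtain ⟨a, s, rfl⟩ := IsLocalization.exists_mk'_eq p.primeCompl a
    rw [IsLocalization.AtPrime.isUnit_mk'_iff _ p]
    intro hap
    rw [RingHom.algebraMap_toAlgebra, IsLocalization.lift_mk'] at ha
    have ha := isUnit_of_mul_isUnit_left ha
    rw [IsScalarTower.algebraMap_apply A S R] at ha
    exact ((IsLocalization.AtPrime.isUnit_to_map_iff R q _).1 ha) hap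
  have : Algebra.FormallyEtale S R := .of_isLocalization q.primeCompl
  have : Algebra.FormallyUnramified A R := .comp A S R
  have : Algebra.FormallyUnramified (Localization.AtPrime p) R := .of_restrictScalars A _ _
  have : Algebra.EssFiniteType S R := .of_isLocalization R q.primeCompl
  have : Algebra.EssFiniteType A R := .comp A S R
  have : Algebra.EssFiniteType (Localization.AtPrime p) R := .of_comp A _ _
  have : IsNoetherianRing S := Algebra.FiniteType.isNoetherianRing A S
  have : IsNoetherianRing R := IsLocalization.isNoetherianRing q.primeCompl R inferInstance
  -- Unramifiedness over the localization of `A` at `p` makes the maximal ideal of `R` the extension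
  -- of a principal one, and a Noetherian local domain with principal maximal ideal is a valuation
  -- ring.
  have hm := Algebra.FormallyUnramified.map_maximalIdeal (R := Localization.AtPrime p) (S := R)
  refine ((tfae_of_isNoetherianRing_of_isLocalRing_of_isDomain R).out 4 1).1 ?_
  rw [← hm]
  rw [← Localization.AtPrime.map_eq_maximalIdeal]
  infer_instance

/-- The local rings of a smooth algebra of relative dimension one over a field are valuation
rings. -/
theorem valuationRing_of_isStandardSmoothOfRelativeDimension_one {K S : Type*} (R : Type*) [Field K]
    [CommRing S] {f : K →+* S} (hf : f.IsStandardSmoothOfRelativeDimension 1)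
    [CommRing R] [IsDomain R] [Algebra S R] (q : Ideal S) [q.IsPrime]
    [IsLocalization.AtPrime R q] : ValuationRing R := by
  obtain ⟨g, -, hg⟩ := hf.exists_etale_mvPolynomial
  let _ := g.toAlgebra
  have : Algebra.Etale (MvPolynomial (Fin 1) K) S := hg
  have := MvPolynomial.isPrincipalIdealRing_of_unique (σ := Fin 1) K
  exact valuationRing_of_etale (MvPolynomial (Fin 1) K) S R q

theorem formallySmooth_comp_of_isStandardSmooth {K S : Type*} (R : Type*) [CommRing K]
    [CommRing S] {f : K →+* S} (hf : f.IsStandardSmooth)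
    [CommRing R] [Algebra S R] (M : Submonoid S)
    [IsLocalization M R] : ((algebraMap S R).comp f).FormallySmooth := by
  have : Algebra.FormallyEtale S R := .of_isLocalization M
  have h1 : (algebraMap S R).FormallySmooth := RingHom.formallySmooth_algebraMap.2 inferInstance
  exact hf.smooth.formallySmooth.comp h1

/-! ### Local rings of a curve -/

namespace GenusOne
noncomputable section
variable {K : Type u} [Field K] (C : Over (Spec (.of K))) [IsCurve C]

/-- The structure map `K → O_P` of a local ring of `C`. -/
def toStalk (p : C.left) : K →+* C.left.presheaf.stalk p :=
  ((Scheme.ΓSpecIso (.of K)).inv ≫ C.hom.appTop ≫ C.left.presheaf.germ ⊤ p (TopologicalSpace.Opens.mem_top p)).hom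

theorem algebraMap_toStalk (p : C.left) (a : K) :
    algebraMap (C.left.presheaf.stalk p) (FunctionField C) (toStalk C p a) =
      algebraMap K (FunctionField C) a := by
  change _ = ((Scheme.ΓSpecIso (.of K)).inv ≫ C.hom.appTop ≫
    C.left.presheaf.germ ⊤ (genericPoint C.left) (TopologicalSpace.Opens.mem_top _)).hom a
  rw [← C.left.presheaf.germ_stalkSpecializes (TopologicalSpace.Opens.mem_top p)
    ((genericPoint_spec C.left).specializes trivial)]
  rfl

theorem exists_chart (p : C.left) : ∃ (V : C.left.Opens) (_ : IsAffineOpen V) (hp : p ∈ V)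
    (f : K →+* Γ(C.left, V)), f.IsStandardSmoothOfRelativeDimension 1 ∧
      (C.left.presheaf.germ V p hp).hom.comp f = toStalk C p := by
  have := IsCurve.smooth (C := C)
  obtain ⟨U, hU, V, hV, hp, e, h⟩ :=
    SmoothOfRelativeDimension.exists_isStandardSmoothOfRelativeDimension (n := 1) (f := C.hom) p
  have : Subsingleton (Spec (.of K)) := inferInstanceAs (Subsingleton (PrimeSpectrum K))
  obtain rfl : U = ⊤ := by
    ext x
    simpa [Subsingleton.elim x (C.hom p)] using e hp
  refine ⟨V, hV, hp, _, RingHom.isStandardSmoothOfRelativeDimension_respectsIso.2 _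
    (Scheme.ΓSpecIso (.of K)).symm.commRingCatIsoToRingEquiv h, ?_⟩
  ext a
  exact C.left.presheaf.germ_res_apply (homOfLE e) p hp _

theorem valuationRing_stalk (p : C.left) : ValuationRing (C.left.presheaf.stalk p) := by
  obtain ⟨V, hV, hp, f, hf, -⟩ := exists_chart C p
  let _ := TopCat.Presheaf.algebra_section_stalk C.left.presheaf (⟨p, hp⟩ : V)
  have := hV.isLocalization_stalk ⟨p, hp⟩
  exact valuationRing_of_isStandardSmoothOfRelativeDimension_one _ hf
    (hV.primeIdealOf ⟨p, hp⟩).asIdeal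

theorem formallySmooth_toStalk (p : C.left) : (toStalk C p).FormallySmooth := by
  obtain ⟨V, hV, hp, f, hf, h⟩ := exists_chart C p
  let _ := TopCat.Presheaf.algebra_section_stalk C.left.presheaf (⟨p, hp⟩ : V)
  have := hV.isLocalization_stalk ⟨p, hp⟩
  rw [← h]
  exact formallySmooth_comp_of_isStandardSmooth (C.left.presheaf.stalk p) hf.isStandardSmooth
    (hV.primeIdealOf ⟨p, hp⟩).asIdeal.primeCompl

end
end GenusOne

/-! ### Points and valuation rings of the function field -/

namespace GenusOne
noncomputable section

/-- The differentials of `F/K` which are regular at every valuation subring of `F` containing `K`. -/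
def regDiff (K F : Type*) [Field K] [Field F] [Algebra K F] :
    Submodule K (KaehlerDifferential K F) :=
  ⨅ (V : ValuationSubring F) (_ : ∀ a, algebraMap K F a ∈ V), Submodule.span K
    {ω | ∃ a ∈ V, ∃ b ∈ V, ω = a • KaehlerDifferential.D K F b}

variable {K : Type u} [Field K] (C : Over (Spec (.of K))) [IsCurve C]

/-- The local ring at `p` as a valuation subring of the function field. -/
def stalkSubring (p : C.left) : ValuationSubring (FunctionField C) where
  toSubring := (algebraMap (C.left.presheaf.stalk p) (FunctionField C)).range
  mem_or_inv_mem' x := by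
    have := valuationRing_stalk C p
    obtain ⟨a, h⟩ | ⟨a, h⟩ := ValuationRing.isInteger_or_isInteger (C.left.presheaf.stalk p) x
    exacts [Or.inl ⟨a, h⟩, Or.inr ⟨a, h⟩]

theorem algebraMap_mem_stalkSubring (p : C.left) (a : K) :
    algebraMap K (FunctionField C) a ∈ stalkSubring C p :=
  ⟨_, algebraMap_toStalk C p a⟩

omit [IsCurve C] in
theorem fromSpecStalk_comp_hom (p : C.left) :
    C.left.fromSpecStalk p ≫ C.hom = Spec.map (CommRingCat.ofHom (toStalk C p)) := by
  refine ext_of_isAffine ?_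
  have h : CommRingCat.ofHom (toStalk C p) = (Scheme.ΓSpecIso (.of K)).inv ≫ C.hom.appTop ≫
    C.left.presheaf.germ ⊤ p (TopologicalSpace.Opens.mem_top p) := rfl
  rw [Scheme.Hom.comp_appTop, ← cancel_epi (Scheme.ΓSpecIso (.of K)).inv]
  refine Eq.trans ?_ (Scheme.ΓSpecIso_inv_naturality (CommRingCat.ofHom (toStalk C p)))
  rw [h, Scheme.fromSpecStalk_appTop]
  simp only [Category.assoc]
  have h2 : (Spec (C.left.presheaf.stalk p)).presheaf.map (homOfLE (le_top (a :=
      (⊤ : (Spec (C.left.presheaf.stalk p)).Opens)))).op = 𝟙 _ :=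
    (Spec (C.left.presheaf.stalk p)).presheaf.map_id _
  exact congr(_ ≫ C.hom.appTop ≫ C.left.presheaf.germ ⊤ p _ ≫
    (Scheme.ΓSpecIso (C.left.presheaf.stalk p)).inv ≫ $h2).trans (by
      rw [Category.comp_id]; rfl)

theorem SpecMap_algebraMap_fromSpecStalk (p : C.left) :
    Spec.map (CommRingCat.ofHom (algebraMap (C.left.presheaf.stalk p) (FunctionField C))) ≫
      C.left.fromSpecStalk p = C.left.fromSpecStalk (genericPoint C.left) :=
  Scheme.SpecMap_stalkSpecializes_fromSpecStalk ((genericPoint_spec C.left).specializes trivial)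

/-- By the valuative criterion the generic point `Spec K(C) ⟶ C` extends to `Spec V`. If `p` is the
image of the closed point, `V` dominates the local ring at `p`, and a valuation ring has no strictly
larger ring of its fraction field dominating it. -/
theorem exists_stalkSubring_eq (V : ValuationSubring (FunctionField C))
    (hV : ∀ a, algebraMap K (FunctionField C) a ∈ V) : ∃ p, stalkSubring C p = V := by
  have := IsCurve.isProper (C := C)
  have hex : ValuativeCriterion.Existence C.hom := by
    have : UniversallyClosed C.hom := inferInstance
    rw [UniversallyClosed.eq_valuativeCriterion] at this
    exact this.1
  let k : K →+* V := (algebraMap K (FunctionField C)).codRestrict V.toSubring hV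
  have hsq : CommSq (C.left.fromSpecStalk (genericPoint C.left))
      (Spec.map (CommRingCat.ofHom (algebraMap V (FunctionField C)))) C.hom
      (Spec.map (CommRingCat.ofHom k)) := by
    constructor
    exact (fromSpecStalk_comp_hom C _).trans (Spec.map_comp (CommRingCat.ofHom k)
      (CommRingCat.ofHom (V.subtype : V →+* FunctionField C)))
  obtain ⟨⟨l, hl, -⟩⟩ := (hex ⟨V, FunctionField C, _, _, hsq⟩).exists_lift
  dsimp only at l hl
  let p := l (IsLocalRing.closedPoint V)
  let φ := Scheme.stalkClosedPointTo l
  have hφ : Spec.map φ ≫ C.left.fromSpecStalk p = l := Scheme.Spec_stalkClosedPointTo_fromSpecStalk l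
  have hφl : IsLocalHom φ.hom := inferInstance
  have key : ∀ a, ((φ.hom a : V) : FunctionField C) =
      algebraMap (C.left.presheaf.stalk p) (FunctionField C) a := by
    have h1 : Spec.map (φ ≫ CommRingCat.ofHom (algebraMap V (FunctionField C))) =
        Spec.map (CommRingCat.ofHom (algebraMap (C.left.presheaf.stalk p) (FunctionField C))) := by
      rw [← cancel_mono (C.left.fromSpecStalk p), SpecMap_algebraMap_fromSpecStalk, Spec.map_comp,
        Category.assoc, hφ]
      exact hl
    intro a
    exact congr($(Spec.map_injective h1).hom a)
  refine ⟨p, SetLike.ext fun g => ⟨?_, fun hg => ?_⟩⟩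
  · rintro ⟨a, rfl⟩
    rw [← key]
    exact (φ.hom a).2
  · obtain h | ⟨a, ha⟩ := (stalkSubring C p).mem_or_inv_mem g
    · exact h
    by_cases hg0 : g = 0
    · exact hg0 ▸ zero_mem _
    -- Here `g⁻¹` comes from `a` in the local ring at `p` and is a unit of `V`; since the map to `V`
    -- is local, `a` is already a unit.
    have hu : IsUnit (φ.hom a) := .of_mul_eq_one ⟨g, hg⟩ (by
      ext
      change ((φ.hom a : V) : FunctionField C) * g = 1
      rw [key, ha, inv_mul_cancel₀ hg0])
    have hu := (isUnit_map_iff φ.hom a).1 hu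
    obtain ⟨b, hb⟩ := hu.exists_right_inv
    refine ⟨b, ?_⟩
    have := congr(algebraMap (C.left.presheaf.stalk p) (FunctionField C) $hb)
    rw [map_mul, ha, map_one] at this
    field_simp at this
    exact this

/-- The two intersections run over the same rings, so the genus is an invariant of the extension
`K(C)/K`. -/
theorem regularDifferentials_eq : regularDifferentials C = regDiff K (FunctionField C) := by
  have h : ∀ p : C.left, {ω | ∃ a b : C.left.presheaf.stalk p,
      ω = (algebraMap (C.left.presheaf.stalk p) (FunctionField C) a) •
        KaehlerDifferential.D K (FunctionField C)
          (algebraMap (C.left.presheaf.stalk p) (FunctionField C) b)} =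
      {ω | ∃ a ∈ stalkSubring C p, ∃ b ∈ stalkSubring C p,
        ω = a • KaehlerDifferential.D K (FunctionField C) b} := fun p => by
    ext ω
    constructor
    · rintro ⟨a, b, rfl⟩
      exact ⟨_, ⟨a, rfl⟩, _, ⟨b, rfl⟩, rfl⟩
    · rintro ⟨_, ⟨a, rfl⟩, _, ⟨b, rfl⟩, rfl⟩
      exact ⟨a, b, rfl⟩
  apply le_antisymm
  · refine le_iInf₂ fun V hV => ?_
    obtain ⟨p, rfl⟩ := exists_stalkSubring_eq C V hV
    rw [← h]
    exact iInf_le _ p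
  · refine le_iInf fun p => ?_
    rw [h]
    exact iInf₂_le (stalkSubring C p) (algebraMap_mem_stalkSubring C p)

/-- Valuation subrings of `K(C)` containing `K` are formally smooth over `K`. -/
theorem formallySmooth_valuationSubring (V : ValuationSubring (FunctionField C))
    (hV : ∀ a, algebraMap K (FunctionField C) a ∈ V) :
    ((algebraMap K (FunctionField C)).codRestrict V.toSubring hV).FormallySmooth := by
  obtain ⟨p, rfl⟩ := exists_stalkSubring_eq C V hV
  let e : C.left.presheaf.stalk p ≃+* (stalkSubring C p).toSubring :=
    RingEquiv.ofBijective (algebraMap (C.left.presheaf.stalk p) (FunctionField C)).rangeRestrict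
      ⟨fun a b h => IsFractionRing.injective (C.left.presheaf.stalk p) (FunctionField C)
        (congrArg Subtype.val h), RingHom.rangeRestrict_surjective _⟩
  convert! RingHom.FormallySmooth.respectsIso.1 _ e (formallySmooth_toStalk C p)
  ext a
  exact (algebraMap_toStalk C p a).symm

end
end GenusOne

/-! ### Morphisms of curves and maps of function fields -/

namespace GenusOne
noncomputable section
variable {K : Type u} [Field K] {C Q : Over (Spec (.of K))} [IsCurve C] [IsCurve Q]

/-- The map of function fields of a dominant morphism of curves. -/
def comapFunction (π : C ⟶ Q) (h : π.left (genericPoint C.left) = genericPoint Q.left) :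
    FunctionField Q →+* FunctionField C :=
  (Q.left.presheaf.stalkSpecializes (specializes_of_eq h) ≫
    π.left.stalkMap (genericPoint C.left)).hom

section
variable (π : C ⟶ Q) (h : π.left (genericPoint C.left) = genericPoint Q.left)

theorem SpecMap_comapFunction :
    Spec.map (CommRingCat.ofHom (comapFunction π h)) ≫ Q.left.fromSpecStalk (genericPoint Q.left) =
      C.left.fromSpecStalk (genericPoint C.left) ≫ π.left := by
  change Spec.map (Q.left.presheaf.stalkSpecializes (specializes_of_eq h) ≫
    π.left.stalkMap (genericPoint C.left)) ≫ _ = _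
  rw [Spec.map_comp, Category.assoc, Scheme.SpecMap_stalkSpecializes_fromSpecStalk,
    Scheme.SpecMap_stalkMap_fromSpecStalk]

/-- Since `fromSpecStalk` is a monomorphism, the map of function fields is characterised by its
effect on generic points; functoriality is deduced from this. -/
theorem eq_comapFunction {ψ : FunctionField Q →+* FunctionField C}
    (hψ : Spec.map (CommRingCat.ofHom ψ) ≫ Q.left.fromSpecStalk (genericPoint Q.left) =
      C.left.fromSpecStalk (genericPoint C.left) ≫ π.left) : ψ = comapFunction π h := by
  rw [← SpecMap_comapFunction π h, cancel_mono] at hψ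
  exact congrArg CommRingCat.Hom.hom (Spec.map_injective hψ)

theorem comapFunction_stalk (p : C.left) (s : Q.left.presheaf.stalk (π.left p)) :
    comapFunction π h (algebraMap (Q.left.presheaf.stalk (π.left p)) (FunctionField Q) s) =
      algebraMap (C.left.presheaf.stalk p) (FunctionField C) (π.left.stalkMap p s) := by
  have h1 := Scheme.Hom.stalkSpecializes_stalkMap_apply π.left _ p
    ((genericPoint_spec C.left).specializes trivial) s
  refine Eq.trans ?_ h1
  exact congrArg (π.left.stalkMap (genericPoint C.left))
    congr($(Q.left.presheaf.stalkSpecializes_comp (specializes_of_eq h)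
      ((genericPoint_spec Q.left).specializes trivial)) s)

theorem comapFunction_algebraMap (a : K) :
    comapFunction π h (algebraMap K (FunctionField Q) a) = algebraMap K (FunctionField C) a := by
  have h1 : Spec.map (CommRingCat.ofHom ((comapFunction π h).comp (algebraMap K _))) =
      Spec.map (CommRingCat.ofHom (algebraMap K (FunctionField C))) := by
    refine (Spec.map_comp (CommRingCat.ofHom (algebraMap K (FunctionField Q)))
      (CommRingCat.ofHom (comapFunction π h))).trans ?_
    refine Eq.trans ?_ (fromSpecStalk_comp_hom C (genericPoint C.left))
    refine congr(_ ≫ $((fromSpecStalk_comp_hom Q (genericPoint Q.left)).symm)).trans ?_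
    rw [← Category.assoc, SpecMap_comapFunction, Category.assoc, Over.w π]
  exact congr($(Spec.map_injective h1).hom a)

/-- `comapFunction` as a homomorphism of `K`-algebras. -/
def comapFunctionAlgHom : FunctionField Q →ₐ[K] FunctionField C :=
  { comapFunction π h with commutes' := comapFunction_algebraMap π h }

end

instance isDominant_fromSpecStalk_genericPoint :
    IsDominant (C.left.fromSpecStalk (genericPoint C.left)) := by
  constructor
  refine Dense.mono (s₁ := {genericPoint C.left}) ?_ ?_
  · rw [Set.singleton_subset_iff, Scheme.range_fromSpecStalk]
    exact specializes_rfl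
  · rw [dense_iff_closure_eq]
    exact genericPoint_spec C.left

/-- The generic point is dense in the integral scheme `C` and `Q` is separated, so agreement there
suffices. -/
theorem hom_ext_of_comapFunction {π₁ π₂ : C ⟶ Q}
    (h₁ : π₁.left (genericPoint C.left) = genericPoint Q.left)
    (h₂ : π₂.left (genericPoint C.left) = genericPoint Q.left)
    (h : comapFunction π₁ h₁ = comapFunction π₂ h₂) : π₁ = π₂ := by
  have := IsCurve.isProper (C := Q)
  ext1
  refine ext_of_isDominant_of_isSeparated Q.hom ((Over.w π₁).trans (Over.w π₂).symm)
    (C.left.fromSpecStalk (genericPoint C.left)) ?_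
  rw [← SpecMap_comapFunction π₁ h₁, h, SpecMap_comapFunction]

theorem aut_genericPoint (v : Aut C) : v.hom.left (genericPoint C.left) = genericPoint C.left := by
  have : IsIso v.hom := Iso.isIso_hom (X := C) (Y := C) v
  have : IsIso v.hom.left := inferInstanceAs (IsIso ((Over.forget (Spec (.of K))).map v.hom))
  exact genericPoint_eq_of_isOpenImmersion v.hom.left

theorem pullback_injective : Function.Injective (pullback : Aut C → _) := fun v₁ v₂ h =>
  Iso.ext (hom_ext_of_comapFunction (aut_genericPoint v₁) (aut_genericPoint v₂) h)

theorem pullback_one : pullback (1 : Aut C) = RingHom.id _ :=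
  (eq_comapFunction _ (aut_genericPoint (1 : Aut C)) (by
    change Spec.map (𝟙 _) ≫ _ = _ ≫ 𝟙 _
    rw [Spec.map_id, Category.id_comp, Category.comp_id])).symm

theorem pullback_mul (u v : Aut C) : pullback (u * v) = (pullback v).comp (pullback u) := by
  refine (eq_comapFunction _ (aut_genericPoint (u * v)) ?_).symm
  refine (congr($(Spec.map_comp (CommRingCat.ofHom (pullback u))
    (CommRingCat.ofHom (pullback v))) ≫ _)).trans ?_
  rw [Category.assoc]
  refine congr(_ ≫ $(SpecMap_comapFunction u.hom (aut_genericPoint u))).trans ?_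
  rw [← Category.assoc]
  refine congr($(SpecMap_comapFunction v.hom (aut_genericPoint v)) ≫ _).trans ?_
  rw [Category.assoc]
  rfl

/-- The action of an automorphism of `C` on `K(C)`, as an automorphism over `K`. -/
def pullbackAlgEquiv (v : Aut C) : FunctionField C ≃ₐ[K] FunctionField C :=
  AlgEquiv.ofAlgHom (comapFunctionAlgHom v.hom (aut_genericPoint v))
    (comapFunctionAlgHom (v⁻¹ : Aut C).hom (aut_genericPoint v⁻¹))
    (by
      ext g
      change ((pullback v).comp (pullback v⁻¹)) g = g
      rw [← pullback_mul, inv_mul_cancel, pullback_one]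
      rfl)
    (by
      ext g
      change ((pullback v⁻¹).comp (pullback v)) g = g
      rw [← pullback_mul, mul_inv_cancel, pullback_one]
      rfl)

theorem pullbackAlgEquiv_mul (u v : Aut C) (g) :
    pullbackAlgEquiv (u * v) g = pullbackAlgEquiv v (pullbackAlgEquiv u g) :=
  congr($(pullback_mul u v) g)

theorem pullbackAlgEquiv_one (g) : pullbackAlgEquiv (1 : Aut C) g = g := congr($(pullback_one) g)

theorem pullbackAlgEquiv_injective :
    Function.Injective (pullbackAlgEquiv : Aut C → FunctionField C ≃ₐ[K] FunctionField C) :=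
  fun _ _ h => pullback_injective (RingHom.ext fun g => congr($h g))

end
end GenusOne

/-! ### Places, and the place attached to a point -/

namespace GenusOne
noncomputable section

/-- A place of `F/K` with values in `L`, given by the relation "`g` is regular at the place, with
value `c`". -/
@[ext]
structure Place (K F L : Type*) [Field K] [Field F] [Field L] [Algebra K F] [Algebra K L] where
  Val : F → L → Prop
  unique : ∀ {g c c'}, Val g c → Val g c' → c = c'
  add : ∀ {g h c e}, Val g c → Val h e → Val (g + h) (c + e)
  mul : ∀ {g h c e}, Val g c → Val h e → Val (g * h) (c * e)
  const : ∀ a : K, Val (algebraMap K F a) (algebraMap K L a)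
  total : ∀ g, (∃ c, Val g c) ∨ Val g⁻¹ 0

namespace Place

variable {K F L : Type*} [Field K] [Field F] [Field L] [Algebra K F] [Algebra K L]
  (P : Place K F L)

theorem one : P.Val 1 1 := by simpa using P.const 1

theorem zero : P.Val 0 0 := by simpa using P.const 0

theorem neg {g c} (h : P.Val g c) : P.Val (-g) (-c) := by
  simpa using P.mul (P.const (-1)) h

theorem sub {g h c e} (h₁ : P.Val g c) (h₂ : P.Val h e) : P.Val (g - h) (c - e) := by
  simpa [sub_eq_add_neg] using P.add h₁ (P.neg h₂)

theorem pow {g c} (h : P.Val g c) (n : ℕ) : P.Val (g ^ n) (c ^ n) := by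
  induction n with
  | zero => simpa using P.one
  | succ n ih => simpa [pow_succ] using P.mul ih h

theorem ne_zero {g c} (h : P.Val g c) (hc : c ≠ 0) : g ≠ 0 := by
  rintro rfl
  exact hc (P.unique h P.zero)

theorem inv {g c} (h : P.Val g c) (hc : c ≠ 0) : P.Val g⁻¹ c⁻¹ := by
  have hg := P.ne_zero h hc
  obtain ⟨e, he⟩ | h0 := P.total g⁻¹
  · have := P.unique (P.mul h he) (by simpa [hg] using P.one)
    rwa [← eq_inv_of_mul_eq_one_right this]
  · exact absurd (P.unique h (by simpa using h0)) hc

theorem div {g h c e} (h₁ : P.Val g c) (h₂ : P.Val h e) (he : e ≠ 0) : P.Val (g / h) (c / e) := by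
  simpa [div_eq_mul_inv] using P.mul h₁ (P.inv h₂ he)

theorem aeval {g c} (h : P.Val g c) (p : Polynomial K) :
    P.Val (Polynomial.aeval g p) (Polynomial.aeval c p) := by
  induction p using Polynomial.induction_on' with
  | add p q hp hq => simpa using P.add hp hq
  | monomial n a => simpa [Polynomial.aeval_monomial] using P.mul (P.const a) (P.pow h n)

/-- The valuation ring of a place. -/
def ring : ValuationSubring F where
  carrier := {g | ∃ c, P.Val g c}
  mul_mem' := fun ⟨_, h₁⟩ ⟨_, h₂⟩ => ⟨_, P.mul h₁ h₂⟩
  one_mem' := ⟨_, P.one⟩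
  add_mem' := fun ⟨_, h₁⟩ ⟨_, h₂⟩ => ⟨_, P.add h₁ h₂⟩
  zero_mem' := ⟨_, P.zero⟩
  neg_mem' := fun ⟨_, h⟩ => ⟨_, P.neg h⟩
  mem_or_inv_mem' g := (P.total g).imp id fun h => ⟨0, h⟩

theorem algebraMap_mem_ring (a : K) : algebraMap K F a ∈ P.ring := ⟨_, P.const a⟩

theorem inv_mem_ring {g c} (h : P.Val g c) : g⁻¹ ∈ P.ring ↔ c ≠ 0 ∨ g = 0 := by
  constructor
  · rintro ⟨e, he⟩
    by_contra! hc
    obtain ⟨rfl, hg⟩ := hc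
    exact zero_ne_one (P.unique (by simpa [hg] using P.mul h he) P.one)
  · rintro (hc | rfl)
    · exact ⟨_, P.inv h hc⟩
    · simp

/-- One inclusion is enough: where `P` has a pole, `g⁻¹` has value `0` at `P`, hence at `Q`, so `Q`
has no finite value at a nonzero `g`. -/
theorem ext_of_le {P Q : Place K F L} (h : ∀ g c, P.Val g c → Q.Val g c) : P = Q := by
  ext g c
  refine ⟨h g c, fun hQ => ?_⟩
  obtain ⟨e, he⟩ | h0 := P.total g
  · rwa [Q.unique hQ (h _ _ he)]
  · by_cases hg : g = 0
    · subst hg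
      rw [Q.unique hQ Q.zero]
      exact P.zero
    · exact absurd (Q.unique (by simpa [hg] using Q.mul hQ (h _ _ h0)) Q.one) zero_ne_one

/-- The place `g ↦ P(v(g))`. -/
def comap (v : F ≃ₐ[K] F) : Place K F L where
  Val g c := P.Val (v g) c
  unique := P.unique
  add h₁ h₂ := by simpa using P.add h₁ h₂
  mul h₁ h₂ := by simpa using P.mul h₁ h₂
  const a := by simpa using P.const a
  total g := by simpa using P.total (v g)

end Place

variable {K L : Type u} [Field K] [Field L] [Algebra K L] {C : Over (Spec (.of K))} [IsCurve C]

/-- The uniqueness half of the valuative criterion: two points with the same ring give two lifts of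
one square, and each lift sends the closed point to its own point. -/
theorem stalkSubring_injective : Function.Injective (stalkSubring C) := by
  intro p p' h
  have := IsCurve.isProper (C := C)
  have huniq : ValuativeCriterion.Uniqueness C.hom := IsSeparated.valuativeCriterion _
  have hj : ∀ {q : C.left} (hq : stalkSubring C q = stalkSubring C p)
      (s : C.left.presheaf.stalk q), algebraMap (C.left.presheaf.stalk q) (FunctionField C) s ∈
        (stalkSubring C p).toSubring := fun hq s => by
    rw [← hq]
    exact ⟨s, rfl⟩
  let j : ∀ {q : C.left}, stalkSubring C q = stalkSubring C p →
      (C.left.presheaf.stalk q →+* stalkSubring C p) := fun hq =>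
    RingHom.codRestrict (algebraMap _ (FunctionField C)) (stalkSubring C p).toSubring (hj hq)
  have hl : ∀ {q : C.left} (hq : stalkSubring C q = stalkSubring C p), IsLocalHom (j hq) := by
    intro q hq
    refine ⟨fun s hs => ?_⟩
    obtain ⟨⟨_, ht⟩, h1⟩ := hs.exists_right_inv
    obtain ⟨t, rfl⟩ : _ ∈ stalkSubring C q := by
      rw [hq]
      exact ht
    refine .of_mul_eq_one t (IsFractionRing.injective (C.left.presheaf.stalk q) (FunctionField C) ?_)
    rw [map_mul, map_one]
    exact congrArg Subtype.val h1
  let k : K →+* stalkSubring C p := (algebraMap K (FunctionField C)).codRestrict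
    (stalkSubring C p).toSubring (algebraMap_mem_stalkSubring C p)
  have hsq : CommSq (C.left.fromSpecStalk (genericPoint C.left))
      (Spec.map (CommRingCat.ofHom (algebraMap (stalkSubring C p) (FunctionField C)))) C.hom
      (Spec.map (CommRingCat.ofHom k)) := by
    constructor
    exact (fromSpecStalk_comp_hom C _).trans (Spec.map_comp (CommRingCat.ofHom k)
      (CommRingCat.ofHom ((stalkSubring C p).subtype : stalkSubring C p →+* FunctionField C)))
  have hlift : ∀ {q : C.left} (hq : stalkSubring C q = stalkSubring C p), ∃ l : hsq.LiftStruct,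
      l.l = Spec.map (CommRingCat.ofHom (j hq)) ≫ C.left.fromSpecStalk q := by
    intro q hq
    refine ⟨⟨Spec.map (CommRingCat.ofHom (j hq)) ≫ C.left.fromSpecStalk q, ?_, ?_⟩, rfl⟩
    · rw [← SpecMap_algebraMap_fromSpecStalk C q, ← Category.assoc]
      exact congr($((Spec.map_comp (CommRingCat.ofHom (j hq)) (CommRingCat.ofHom
        ((stalkSubring C p).subtype : stalkSubring C p →+* FunctionField C))).symm) ≫ _)
    · rw [Category.assoc, fromSpecStalk_comp_hom]
      refine (Spec.map_comp (CommRingCat.ofHom (toStalk C q)) (CommRingCat.ofHom (j hq))).symm.trans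
        (congrArg Spec.map (congrArg CommRingCat.ofHom (RingHom.ext fun a =>
          Subtype.ext (algebraMap_toStalk C q a))))
  obtain ⟨l, h1⟩ := hlift rfl
  obtain ⟨l', h2⟩ := hlift h.symm
  obtain rfl := (huniq ⟨stalkSubring C p, FunctionField C, _, _, hsq⟩).elim l l'
  have hp : ∀ {q : C.left} (hq : stalkSubring C q = stalkSubring C p),
      (Spec.map (CommRingCat.ofHom (j hq)) ≫ C.left.fromSpecStalk q)
        (IsLocalRing.closedPoint (stalkSubring C p)) = q := by
    intro q hq
    have := hl hq
    have : IsLocalHom (CommRingCat.ofHom (j hq)).hom := this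
    refine (Scheme.Hom.comp_apply _ _ _).trans ?_
    exact (congrArg _ (Spec_closedPoint (f := CommRingCat.ofHom (j hq)))).trans
      Scheme.fromSpecStalk_closedPoint
  exact ((hp rfl).symm.trans (by rw [← h1, h2])).trans (hp h.symm)

/-- The relation "`g` is regular at `P` and has value `c` there". -/
def Points.Val (P : Points C L) (g : FunctionField C) (c : L) : Prop :=
  ∃ (p : C.left) (φ : C.left.presheaf.stalk p ⟶ .of L) (_ : IsLocalHom φ.hom),
    Spec.map φ ≫ C.left.fromSpecStalk p = P.left ∧
      ∃ s, algebraMap (C.left.presheaf.stalk p) (FunctionField C) s = g ∧ φ.hom s = c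

namespace Points

omit [IsCurve C] in
theorem exists_stalk (P : Points C L) : ∃ (p : C.left) (φ : C.left.presheaf.stalk p ⟶ .of L)
    (_ : IsLocalHom φ.hom), Spec.map φ ≫ C.left.fromSpecStalk p = P.left :=
  ⟨_, Scheme.stalkClosedPointTo P.left, inferInstance,
    Scheme.Spec_stalkClosedPointTo_fromSpecStalk P.left⟩

/-- A morphism from `Spec L` is the same as a point with a local homomorphism from its stalk, so
values may be computed in any such presentation of `P`. -/
theorem val_iff {P : Points C L} {p : C.left} {φ : C.left.presheaf.stalk p ⟶ .of L}
    (hφ : IsLocalHom φ.hom) (h : Spec.map φ ≫ C.left.fromSpecStalk p = P.left) {g c} :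
    P.Val g c ↔ ∃ s, algebraMap (C.left.presheaf.stalk p) (FunctionField C) s = g ∧ φ.hom s = c := by
  refine ⟨?_, fun hs => ⟨p, φ, hφ, h, hs⟩⟩
  rintro ⟨p', φ', hφ', h', hs⟩
  have := (SpecToEquivOfLocalRing C.left (.of L)).symm.injective
    (a₁ := ⟨p, φ, hφ⟩) (a₂ := ⟨p', φ', hφ'⟩) (h.trans h'.symm)
  obtain ⟨rfl, h2⟩ := Sigma.mk.inj_iff.1 this
  obtain rfl := congrArg Subtype.val (eq_of_heq h2)
  exact hs

omit [IsCurve C] in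
theorem toStalk_comp {P : Points C L} {p : C.left} {φ : C.left.presheaf.stalk p ⟶ .of L}
    (h : Spec.map φ ≫ C.left.fromSpecStalk p = P.left) (a : K) :
    φ.hom (toStalk C p a) = algebraMap K L a := by
  have h1 : Spec.map (CommRingCat.ofHom (toStalk C p) ≫ φ) =
      Spec.map (CommRingCat.ofHom (algebraMap K L)) := by
    rw [Spec.map_comp, ← fromSpecStalk_comp_hom, ← Category.assoc, h]
    exact Over.w P
  exact congr($(Spec.map_injective h1).hom a)

/-- The place of `K(C)` attached to a point. -/
def toPlace (P : Points C L) : Place K (FunctionField C) L where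
  Val := P.Val
  unique {g c c'} h h' := by
    obtain ⟨p, φ, hφ, hP⟩ := P.exists_stalk
    obtain ⟨s, rfl, rfl⟩ := (val_iff hφ hP).1 h
    obtain ⟨t, ht, rfl⟩ := (val_iff hφ hP).1 h'
    rw [IsFractionRing.injective (C.left.presheaf.stalk p) (FunctionField C) ht]
  add {g h c e} h₁ h₂ := by
    obtain ⟨p, φ, hφ, hP⟩ := P.exists_stalk
    obtain ⟨s, rfl, rfl⟩ := (val_iff hφ hP).1 h₁
    obtain ⟨t, rfl, rfl⟩ := (val_iff hφ hP).1 h₂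
    exact (val_iff hφ hP).2 ⟨s + t, map_add _ _ _, map_add _ _ _⟩
  mul {g h c e} h₁ h₂ := by
    obtain ⟨p, φ, hφ, hP⟩ := P.exists_stalk
    obtain ⟨s, rfl, rfl⟩ := (val_iff hφ hP).1 h₁
    obtain ⟨t, rfl, rfl⟩ := (val_iff hφ hP).1 h₂
    exact (val_iff hφ hP).2 ⟨s * t, map_mul _ _ _, map_mul _ _ _⟩
  const a := by
    obtain ⟨p, φ, hφ, hP⟩ := P.exists_stalk
    exact (val_iff hφ hP).2 ⟨_, algebraMap_toStalk C p a, toStalk_comp hP a⟩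
  total g := by
    obtain ⟨p, φ, hφ, hP⟩ := P.exists_stalk
    obtain ⟨s, hs⟩ | ⟨s, hs⟩ := (stalkSubring C p).mem_or_inv_mem g
    · exact Or.inl ⟨_, (val_iff hφ hP).2 ⟨s, hs, rfl⟩⟩
    · by_cases h0 : φ.hom s = 0
      · exact Or.inr ((val_iff hφ hP).2 ⟨s, hs, h0⟩)
      · have hu := (isUnit_map_iff φ.hom s).1 (isUnit_iff_ne_zero.2 h0)
        obtain ⟨t, ht⟩ := hu.exists_right_inv
        refine Or.inl ⟨_, (val_iff hφ hP).2 ⟨t, ?_, rfl⟩⟩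
        have := congr(algebraMap (C.left.presheaf.stalk p) (FunctionField C) $ht)
        rw [map_mul, hs, map_one] at this
        exact (eq_inv_of_mul_eq_one_right this).trans (inv_inv g)

theorem toPlace_comp (P : Points C L) (v : Aut C) :
    toPlace (P ≫ v.hom) = P.toPlace.comap (pullbackAlgEquiv v) := by
  refine Place.ext_of_le fun g c h => ?_
  obtain ⟨p, φ, hφ, hP⟩ := P.exists_stalk
  have h1 : IsLocalHom (v.hom.left.stalkMap p).hom := inferInstance
  have h2 : IsLocalHom (v.hom.left.stalkMap p ≫ φ).hom := RingHom.isLocalHom_comp _ _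
  have h3 : Spec.map (v.hom.left.stalkMap p ≫ φ) ≫ C.left.fromSpecStalk (v.hom.left p) =
      (P ≫ v.hom).left := by
    rw [Spec.map_comp, Category.assoc, Scheme.SpecMap_stalkMap_fromSpecStalk, ← Category.assoc, hP]
    rfl
  obtain ⟨s, rfl, rfl⟩ := (val_iff h2 h3).1 h
  refine (val_iff hφ hP).2 ⟨v.hom.left.stalkMap p s, ?_, rfl⟩
  exact (comapFunction_stalk v.hom (aut_genericPoint v) p s).symm

theorem val_map {L' : Type u} [Field L'] [Algebra K L'] (σ : L →ₐ[K] L') (P : Points C L) {g c}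
    (h : P.toPlace.Val g c) : (Points.map σ P).toPlace.Val g (σ c) := by
  obtain ⟨p, φ, hφ, hP⟩ := P.exists_stalk
  obtain ⟨s, rfl, rfl⟩ := (val_iff hφ hP).1 h
  have h1 : IsLocalHom (CommRingCat.ofHom σ.toRingHom).hom :=
    inferInstanceAs (IsLocalHom σ.toRingHom)
  have h2 : IsLocalHom (φ ≫ CommRingCat.ofHom σ.toRingHom).hom := RingHom.isLocalHom_comp _ _
  refine (val_iff h2 ?_).2 ⟨s, rfl, rfl⟩
  rw [Spec.map_comp, Category.assoc, hP]
  rfl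

/-- The ring of a place determines the point of the scheme, and the values determine the map from
its stalk to `L`. This turns `u(P) = P` into an equality of places. -/
theorem toPlace_injective : Function.Injective (toPlace : Points C L → _) := by
  intro P P' h
  have := IsCurve.isProper (C := C)
  obtain ⟨p, φ, hφ, hP⟩ := P.exists_stalk
  obtain ⟨p', φ', hφ', hP'⟩ := P'.exists_stalk
  have hval : ∀ g c, P.Val g c ↔ P'.Val g c := fun g c => by
    change P.toPlace.Val g c ↔ P'.toPlace.Val g c
    rw [h]
  have hmem : ∀ {q : C.left} {ψ : C.left.presheaf.stalk q ⟶ .of L} {R : Points C L}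
      (_ : IsLocalHom ψ.hom) (_ : Spec.map ψ ≫ C.left.fromSpecStalk q = R.left)
      (g : FunctionField C), g ∈ stalkSubring C q ↔ ∃ c, R.Val g c := by
    intro q ψ R h1 h2 g
    constructor
    · rintro ⟨s, hs⟩
      exact ⟨_, (val_iff h1 h2).2 ⟨s, hs, rfl⟩⟩
    · rintro ⟨c, hc⟩
      obtain ⟨s, hs, -⟩ := (val_iff h1 h2).1 hc
      exact ⟨s, hs⟩
  obtain rfl : p = p' := by
    refine stalkSubring_injective (SetLike.ext fun g => ?_)
    rw [hmem hφ hP, hmem hφ' hP']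
    simp only [hval]
  obtain rfl : φ = φ' := by
    ext s
    obtain ⟨t, ht, h2⟩ := (val_iff hφ' hP').1 ((hval _ _).1 ((val_iff hφ hP).2 ⟨s, rfl, rfl⟩))
    rw [← h2, IsFractionRing.injective (C.left.presheaf.stalk p) (FunctionField C) ht]
  exact Over.OverMorphism.ext (hP.symm.trans hP')

/-- Were all values in `K`, the map from the stalk to `L` would factor through `K` and define a
rational point inducing `P`. -/
theorem exists_val_notMem_range (P : Points C L)
    (hP : ¬ ∃ P₀ : Points C K, P = Points.map (Algebra.ofId K L) P₀) :
    ∃ g c, P.toPlace.Val g c ∧ c ∉ (algebraMap K L).range := by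
  by_contra! hcon
  apply hP
  obtain ⟨p, φ, hφ, h⟩ := P.exists_stalk
  have hr : ∀ s, φ.hom s ∈ (algebraMap K L).range := fun s =>
    hcon _ _ ((val_iff hφ h).2 ⟨s, rfl, rfl⟩)
  let e : K ≃+* (algebraMap K L).range := RingEquiv.ofBijective (algebraMap K L).rangeRestrict
    ⟨fun a b h => (algebraMap K L).injective (congrArg Subtype.val h),
      RingHom.rangeRestrict_surjective _⟩
  let ψ : C.left.presheaf.stalk p →+* K :=
    (e.symm : _ →+* K).comp (RingHom.codRestrict φ.hom _ hr)
  have hψ : ∀ s, algebraMap K L (ψ s) = φ.hom s := fun s =>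
    congrArg Subtype.val (e.apply_symm_apply ⟨φ.hom s, hr s⟩)
  have hψK : ∀ a, ψ (toStalk C p a) = a := fun a =>
    (algebraMap K L).injective ((hψ _).trans (toStalk_comp h a))
  refine ⟨Over.homMk (U := specOver K K) (Spec.map (CommRingCat.ofHom ψ) ≫
    C.left.fromSpecStalk p) ?_, ?_⟩
  · refine (Category.assoc _ _ _).trans ?_
    rw [fromSpecStalk_comp_hom]
    refine (Spec.map_comp (CommRingCat.ofHom (toStalk C p)) (CommRingCat.ofHom ψ)).symm.trans
      (congrArg Spec.map ?_)
    ext a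
    exact hψK a
  · refine Over.OverMorphism.ext (h.symm.trans ?_)
    refine Eq.trans ?_ (Category.assoc (Spec.map (CommRingCat.ofHom (algebraMap K L)))
      (Spec.map (CommRingCat.ofHom ψ)) (C.left.fromSpecStalk p))
    refine congr($(?_) ≫ _)
    refine Eq.trans (congrArg Spec.map ?_)
      (Spec.map_comp (CommRingCat.ofHom ψ) (CommRingCat.ofHom (algebraMap K L)))
    ext s
    exact (hψ s).symm

end Points

end
end GenusOne

/-! ### Function field of a quotient as a fixed field -/

namespace GenusOne
noncomputable section
variable {K : Type u} [Field K] {C Q : Over (Spec (.of K))} [IsCurve C]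

/-- Functions on `Q` near the image of the generic point of `C`, as elements of `K(C)`. -/
def evalGeneric (π : C ⟶ Q) (U : Q.left.Opens) (hU : π.left (genericPoint C.left) ∈ U) :
    Γ(Q.left, U) →+* FunctionField C :=
  (Q.left.presheaf.germ U _ hU ≫ π.left.stalkMap (genericPoint C.left)).hom

theorem evalGeneric_eq_germ (π : C ⟶ Q) (U : Q.left.Opens) (hU : π.left (genericPoint C.left) ∈ U)
    (s : Γ(Q.left, U)) : evalGeneric π U hU s =
      C.left.presheaf.germ (π.left ⁻¹ᵁ U) (genericPoint C.left) hU (π.left.app U s) :=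
  Scheme.Hom.germ_stalkMap_apply π.left U _ hU s

theorem evalGeneric_map (π : C ⟶ Q) {U V : Q.left.Opens} (i : V ⟶ U)
    (hV : π.left (genericPoint C.left) ∈ V) (s : Γ(Q.left, U)) :
    evalGeneric π V hV (Q.left.presheaf.map i.op s) = evalGeneric π U (i.le hV) s :=
  congrArg (π.left.stalkMap (genericPoint C.left)) (Q.left.presheaf.germ_res_apply i _ hV s)

theorem pullback_germ (v : Aut C) {U : C.left.Opens} (hU : genericPoint C.left ∈ U)
    (s : Γ(C.left, U)) {V : C.left.Opens} (hV : genericPoint C.left ∈ V)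
    (e : V ≤ v.hom.left ⁻¹ᵁ U) :
    pullback v (C.left.presheaf.germ U _ hU s) =
      C.left.presheaf.germ V _ hV (v.hom.left.appLE U V e s) := by
  have h1 : C.left.presheaf.germ V _ hV (v.hom.left.appLE U V e s) =
      C.left.presheaf.germ (v.hom.left ⁻¹ᵁ U) _ (e hV) (v.hom.left.app U s) :=
    C.left.presheaf.germ_res_apply (homOfLE e) _ hV _
  rw [h1, ← Scheme.Hom.germ_stalkMap_apply v.hom.left U (genericPoint C.left) (e hV) s]
  refine congrArg (v.hom.left.stalkMap (genericPoint C.left)) ?_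
  exact congr($(C.left.presheaf.germ_stalkSpecializes hU
    (specializes_of_eq (aut_genericPoint v))) s)

/-- An invariant function is regular on a `v`-stable open set, whose image in `Q` is open because
fibres are orbits. On a basic open `D(h)` inside that image the function descends to a section,
which is a fraction with denominator a power of `h`. `Q` is not required to be a curve, so the
result applies to `projectiveLine` directly. -/
theorem exists_evalGeneric_eq {v : Aut C} (hv : v * v = 1) {π : C ⟶ Q} (hπ : IsQuotient v π)
    {U : Q.left.Opens} (hU : IsAffineOpen U) (hgU : π.left (genericPoint C.left) ∈ U)
    {f : FunctionField C} (hf : pullback v f = f) :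
    ∃ a h : Γ(Q.left, U), evalGeneric π U hgU h ≠ 0 ∧
      f = evalGeneric π U hgU a / evalGeneric π U hgU h := by
  have hvv : ∀ x, v.hom.left (v.hom.left x) = x := fun x => by
    have : (v.hom ≫ v.hom).left x = x := congr(($hv).hom.left x)
    rwa [Over.comp_left, Scheme.Hom.comp_apply] at this
  obtain ⟨V, hV, s, rfl⟩ := C.left.presheaf.exists_germ_eq f
  let W := V ⊓ v.hom.left ⁻¹ᵁ V
  have hW : ∀ x, x ∈ W → v.hom.left x ∈ W := fun x hx => ⟨hx.2, by
    change v.hom.left (v.hom.left x) ∈ V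
    rw [hvv]
    exact hx.1⟩
  have hgW : genericPoint C.left ∈ W := ⟨hV, by
    change v.hom.left (genericPoint C.left) ∈ V
    rwa [aut_genericPoint]⟩
  have hpre : π.left ⁻¹' (π.left '' (W : Set C.left)) = W := by
    ext x
    constructor
    · rintro ⟨y, hy, hxy⟩
      obtain rfl | rfl := (hπ.fiber _ _).1 hxy.symm
      exacts [hy, by simpa using hW _ hy]
    · exact fun hx => ⟨x, hx, rfl⟩
  let O : Q.left.Opens := ⟨π.left '' (W : Set C.left), by
    rw [← hπ.isQuotientMap.isOpen_preimage, hpre]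
    exact W.isOpen⟩
  obtain ⟨h, hh, hgh⟩ := hU.exists_basicOpen_le (V := O)
    ⟨π.left (genericPoint C.left), Set.mem_image_of_mem _ hgW⟩ hgU
  set D := Q.left.basicOpen h
  have hDU : D ≤ U := Q.left.basicOpen_le h
  have hDV : π.left ⁻¹ᵁ D ≤ V := fun x hx =>
    (show x ∈ (W : Set C.left) from hpre ▸ hh hx).1
  have hgD : genericPoint C.left ∈ π.left ⁻¹ᵁ D := hgh
  let s' : Γ(C.left, π.left ⁻¹ᵁ D) := C.left.presheaf.map (homOfLE hDV).op s
  have hs' : C.left.presheaf.germ _ _ hgD s' = C.left.presheaf.germ V _ hV s :=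
    C.left.presheaf.germ_res_apply (homOfLE hDV) _ hgD s
  obtain ⟨t, ht⟩ := (hπ.range_app D s').2 (by
    apply germ_injective_of_isIntegral C.left (genericPoint C.left) hgD
    rw [← pullback_germ v hgD s' hgD, hs']
    exact hf)
  have htf : evalGeneric π D hgh t = C.left.presheaf.germ V _ hV s := by
    exact (evalGeneric_eq_germ π D hgh t).trans ((congrArg _ ht).trans hs')
  have hloc := hU.isLocalization_basicOpen h
  have hmap : ∀ r, evalGeneric π D hgh (algebraMap Γ(Q.left, U) Γ(Q.left, D) r) =
      evalGeneric π U hgU r := fun r => evalGeneric_map π (homOfLE hDU) hgh r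
  obtain ⟨⟨r, ⟨_, n, rfl⟩⟩, hr⟩ := IsLocalization.surj (Submonoid.powers h) t
  have hu := (IsLocalization.map_units Γ(Q.left, D) (⟨h, 1, pow_one h⟩ :
    Submonoid.powers h)).map (evalGeneric π D hgh)
  rw [hmap] at hu
  refine ⟨r, h ^ n, by simpa using pow_ne_zero n hu.ne_zero, ?_⟩
  rw [eq_div_iff (by simpa using pow_ne_zero n hu.ne_zero), ← htf, ← hmap, ← hmap, ← map_mul, hr]

theorem comp_evalGeneric (π : C ⟶ Q) {U : Q.left.Opens} (hU : IsAffineOpen U)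
    (hgU : π.left (genericPoint C.left) ∈ U) :
    C.left.fromSpecStalk (genericPoint C.left) ≫ π.left =
      Spec.map (CommRingCat.ofHom (evalGeneric π U hgU)) ≫ hU.fromSpec := by
  have h := hU.fromSpecStalk_eq_fromSpecStalk hgU
  rw [IsAffineOpen.fromSpecStalk] at h
  rw [← Scheme.SpecMap_stalkMap_fromSpecStalk, ← h, ← Category.assoc, ← Spec.map_comp]
  rfl

section
variable [IsCurve Q]

theorem IsQuotient.genericPoint {v : Aut C} {π : C ⟶ Q} (hπ : IsQuotient v π) :
    π.left (genericPoint C.left) = genericPoint Q.left := by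
  apply ((genericPoint_spec Q.left).eq _).symm
  have := (genericPoint_spec C.left).image π.left.continuous
  rwa [Set.image_univ, hπ.isQuotientMap.surjective.range_eq, closure_univ] at this

theorem IsQuotient.range_comapFunction {v : Aut C} (hv : v * v = 1) {π : C ⟶ Q}
    (hπ : IsQuotient v π) (f : FunctionField C) :
    f ∈ Set.range (comapFunction π hπ.genericPoint) ↔ pullback v f = f := by
  constructor
  · rintro ⟨g, rfl⟩
    have h : (pullback v).comp (comapFunction π hπ.genericPoint) =
        comapFunction π hπ.genericPoint := by
      refine eq_comapFunction π hπ.genericPoint ?_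
      refine (congr($(Spec.map_comp (CommRingCat.ofHom (comapFunction π hπ.genericPoint))
        (CommRingCat.ofHom (pullback v))) ≫ _)).trans ?_
      rw [Category.assoc]
      refine congr(_ ≫ $(SpecMap_comapFunction π hπ.genericPoint)).trans ?_
      rw [← Category.assoc]
      refine congr($(SpecMap_comapFunction v.hom (aut_genericPoint v)) ≫ _).trans ?_
      rw [Category.assoc, hπ.comp_eq]
    exact congr($h g)
  · intro hf
    obtain ⟨U, hU, hx⟩ : ∃ U : Q.left.Opens, IsAffineOpen U ∧ π.left (_root_.genericPoint C.left) ∈ U := by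
      obtain ⟨_, ⟨U, hU, rfl⟩, hx, -⟩ := Q.left.isBasis_affineOpens.exists_subset_of_mem_open
        (Set.mem_univ (π.left (_root_.genericPoint C.left))) isOpen_univ
      exact ⟨U, hU, hx⟩
    obtain ⟨a, h, h0, rfl⟩ := exists_evalGeneric_eq hv hπ hU hx hf
    have key : ∀ s, evalGeneric π U hx s = comapFunction π hπ.genericPoint
        (Q.left.presheaf.germ U _ (hπ.genericPoint ▸ hx) s) := fun s => by
      refine congrArg (π.left.stalkMap (_root_.genericPoint C.left)) ?_
      exact (congr($(Q.left.presheaf.germ_stalkSpecializes (hπ.genericPoint ▸ hx)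
        (specializes_of_eq hπ.genericPoint)) s)).symm
    refine ⟨Q.left.presheaf.germ U _ (hπ.genericPoint ▸ hx) a /
      Q.left.presheaf.germ U _ (hπ.genericPoint ▸ hx) h, ?_⟩
    rw [map_div₀, ← key, ← key]

end

end
end GenusOne

/-! ### The projective line: the fixed field is generated by one element -/

namespace GenusOne
noncomputable section

attribute [local instance] MvPolynomial.gradedAlgebra

open HomogeneousLocalization

theorem algebraMap_homogeneousSubmodule_zero_surjective (K : Type u) [Field K] :
    Function.Surjective (algebraMap K (MvPolynomial.homogeneousSubmodule (Fin 2) K 0)) := by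
  rintro ⟨p, hp⟩
  obtain ⟨c, rfl⟩ : ∃ c, MvPolynomial.C c = p := by
    have := (MvPolynomial.totalDegree_eq_zero_iff_eq_C).1 (Nat.le_zero.1
      ((MvPolynomial.mem_homogeneousSubmodule _ _).1 hp).totalDegree_le)
    exact ⟨_, this.symm⟩
  exact ⟨c, rfl⟩

theorem adjoin_range_X (K : Type u) [Field K] :
    Algebra.adjoin (MvPolynomial.homogeneousSubmodule (Fin 2) K 0)
      (Set.range (MvPolynomial.X : Fin 2 → MvPolynomial (Fin 2) K)) = ⊤ := by
  rw [eq_top_iff]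
  intro p _
  induction p using MvPolynomial.induction_on with
  | C c =>
    exact algebraMap_mem (Algebra.adjoin (MvPolynomial.homogeneousSubmodule (Fin 2) K 0) _)
      (algebraMap K (MvPolynomial.homogeneousSubmodule (Fin 2) K 0) c)
  | add p q hp hq => exact add_mem (hp trivial) (hq trivial)
  | mul_X p j hp => exact mul_mem (hp trivial) (Algebra.subset_adjoin ⟨j, rfl⟩)

theorem X_mem_homogeneousSubmodule (K : Type u) [Field K] (i : Fin 2) :
    (MvPolynomial.X i : MvPolynomial (Fin 2) K) ∈ MvPolynomial.homogeneousSubmodule (Fin 2) K 1 :=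
  MvPolynomial.isHomogeneous_X K i

/-- The generator is `T = X_{1-i} / X_i`: a monomial of degree `a` divided by `X_i ^ a` is a power
of `T`. -/
theorem exists_away_generator (K : Type u) [Field K] (i : Fin 2) :
    ∃ T : Away (MvPolynomial.homogeneousSubmodule (Fin 2) K) (MvPolynomial.X i),
      Algebra.adjoin (MvPolynomial.homogeneousSubmodule (Fin 2) K 0) {T} = ⊤ := by
  have h1 : ∀ j : Fin 2, (MvPolynomial.X j : MvPolynomial (Fin 2) K) ∈
    MvPolynomial.homogeneousSubmodule (Fin 2) K 1 := fun j => MvPolynomial.isHomogeneous_X K j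
  have := Away.adjoin_mk_prod_pow_eq_top (h1 i) _ MvPolynomial.X (adjoin_range_X K)
    (fun _ => 1) h1
  let T : Away (MvPolynomial.homogeneousSubmodule (Fin 2) K) (MvPolynomial.X i) :=
    Away.mk _ (h1 i) 1 (MvPolynomial.X (1 - i)) (by simpa using h1 (1 - i))
  refine ⟨T, ?_⟩
  rw [eq_top_iff, ← this, Algebra.adjoin_le_iff]
  rintro _ ⟨a, ai, hai, -, rfl⟩
  have h2 : a = ai i + ai (1 - i) := by
    fin_cases i <;> simpa [add_comm] using hai.symm
  have h3 : ∏ j, (MvPolynomial.X j : MvPolynomial (Fin 2) K) ^ ai j =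
      MvPolynomial.X i ^ ai i * MvPolynomial.X (1 - i) ^ ai (1 - i) := by
    fin_cases i <;> simp [mul_comm]
  refine (?_ : _ ∈ Algebra.adjoin (MvPolynomial.homogeneousSubmodule (Fin 2) K 0) {T})
  have key := pow_mem (Algebra.subset_adjoin (R := MvPolynomial.homogeneousSubmodule (Fin 2) K 0)
    (Set.mem_singleton T)) (ai (1 - i))
  refine (congrArg (· ∈ Algebra.adjoin (MvPolynomial.homogeneousSubmodule (Fin 2) K 0) {T})
    ?_).mpr key
  apply HomogeneousLocalization.val_injective
  rw [HomogeneousLocalization.val_pow, Away.val_mk, Away.val_mk, Localization.mk_pow,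
    Localization.mk_eq_mk_iff, Localization.r_iff_exists]
  refine ⟨1, ?_⟩
  simp only [OneMemClass.coe_one, one_mul, SubmonoidClass.mk_pow, pow_one, h3, h2, pow_add]
  ring

theorem isAffineOpen_basicOpen_X (K : Type u) [Field K] (i : Fin 2) : IsAffineOpen
    (Proj.basicOpen (MvPolynomial.homogeneousSubmodule (Fin 2) K) (MvPolynomial.X i)) :=
  Proj.isAffineOpen_basicOpen _ _ (X_mem_homogeneousSubmodule K i) one_pos

theorem fromSpec_toSpecZero (K : Type u) [Field K] (i : Fin 2) :
    (isAffineOpen_basicOpen_X K i).fromSpec ≫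
        Proj.toSpecZero (MvPolynomial.homogeneousSubmodule (Fin 2) K) =
      Spec.map (Proj.awayToSection _ (MvPolynomial.X i)) ≫
        Spec.map (CommRingCat.ofHom (fromZeroRingHom _ _)) := by
  rw [← Proj.awayι_toSpecZero _ _ (X_mem_homogeneousSubmodule K i) one_pos, ← Category.assoc]
  congr 1
  rw [← Proj.basicOpenIsoSpec_inv_ι, ← IsAffineOpen.isoSpec_inv_ι, Iso.inv_comp_eq,
    ← Category.assoc, ← Category.assoc, IsAffineOpen.isoSpec_hom]
  refine (Category.id_comp _).symm.trans congr($(?_) ≫ _)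
  rw [Iso.eq_comp_inv, Category.id_comp, Proj.basicOpenIsoSpec_hom]
  rfl

variable {K : Type u} [Field K] {C : Over (Spec (.of K))} [IsCurve C]

theorem evalGeneric_algebraMap {Q : Over (Spec (.of K))} (π : C ⟶ Q) {U : Q.left.Opens}
    (hU : IsAffineOpen U) (hgU : π.left (genericPoint C.left) ∈ U) {A : CommRingCat.{u}}
    (α : A ⟶ Γ(Q.left, U)) (β : CommRingCat.of K ⟶ A)
    (h : hU.fromSpec ≫ Q.hom = Spec.map α ≫ Spec.map β) (c : K) :
    evalGeneric π U hgU (α.hom (β.hom c)) = algebraMap K (FunctionField C) c := by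
  have h1 : C.left.fromSpecStalk (genericPoint C.left) ≫ C.hom =
      Spec.map (CommRingCat.ofHom (algebraMap K (FunctionField C))) :=
    fromSpecStalk_comp_hom C _
  have h2 : Spec.map (CommRingCat.ofHom (algebraMap K (FunctionField C))) =
      Spec.map (β ≫ α ≫ CommRingCat.ofHom (evalGeneric π U hgU)) := by
    rw [← h1, ← Over.w π, ← Category.assoc, comp_evalGeneric π hU hgU, Category.assoc, h,
      Spec.map_comp, Spec.map_comp, Category.assoc]
  exact congr($(Spec.map_injective h2).hom c).symm

theorem IsQuotient.pullback_evalGeneric {Q : Over (Spec (.of K))} {v : Aut C} {π : C ⟶ Q}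
    (hπ : IsQuotient v π) {U : Q.left.Opens} (hgU : π.left (_root_.genericPoint C.left) ∈ U)
    (s : Γ(Q.left, U)) :
    pullback v (evalGeneric π U hgU s) = evalGeneric π U hgU s := by
  rw [evalGeneric_eq_germ, pullback_germ v hgU _ hgU (by
    rw [← Scheme.Hom.comp_preimage, hπ.comp_eq]), (hπ.range_app U _).1 ⟨s, rfl⟩]

/-- Take for `t` the affine coordinate of a standard chart containing the image of the generic
point. Sections on the chart are polynomials in `t`, and invariant functions are quotients of
sections. -/
theorem exists_fixed_eq_adjoin {v : Aut C} (hv : v * v = 1) {π : C ⟶ projectiveLine K}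
    (hπ : IsQuotient v π) :
    ∃ t : FunctionField C, pullback v t = t ∧ ∀ f, pullback v f = f → f ∈ IntermediateField.adjoin K {t} := by
  obtain ⟨i, hi⟩ : ∃ i : Fin 2, π.left (genericPoint C.left) ∈
      Proj.basicOpen (MvPolynomial.homogeneousSubmodule (Fin 2) K) (MvPolynomial.X i) := by
    have := Proj.iSup_basicOpen_eq_top' (MvPolynomial.homogeneousSubmodule (Fin 2) K)
      MvPolynomial.X (fun i => ⟨1, X_mem_homogeneousSubmodule K i⟩) (adjoin_range_X K)
    have h := TopologicalSpace.Opens.mem_top (π.left (genericPoint C.left))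
    exact TopologicalSpace.Opens.mem_iSup.1 (this.ge h)
  obtain ⟨T, hT⟩ := exists_away_generator K i
  let θ : Away (MvPolynomial.homogeneousSubmodule (Fin 2) K) (MvPolynomial.X i) →+*
    FunctionField C := (evalGeneric π _ hi).comp (Proj.awayToSection _ _).hom
  have hθ : ∀ c : MvPolynomial.homogeneousSubmodule (Fin 2) K 0,
      θ (algebraMap _ _ c) ∈ IntermediateField.adjoin K {θ T} := by
    intro c
    obtain ⟨c, rfl⟩ := algebraMap_homogeneousSubmodule_zero_surjective K c
    suffices θ (algebraMap _ _ (algebraMap K _ c)) = algebraMap K (FunctionField C) c by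
      rw [this]
      exact algebraMap_mem _ c
    refine evalGeneric_algebraMap π (isAffineOpen_basicOpen_X K i) hi
      (Proj.awayToSection _ (MvPolynomial.X i)) (CommRingCat.ofHom (algebraMap K _) ≫
        CommRingCat.ofHom (fromZeroRingHom _ _)) ?_ c
    refine (Category.assoc _ _ _).symm.trans (congr($(fromSpec_toSpecZero K i) ≫ _).trans ?_)
    rw [Spec.map_comp]
    exact Category.assoc _ _ _
  have hmem : ∀ s, evalGeneric π _ hi s ∈ IntermediateField.adjoin K {θ T} := by
    intro s
    obtain ⟨z, rfl⟩ := ((ConcreteCategory.isIso_iff_bijective _).1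
      (Proj.basicOpenIsoAway _ _ (X_mem_homogeneousSubmodule K i) one_pos).isIso_hom).2 s
    have hz : z ∈ Algebra.adjoin (MvPolynomial.homogeneousSubmodule (Fin 2) K 0) {T} := hT ▸ trivial
    change θ z ∈ _
    induction hz using Algebra.adjoin_induction with
    | mem x hx => 
      rw [hx]
      exact IntermediateField.mem_adjoin_simple_self K _
    | algebraMap c => exact hθ c
    | add x y _ _ hx hy => rw [map_add]; exact add_mem hx hy
    | mul x y _ _ hx hy => rw [map_mul]; exact mul_mem hx hy
  refine ⟨θ T, hπ.pullback_evalGeneric hi _, fun f hf => ?_⟩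
  obtain ⟨a, h, -, rfl⟩ := exists_evalGeneric_eq hv hπ (isAffineOpen_basicOpen_X K i) hi hf
  exact div_mem (hmem a) (hmem h)

end
end GenusOne

/-! ### Double covers `y² = f(x)`: coordinate ring and valuation rings -/

namespace GenusOne
noncomputable section
open Polynomial

/-- An extension whose base contains all fixed elements of some involution is separable in
characteristic different from two. -/
theorem isSeparable_of_involution {E F : Type*} [Field E] [Field F] [Algebra E F] (τ : F →+* F)
    (h2 : ∀ g, τ (τ g) = g)
    (h3 : ∀ g, τ g = g → g ∈ Set.range (algebraMap E F)) : Algebra.IsSeparable E F := by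
  refine ⟨fun g => ?_⟩
  by_cases hg : τ g = g
  · obtain ⟨a, rfl⟩ := h3 g hg
    exact isSeparable_algebraMap a
  obtain ⟨a, ha⟩ := h3 (g + τ g) (by rw [map_add, h2, add_comm])
  obtain ⟨b, hb⟩ := h3 (g * τ g) (by rw [map_mul, h2, mul_comm])
  have hp : (X ^ 2 - C a * X + C b : E[X]).map (algebraMap E F) = (X - C g) * (X - C (τ g)) := by
    simp only [Polynomial.map_add, Polynomial.map_sub, Polynomial.map_mul, Polynomial.map_pow,
      map_X, map_C, ha, hb, C_add, C_mul]
    ring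
  have hs : (X ^ 2 - C a * X + C b : E[X]).Separable := by
    rw [← separable_map (algebraMap E F), hp]
    exact separable_X_sub_C.mul separable_X_sub_C (isCoprime_X_sub_C_of_isUnit_sub
      (isUnit_iff_ne_zero.2 (sub_ne_zero.2 (Ne.symm hg))))
  refine hs.of_dvd (minpoly.dvd _ _ ?_)
  rw [← eval_map_algebraMap, hp]
  simp

variable {K F : Type*} [Field K] [Field F] [Algebra K F]

/-- `F` is the function field of the curve `y² = f(x)`, with hyperelliptic involution `w`. -/
structure DoubleCover (w : F ≃ₐ[K] F) (x y : F) (f : K[X]) : Prop where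
  two : (2 : K) ≠ 0
  transc : Transcendental K x
  sq : y ^ 2 = aeval x f
  squarefree : Squarefree f
  involutive : ∀ g, w (w g) = g
  map_x : w x = x
  map_y : w y = -y
  fixed : ∀ g, w g = g → ∃ p q : K[X], q ≠ 0 ∧ g = aeval x p / aeval x q

namespace DoubleCover

variable {w : F ≃ₐ[K] F} {x y : F} {f : K[X]} (M : DoubleCover w x y f)
include M

theorem two' : (2 : F) ≠ 0 := by
  simpa only [map_ofNat] using (map_ne_zero (algebraMap K F)).2 M.two

theorem aeval_ne_zero {p : K[X]} (hp : p ≠ 0) : aeval x p ≠ 0 :=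
  fun h => M.transc ⟨p, hp, h⟩

theorem aeval_inj {p q : K[X]} (h : aeval x p = aeval x q) : p = q :=
  (transcendental_iff_injective.1 M.transc) h

theorem y_ne_zero : y ≠ 0 := by
  rintro rfl
  exact M.aeval_ne_zero M.squarefree.ne_zero (by simp [← M.sq])

theorem map_aeval (p : K[X]) : w (aeval x p) = aeval x p := by
  rw [← aeval_algHom_apply, M.map_x]

theorem eq_of_eq {p q r s : K[X]}
    (h : aeval x p + aeval x q * y = aeval x r + aeval x s * y) : p = r ∧ q = s := by
  have h' := congrArg w h
  simp only [map_add, map_mul, M.map_aeval, M.map_y] at h'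
  have h2 := M.two'
  refine ⟨M.aeval_inj (mul_left_cancel₀ h2 ?_),
    M.aeval_inj (mul_left_cancel₀ (mul_ne_zero h2 M.y_ne_zero) ?_)⟩
  · linear_combination h + h'
  · linear_combination h - h'

theorem exists_eq (g : F) : ∃ α β γ : K[X], γ ≠ 0 ∧
    g = (aeval x α + aeval x β * y) / aeval x γ := by
  have h2 := M.two'
  have hy := M.y_ne_zero
  obtain ⟨p, q, hq, h⟩ := M.fixed (g + w g) (by rw [map_add, M.involutive, add_comm])
  obtain ⟨r, s, hs, h'⟩ := M.fixed ((g - w g) / y) (by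
    rw [map_div₀, map_sub, M.involutive, M.map_y, div_neg, ← neg_div, neg_sub])
  refine ⟨p * s, r * q, C 2 * (q * s), mul_ne_zero (C_ne_zero.2 M.two) (mul_ne_zero hq hs), ?_⟩
  have hq' := M.aeval_ne_zero hq
  have hs' := M.aeval_ne_zero hs
  rw [div_eq_div_iff hy hs'] at h'
  rw [eq_div_iff hq'] at h
  rw [eq_div_iff (M.aeval_ne_zero (mul_ne_zero (C_ne_zero.2 M.two) (mul_ne_zero hq hs)))]
  simp only [map_mul, map_ofNat]
  linear_combination aeval x s * h + aeval x q * h'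

end DoubleCover

/-- `F` as a `K[X]`-algebra through `X ↦ x`. -/
abbrev polyAlgebra (K : Type*) {F : Type*} [Field K] [Field F] [Algebra K F] (x : F) :
    Algebra K[X] F :=
  (aeval x : K[X] →ₐ[K] F).toRingHom.toAlgebra

/-- `F` as a `K(X)`-algebra through `X ↦ x`. -/
abbrev ratAlgebra {x : F} (hx : Transcendental K x) : Algebra (RatFunc K) F :=
  (IsFractionRing.lift (A := K[X]) (K := RatFunc K) (g := (aeval x : K[X] →ₐ[K] F).toRingHom)
    (transcendental_iff_injective.1 hx)).toAlgebra

theorem isScalarTower_polyAlgebra (x : F) :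
    letI := polyAlgebra K x
    IsScalarTower K K[X] F :=
  letI := polyAlgebra K x
  .of_algebraMap_eq fun a => (aeval_C x a).symm

theorem isScalarTower_ratAlgebra {x : F} (hx : Transcendental K x) :
    letI := polyAlgebra K x
    letI := ratAlgebra hx
    IsScalarTower K[X] (RatFunc K) F :=
  letI := polyAlgebra K x
  letI := ratAlgebra hx
  .of_algebraMap_eq fun p => (IsFractionRing.lift_algebraMap (A := K[X]) (K := RatFunc K)
    (g := (aeval x : K[X] →ₐ[K] F).toRingHom) (transcendental_iff_injective.1 hx) p).symm

theorem mem_range_ratAlgebra {x : F} (hx : Transcendental K x) (p q : K[X]) :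
    letI := ratAlgebra hx
    aeval x p / aeval x q ∈ Set.range (algebraMap (RatFunc K) F) := by
  let := polyAlgebra K x
  let := ratAlgebra hx
  have := isScalarTower_ratAlgebra hx
  refine ⟨algebraMap _ _ p / algebraMap _ _ q, ?_⟩
  rw [map_div₀, ← IsScalarTower.algebraMap_apply, ← IsScalarTower.algebraMap_apply]
  rfl

/-- An element of `K(x)` which is integral over `K[x]` is a polynomial in `x`. -/
theorem exists_eq_aeval {x : F} (hx : Transcendental K x) {p q : K[X]}
    (h : (aeval x : K[X] →ₐ[K] F).toRingHom.IsIntegralElem (aeval x p / aeval x q)) :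
    ∃ r : K[X], aeval x p / aeval x q = aeval x r := by
  let := polyAlgebra K x
  let := ratAlgebra hx
  have := isScalarTower_ratAlgebra hx
  obtain ⟨ρ, hρ⟩ := mem_range_ratAlgebra hx p q
  rw [← hρ] at h ⊢
  have h1 : IsIntegral K[X] ρ :=
    (isIntegral_algHom_iff (IsScalarTower.toAlgHom K[X] (RatFunc K) F)
    (algebraMap (RatFunc K) F).injective (x := ρ)).1 h
  obtain ⟨r, rfl⟩ := IsIntegrallyClosed.isIntegral_iff.1 h1
  exact ⟨r, (IsScalarTower.algebraMap_apply K[X] (RatFunc K) F r).symm⟩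

theorem isIntegralElem_aeval (x : F) (p : K[X]) :
    (aeval x : K[X] →ₐ[K] F).toRingHom.IsIntegralElem (aeval x p) :=
  RingHom.isIntegralElem_map (aeval x : K[X] →ₐ[K] F).toRingHom

theorem mem_of_isIntegralElem {x : F} {V : ValuationSubring F} (hV : ∀ a, algebraMap K F a ∈ V)
    (hx : x ∈ V) {g : F} (hg : (aeval x : K[X] →ₐ[K] F).toRingHom.IsIntegralElem g) : g ∈ V := by
  have haeval : ∀ p : K[X], aeval x p ∈ V := fun p => by
    induction p using Polynomial.induction_on' with
    | add p q hp hq => rw [map_add]; exact V.add_mem _ _ hp hq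
    | monomial n a =>
      rw [aeval_monomial]
      exact V.mul_mem _ _ (hV a) (V.toSubring.pow_mem hx n)
  obtain ⟨p, hp, h⟩ := hg
  let j : K[X] →+* V := (aeval x : K[X] →ₐ[K] F).toRingHom.codRestrict V.toSubring haeval
  have hi : IsIntegral V g := ⟨p.map j, hp.map j, by
    rw [eval₂_map]
    exact h⟩
  obtain ⟨v, rfl⟩ := IsIntegrallyClosed.isIntegral_iff.1 hi
  exact v.2

/-- The valuation rings containing a Dedekind domain are its localizations. -/
theorem exists_eq_div_of_isDedekindDomain {A F : Type*} [Field F] [CommRing A]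
    [IsDedekindDomain A] [Algebra A F] [IsFractionRing A F] (V : ValuationSubring F)
    (hV : ∀ a, algebraMap A F a ∈ V) {g : F} (hg : g ∈ V) :
    ∃ a s : A, s ≠ 0 ∧ (algebraMap A F s)⁻¹ ∈ V ∧ g = algebraMap A F a / algebraMap A F s := by
  have hinj := IsFractionRing.injective A F
  have h0 : ∀ {a : A}, a ≠ 0 → algebraMap A F a ≠ 0 := fun ha =>
    (map_ne_zero_iff _ hinj).2 ha
  obtain ⟨a, b, hb, rfl⟩ := IsFractionRing.div_surjective (A := A) g
  have hb0 : b ≠ 0 := nonZeroDivisors.ne_zero hb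
  let i : A →+* V := (algebraMap A F).codRestrict V.toSubring hV
  let P : Ideal A := (IsLocalRing.maximalIdeal V).comap i
  have hP : ∀ {s : A}, s ∉ P → s ≠ 0 ∧ (algebraMap A F s)⁻¹ ∈ V := by
    intro s hs
    have hu : IsUnit (i s) := by
      by_contra h
      exact hs ((IsLocalRing.mem_maximalIdeal _).2 h)
    obtain ⟨t, ht⟩ := hu.exists_right_inv
    have ht' : algebraMap A F s * t = 1 := congrArg Subtype.val ht
    refine ⟨?_, ?_⟩
    · rintro rfl
      exact hs (zero_mem P)
    · rw [← eq_inv_of_mul_eq_one_right ht']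
      exact t.2
  by_cases hP0 : P = ⊥
  · have hbP : b ∉ P := by rwa [hP0, Ideal.mem_bot]
    exact ⟨a, b, hb0, (hP hbP).2, rfl⟩
  have := IsLocalization.AtPrime.isDiscreteValuationRing_of_dedekind_domain A hP0
    (Localization.AtPrime P)
  have hi := IsLocalization.injective (Localization.AtPrime P) P.primeCompl_le_nonZeroDivisors
  obtain ⟨c, hc⟩ | ⟨c, hc⟩ := ValuationRing.dvd_total (algebraMap A (Localization.AtPrime P) a)
    (algebraMap A (Localization.AtPrime P) b)
  -- If `a` divides `b` in the localization, then `g = a / b = s / a'` with `s` outside `P`. The new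
  -- denominator is invertible in `V` because `a'⁻¹ = g * s⁻¹`.
  · obtain ⟨⟨a', s⟩, hs⟩ := IsLocalization.surj P.primeCompl c
    have h1 : b * s = a * a' := hi (by
      rw [map_mul, map_mul, hc, mul_assoc]
      exact congrArg _ hs)
    have hs' := hP s.2
    have ha' : a' ≠ 0 := by
      rintro rfl
      rw [mul_zero] at h1
      exact mul_ne_zero hb0 hs'.1 h1
    have h2 := congrArg (algebraMap A F) h1
    rw [map_mul, map_mul] at h2
    refine ⟨s, a', ha', ?_, ?_⟩
    · have h3 : (algebraMap A F a')⁻¹ = algebraMap A F a / algebraMap A F b *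
          (algebraMap A F (s : A))⁻¹ := by
        field_simp [h0 hb0, h0 ha', h0 hs'.1]
        rw [h2, mul_comm]
      rw [h3]
      exact V.mul_mem _ _ hg hs'.2
    · field_simp [h0 hb0, h0 ha']
      exact h2.symm
  · obtain ⟨⟨a', s⟩, hs⟩ := IsLocalization.surj P.primeCompl c
    have h1 : a * s = b * a' := hi (by
      rw [map_mul, map_mul, hc, mul_assoc]
      exact congrArg _ hs)
    have hs' := hP s.2
    have h2 := congrArg (algebraMap A F) h1
    rw [map_mul, map_mul] at h2
    refine ⟨a', s, hs'.1, hs'.2, ?_⟩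
    rw [div_eq_div_iff (h0 hb0) (h0 hs'.1), h2, mul_comm]

namespace DoubleCover

variable {w : F ≃ₐ[K] F} {x y : F} {f : K[X]} (M : DoubleCover w x y f)
include M

theorem isSeparable :
    letI := ratAlgebra M.transc
    Algebra.IsSeparable (RatFunc K) F := by
  let := ratAlgebra M.transc
  refine isSeparable_of_involution w.toRingEquiv.toRingHom M.involutive fun g hg => ?_
  obtain ⟨p, q, -, rfl⟩ := M.fixed g hg
  exact mem_range_ratAlgebra M.transc p q

theorem finiteDimensional :
    letI := ratAlgebra M.transc
    FiniteDimensional (RatFunc K) F := by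
  let := ratAlgebra M.transc
  refine ⟨⟨(insert 1 (Singleton.singleton y) : Set F).toFinite.toFinset, ?_⟩⟩
  rw [_root_.eq_top_iff]
  rintro g -
  obtain ⟨α, β, γ, -, rfl⟩ := M.exists_eq g
  obtain ⟨a, ha⟩ := mem_range_ratAlgebra M.transc α γ
  obtain ⟨b, hb⟩ := mem_range_ratAlgebra M.transc β γ
  rw [Set.Finite.coe_toFinset, Submodule.mem_span_pair]
  refine ⟨a, b, ?_⟩
  rw [Algebra.smul_def, Algebra.smul_def, ha, hb]
  ring

theorem isIntegralElem_y : (aeval x : K[X] →ₐ[K] F).toRingHom.IsIntegralElem y := by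
  refine ⟨X ^ 2 - C f, monic_X_pow_sub_C f two_ne_zero, ?_⟩
  simp [M.sq]

theorem isIntegralElem_map {g : F} (hg : (aeval x : K[X] →ₐ[K] F).toRingHom.IsIntegralElem g) :
    (aeval x : K[X] →ₐ[K] F).toRingHom.IsIntegralElem (w g) := by
  obtain ⟨p, hp, h⟩ := hg
  refine ⟨p, hp, ?_⟩
  have h1 := congrArg w h
  rw [map_zero] at h1
  rw [← h1]
  refine Eq.trans ?_ (hom_eval₂ p _ w.toRingEquiv.toRingHom g).symm
  congr 1
  ext a
  exacts [(M.map_aeval (C a)).symm, (M.map_aeval X).symm]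

/-- Squarefreeness of `f` makes `K[x, y]` integrally closed. For integral `g` the trace `g + w g` is
a polynomial in `x`. Writing `g - w g = (r/s) y`, both `R = (r/s) f` and `N = (r/s)² f` are
polynomials with `R² = f N`; hence `f` divides `R`, and `r/s` is a polynomial. -/
theorem isIntegralElem_iff {g : F} : (aeval x : K[X] →ₐ[K] F).toRingHom.IsIntegralElem g ↔
    ∃ α β : K[X], g = aeval x α + aeval x β * y := by
  constructor
  · intro hg
    have h2 := M.two'
    have hy := M.y_ne_zero
    obtain ⟨p, q, hq, h⟩ := M.fixed (g + w g) (by rw [map_add, M.involutive, add_comm])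
    obtain ⟨r, s, hs, h'⟩ := M.fixed ((g - w g) / y) (by
      rw [map_div₀, map_sub, M.involutive, M.map_y, div_neg, ← neg_div, neg_sub])
    obtain ⟨α, hα⟩ := exists_eq_aeval (K := K) (p := p) (q := q) M.transc (by
      rw [← h]
      exact RingHom.IsIntegralElem.add _ hg (M.isIntegralElem_map hg))
    have hs' := M.aeval_ne_zero hs
    have hb : g - w g = aeval x r / aeval x s * y := by rw [← h', div_mul_cancel₀ _ hy]
    have hi : (aeval x : K[X] →ₐ[K] F).toRingHom.IsIntegralElem (g - w g) :=
      RingHom.IsIntegralElem.sub _ hg (M.isIntegralElem_map hg)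
    obtain ⟨R, hR⟩ := exists_eq_aeval (K := K) (p := r * f) (q := s) M.transc (by
      have : aeval x (r * f) / aeval x s = (g - w g) * y := by
        rw [hb, map_mul, ← M.sq]
        ring
      rw [this]
      exact RingHom.IsIntegralElem.mul _ hi M.isIntegralElem_y)
    obtain ⟨N, hN⟩ := exists_eq_aeval (K := K) (p := r * r * f) (q := s * s) M.transc (by
      have : aeval x (r * r * f) / aeval x (s * s) = (g - w g) * (g - w g) := by
        rw [hb, map_mul, map_mul, map_mul, ← M.sq]
        ring
      rw [this]
      exact RingHom.IsIntegralElem.mul _ hi hi)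
    have hRN : R ^ 2 = f * N := by
      refine M.aeval_inj ?_
      rw [map_pow, map_mul, ← hR, ← hN]
      simp only [map_mul]
      field_simp
    obtain ⟨β, rfl⟩ := (M.squarefree.dvd_pow_iff_dvd two_ne_zero).1 (Dvd.intro _ hRN.symm)
    have hβ : g - w g = aeval x β * y := by
      rw [hb]
      congr 1
      refine mul_left_cancel₀ (M.aeval_ne_zero M.squarefree.ne_zero) ?_
      rw [← map_mul, ← hR, map_mul]
      ring
    refine ⟨C 2⁻¹ * α, C 2⁻¹ * β, ?_⟩
    rw [hα] at h
    simp only [map_mul, aeval_C, map_inv₀, map_ofNat]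
    field_simp
    linear_combination h + hβ
  · rintro ⟨α, β, rfl⟩
    exact RingHom.IsIntegralElem.add _ (isIntegralElem_aeval x α)
      (RingHom.IsIntegralElem.mul _ (isIntegralElem_aeval x β) M.isIntegralElem_y)

/-- The coordinate ring `K[x, y]`. -/
theorem isDedekindDomain :
    letI := polyAlgebra K x
    IsDedekindDomain (integralClosure K[X] F) := by
  let := polyAlgebra K x
  let := ratAlgebra M.transc
  have := isScalarTower_ratAlgebra M.transc
  have := M.isSeparable
  have := M.finiteDimensional
  exact integralClosure.isDedekindDomain K[X] (RatFunc K) F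

theorem exists_eq_div {V : ValuationSubring F} (hV : ∀ a, algebraMap K F a ∈ V)
    (hx : x ∈ V) {g : F} (hg : g ∈ V) : ∃ α β γ δ : K[X],
      aeval x γ + aeval x δ * y ≠ 0 ∧ (aeval x γ + aeval x δ * y)⁻¹ ∈ V ∧
      g = (aeval x α + aeval x β * y) / (aeval x γ + aeval x δ * y) := by
  let := polyAlgebra K x
  let := ratAlgebra M.transc
  have := isScalarTower_ratAlgebra M.transc
  have := M.finiteDimensional
  have := M.isDedekindDomain
  have := integralClosure.isFractionRing_of_finite_extension (A := K[X]) (RatFunc K) F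
  obtain ⟨a, s, hs0, hs, rfl⟩ := exists_eq_div_of_isDedekindDomain (A := integralClosure K[X] F) V
    (fun a => show (a : F) ∈ V from mem_of_isIntegralElem hV hx a.2) hg
  obtain ⟨α, β, h⟩ := M.isIntegralElem_iff.1 a.2
  obtain ⟨γ, δ, h'⟩ := M.isIntegralElem_iff.1 s.2
  refine ⟨α, β, γ, δ, ?_, ?_, ?_⟩
  · rw [← h']
    exact fun h => hs0 (Subtype.ext h)
  · rw [← h']
    exact hs
  · rw [← h, ← h']
    rfl

/-- An element contained in all valuation rings containing `K[x]` lies in `K[x, y]`. -/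
theorem exists_eq_of_forall_mem {g : F}
    (hg : ∀ V : ValuationSubring F, (∀ a, algebraMap K F a ∈ V) → x ∈ V → g ∈ V) :
    ∃ α β : K[X], g = aeval x α + aeval x β * y := by
  let := polyAlgebra K x
  by_contra h
  have hA : g ∉ (integralClosure K[X] F).toSubring := fun hg => h (M.isIntegralElem_iff.1 hg)
  have : IsIntegrallyClosedIn (integralClosure K[X] F).toSubring F :=
    inferInstanceAs (IsIntegrallyClosedIn (integralClosure K[X] F) F)
  obtain ⟨V, hV, hgV⟩ := Subring.exists_le_valuationSubring_of_isIntegrallyClosedIn hA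
  refine hgV (hg V (fun a => hV ?_) (hV ?_))
  · have := isIntegralElem_aeval x (C a)
    rwa [aeval_C] at this
  · have := isIntegralElem_aeval x (X : K[X])
    rwa [aeval_X] at this

end DoubleCover

end
end GenusOne

/-! ### Differentials on a double cover, and their absence when `deg f ≤ 2` -/

namespace GenusOne
noncomputable section
open Polynomial

variable {K F : Type*} [Field K] [Field F] [Algebra K F]

namespace DoubleCover

variable {w : F ≃ₐ[K] F} {x y : F} {f : K[X]} (M : DoubleCover w x y f)
include M

/-- `K[x] → K(x) → F` is a localization followed by a separable extension, hence formally étale, so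
`Ω[F⁄K]` is free on `dx`. -/
theorem exists_derivation : ∃ D : Derivation K F F, D x = 1 ∧
    ∀ ω, ω = D.liftKaehlerDifferential ω • KaehlerDifferential.D K F x := by
  let := polyAlgebra K x
  let := ratAlgebra M.transc
  have := isScalarTower_polyAlgebra (K := K) x
  have := isScalarTower_ratAlgebra M.transc
  have := M.isSeparable
  have h1 : Algebra.FormallyEtale K[X] (RatFunc K) :=
    Algebra.FormallyEtale.of_isLocalization (nonZeroDivisors K[X])
  have h2 : Algebra.FormallyEtale (RatFunc K) F := Algebra.FormallyEtale.of_isSeparable _ _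
  have h3 : Algebra.FormallyEtale K[X] F := Algebra.FormallyEtale.comp K[X] (RatFunc K) F
  let e : Ω[F⁄K] ≃ₗ[F] F := (KaehlerDifferential.tensorKaehlerEquivOfFormallyEtale K K[X] F).symm ≪≫ₗ
    TensorProduct.AlgebraTensorModule.congr (.refl F F) (KaehlerDifferential.polynomialEquiv K) ≪≫ₗ
    TensorProduct.AlgebraTensorModule.rid K[X] F F
  have he : e (KaehlerDifferential.D K F x) = 1 := by
    have : (KaehlerDifferential.tensorKaehlerEquivOfFormallyEtale K K[X] F).symm
        (KaehlerDifferential.D K F x) = 1 ⊗ₜ KaehlerDifferential.D K K[X] X := by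
      have := KaehlerDifferential.tensorKaehlerEquivOfFormallyEtale_symm_D_algebraMap K K[X] F X
      rwa [show algebraMap K[X] F X = x from aeval_X x] at this
    simp only [e, LinearEquiv.trans_apply, this]
    simp
  have hl : (e.toLinearMap.compDer (KaehlerDifferential.D K F)).liftKaehlerDifferential =
      e.toLinearMap := by
    exact Derivation.liftKaehlerDifferential_unique _ _ (Derivation.liftKaehlerDifferential_comp _)
  refine ⟨e.toLinearMap.compDer (KaehlerDifferential.D K F), he, fun ω => ?_⟩
  apply e.injective
  rw [hl, map_smul, he]
  simp

/-- The derivation `d/dx`. -/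
def diff : Derivation K F F := M.exists_derivation.choose

theorem diff_x : M.diff x = 1 := M.exists_derivation.choose_spec.1

/-- The quotient of a differential by `dx`. -/
def quot : Ω[F⁄K] →ₗ[F] F := M.diff.liftKaehlerDifferential

theorem eq_quot_smul (ω : Ω[F⁄K]) : ω = M.quot ω • KaehlerDifferential.D K F x :=
  M.exists_derivation.choose_spec.2 ω

theorem quot_D (g : F) : M.quot (KaehlerDifferential.D K F g) = M.diff g :=
  Derivation.liftKaehlerDifferential_comp_D M.diff g

theorem quot_injective : Function.Injective M.quot := fun ω η h => by
  rw [M.eq_quot_smul ω, h, ← M.eq_quot_smul η]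

theorem derivation_apply (D : Derivation K F F) (g : F) : D g = D x * M.diff g := by
  have := congrArg D.liftKaehlerDifferential (M.eq_quot_smul (KaehlerDifferential.D K F g))
  rwa [map_smul, Derivation.liftKaehlerDifferential_comp_D, Derivation.liftKaehlerDifferential_comp_D, M.quot_D, smul_eq_mul,
    mul_comm] at this

theorem diff_aeval (p : K[X]) : M.diff (aeval x p) = aeval x (derivative p) := by
  rw [Derivation.map_aeval, M.diff_x, smul_eq_mul, mul_one]

theorem two_mul_y_mul_diff_y : 2 * y * M.diff y = aeval x (derivative f) := by
  rw [← M.diff_aeval, ← M.sq, Derivation.leibniz_pow]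
  simp [mul_assoc]

end DoubleCover

theorem aeval_inv_reverse {x : F} (hx : x ≠ 0) (p : K[X]) :
    aeval x⁻¹ p.reverse * x ^ p.natDegree = aeval x p := by
  have : Invertible x := invertibleOfNonzero hx
  rw [aeval_def, aeval_def, ← invOf_eq_inv]
  exact eval₂_reverse_mul_pow _ x p

theorem aeval_inv_mul_pow {x : F} (hx : x ≠ 0) (p : K[X]) :
    aeval x⁻¹ p * x ^ p.natDegree = aeval x p.reverse := by
  have := aeval_inv_reverse (inv_ne_zero hx) p
  rw [inv_inv] at this
  refine (congrArg (· * _) this.symm).trans ?_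
  rw [inv_pow, inv_mul_cancel_right₀ (pow_ne_zero _ hx)]

/-- If `p²` divides the reverse of `f`, reversing again shows that the square of the reverse of `p`
divides `f`. The reverse of `f` has nonzero constant term, so `p` does too and keeps its degree when
reversed; hence `p` is a constant. -/
theorem squarefree_reverse {x : F} (hx : Transcendental K x) {f : K[X]} (hf : Squarefree f) :
    Squarefree f.reverse := by
  have hx0 : x ≠ 0 := fun h => hx (h ▸ isAlgebraic_zero)
  rintro p ⟨c, hc⟩
  have hc0 : f.reverse.coeff 0 ≠ 0 := by
    rw [coeff_zero_reverse]
    exact leadingCoeff_ne_zero.2 hf.ne_zero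
  have hf0 : f.reverse ≠ 0 := fun h => hc0 (by simp [h])
  have hp0 : p ≠ 0 := by
    rintro rfl
    simp [hc] at hf0
  have hcne : c ≠ 0 := by
    rintro rfl
    simp [hc] at hf0
  have hpc : p.coeff 0 ≠ 0 := by
    intro h
    simp [hc, mul_coeff_zero, h] at hc0
  have hdeg : f.reverse.natDegree = p.natDegree + p.natDegree + c.natDegree := by
    rw [hc, natDegree_mul (mul_ne_zero hp0 hp0) hcne, natDegree_mul hp0 hp0]
  -- Reversal lowers the degree by the order `k` of vanishing of `f` at `0`; `X ^ k` restores it.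
  obtain ⟨k, hk⟩ := Nat.exists_eq_add_of_le (reverse_natDegree_le f)
  have key : f = p.reverse * p.reverse * (c.reverse * X ^ k) := by
    refine transcendental_iff_injective.1 hx ?_
    rw [← aeval_inv_reverse hx0 f, hc, hk, hdeg]
    simp only [map_mul, map_pow, aeval_X, ← aeval_inv_mul_pow hx0 p, ← aeval_inv_mul_pow hx0 c]
    ring
  have hu := hf _ (Dvd.intro _ key.symm)
  have h0 : p.reverse.natDegree = 0 := natDegree_eq_zero_of_isUnit hu
  rw [reverse_natDegree, natTrailingDegree_eq_zero.2 (Or.inr hpc), Nat.sub_zero] at h0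
  rw [eq_C_of_natDegree_eq_zero h0]
  exact isUnit_C.2 (isUnit_iff_ne_zero.2 hpc)

namespace DoubleCover

variable {w : F ≃ₐ[K] F} {x y : F} {f : K[X]} (M : DoubleCover w x y f)
include M

theorem x_ne_zero : x ≠ 0 := fun h => M.transc (h ▸ isAlgebraic_zero)

/-- The chart at infinity. -/
theorem infinity {m : ℕ} (hm : f.natDegree = 2 * m) :
    DoubleCover w x⁻¹ (y / x ^ m) f.reverse where
  two := M.two
  transc h := M.transc (by simpa using h.inv)
  sq := by
    have := aeval_inv_reverse M.x_ne_zero f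
    rw [div_pow, M.sq, ← this, hm, ← pow_mul, mul_comm m, mul_div_cancel_right₀]
    exact pow_ne_zero _ M.x_ne_zero
  squarefree := squarefree_reverse M.transc M.squarefree
  involutive := M.involutive
  map_x := by rw [map_inv₀, M.map_x]
  map_y := by rw [map_div₀, map_pow, M.map_x, M.map_y, neg_div]
  fixed g hg := by
    have hx := M.x_ne_zero
    obtain ⟨p, q, hq, rfl⟩ := M.fixed g hg
    refine ⟨p.reverse * X ^ q.natDegree, q.reverse * X ^ p.natDegree,
      mul_ne_zero (by simpa using hq) (pow_ne_zero _ X_ne_zero), ?_⟩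
    have h : aeval x⁻¹ q.reverse ≠ 0 := fun h => M.aeval_ne_zero hq (by
      rw [← aeval_inv_reverse hx, h, zero_mul])
    rw [← aeval_inv_reverse hx p, ← aeval_inv_reverse hx q]
    simp only [map_mul, map_pow, aeval_X, inv_pow]
    field_simp

theorem quot_infinity {m : ℕ} (hm : f.natDegree = 2 * m) (ω : Ω[F⁄K]) :
    (M.infinity hm).quot ω = -x ^ 2 * M.quot ω := by
  have hx := M.x_ne_zero
  have h1 : (M.infinity hm).diff x = -x ^ 2 := by
    have h := (M.infinity hm).diff_x
    rw [Derivation.leibniz_inv, smul_eq_mul, inv_pow, neg_mul, neg_eq_iff_eq_neg,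
      inv_mul_eq_iff_eq_mul₀ (pow_ne_zero 2 hx)] at h
    rw [h]
    ring
  conv_lhs => rw [M.eq_quot_smul ω]
  rw [map_smul, quot_D, h1, smul_eq_mul, mul_comm]

/-- As `2y · dy/dx = f'(x)`, the derivation `2y d/dx` preserves `K[x, y]`; the quotient rule extends
this to `V`, whose elements are fractions with denominators invertible in `V`. -/
theorem two_mul_y_mul_diff_mem {V : ValuationSubring F} (hV : ∀ a, algebraMap K F a ∈ V)
    (hx : x ∈ V) {g : F} (hg : g ∈ V) : 2 * y * M.diff g ∈ V := by
  have hp : ∀ p : K[X], aeval x p ∈ V := fun p =>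
    mem_of_isIntegralElem hV hx (isIntegralElem_aeval x p)
  have hy : y ∈ V := mem_of_isIntegralElem hV hx M.isIntegralElem_y
  have h2 : (2 : F) ∈ V := by simpa only [map_ofNat] using hV 2
  have hA : ∀ α β : K[X], 2 * y * M.diff (aeval x α + aeval x β * y) ∈ V := by
    intro α β
    have : 2 * y * M.diff (aeval x α + aeval x β * y) = 2 * y * aeval x (derivative α) +
        2 * aeval x f * aeval x (derivative β) + aeval x β * aeval x (derivative f) := by
      rw [map_add, Derivation.leibniz, M.diff_aeval, M.diff_aeval, smul_eq_mul, smul_eq_mul,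
        ← M.two_mul_y_mul_diff_y, ← M.sq]
      ring
    rw [this]
    exact V.add_mem _ _ (V.add_mem _ _ (V.mul_mem _ _ (V.mul_mem _ _ h2 hy) (hp _))
      (V.mul_mem _ _ (V.mul_mem _ _ h2 (hp _)) (hp _))) (V.mul_mem _ _ (hp _) (hp _))
  obtain ⟨α, β, γ, δ, h0, hs, rfl⟩ := M.exists_eq_div hV hx hg
  set s := aeval x γ + aeval x δ * y with hs'
  set a := aeval x α + aeval x β * y with ha'
  have : 2 * y * M.diff (a / s) = s⁻¹ * (2 * y * M.diff a) - (a / s) * (s⁻¹ * (2 * y * M.diff s)) := by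
    rw [Derivation.leibniz_div, smul_eq_mul, smul_eq_mul, smul_eq_mul]
    field_simp
  rw [this]
  exact V.sub_mem (V.mul_mem _ _ hs (hA _ _)) (V.mul_mem _ _ hg (V.mul_mem _ _ hs (hA _ _)))

theorem two_mul_y_mul_quot_mem {V : ValuationSubring F} (hV : ∀ a, algebraMap K F a ∈ V)
    (hx : x ∈ V) {ω : Ω[F⁄K]} (hω : ω ∈ regDiff K F) : 2 * y * M.quot ω ∈ V := by
  have := (Submodule.mem_iInf _).1 ((Submodule.mem_iInf _).1 hω V) hV
  clear hω
  induction this using Submodule.span_induction with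
  | mem ω h =>
    obtain ⟨a, ha, b, hb, rfl⟩ := h
    rw [map_smul, M.quot_D, smul_eq_mul, mul_left_comm]
    exact V.mul_mem _ _ ha (M.two_mul_y_mul_diff_mem hV hx hb)
  | zero => rw [map_zero, mul_zero]; exact V.zero_mem
  | add ω η _ _ h h' => rw [map_add, mul_add]; exact V.add_mem _ _ h h'
  | smul c ω _ h =>
    rw [← algebraMap_smul F c ω, map_smul, smul_eq_mul, mul_left_comm]
    exact V.mul_mem _ _ (hV c) h

theorem add_mul_y_inj {a b c e : F} (ha : w a = a) (hb : w b = b) (hc : w c = c) (he : w e = e)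
    (h : a + b * y = c + e * y) : a = c ∧ b = e := by
  have h' := congrArg w h
  simp only [map_add, map_mul, M.map_y, ha, hb, hc, he] at h'
  have h2 := M.two'
  refine ⟨mul_left_cancel₀ h2 ?_, mul_left_cancel₀ (mul_ne_zero h2 M.y_ne_zero) ?_⟩
  · linear_combination h + h'
  · linear_combination h - h'

omit M in
theorem _root_.GenusOne.eq_zero_of_aeval_eq_inv_mul {x : F} (hx : Transcendental K x) {p q : K[X]}
    (h : aeval x p = x⁻¹ * aeval x⁻¹ q) : p = 0 := by
  have hx0 : x ≠ 0 := fun h => hx (h ▸ isAlgebraic_zero)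
  by_contra hp
  have key : p * X ^ (q.natDegree + 1) = q.reverse := by
    refine transcendental_iff_injective.1 hx ?_
    rw [map_mul, h, map_pow, aeval_X, ← aeval_inv_mul_pow hx0 q]
    linear_combination (aeval x⁻¹ q * x ^ q.natDegree) * inv_mul_cancel₀ hx0
  have := congrArg natDegree key
  rw [natDegree_mul hp (pow_ne_zero _ X_ne_zero), natDegree_X_pow] at this
  have := reverse_natDegree_le q
  omega

/-- On the finite chart `2y ω/dx = α(x) + β(x) y`; on the chart at infinity the analogous expression
has coefficients `γ, δ` in `K[1/x]`. Comparison gives `α = -x^(m-2) γ` and `β = -x^(-2) δ`. For `m ≤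
1` both right-hand sides are polynomials in `1/x` without constant term, so `α = β = 0`. -/
theorem regDiff_eq_bot {m : ℕ} (hm : f.natDegree = 2 * m) (hm1 : m ≤ 1) : regDiff K F = ⊥ := by
  rw [_root_.eq_bot_iff]
  intro ω hω
  rw [Submodule.mem_bot]
  apply M.quot_injective
  rw [map_zero]
  have hx := M.x_ne_zero
  have hy := M.y_ne_zero
  have h2 := M.two'
  obtain ⟨α, β, h⟩ := M.exists_eq_of_forall_mem fun V hV hxV => M.two_mul_y_mul_quot_mem hV hxV hω
  obtain ⟨γ, δ, h'⟩ := (M.infinity hm).exists_eq_of_forall_mem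
    fun V hV hxV => (M.infinity hm).two_mul_y_mul_quot_mem hV hxV hω
  rw [M.quot_infinity hm] at h'
  have hfix : ∀ (n : ℕ) (p : K[X]), w (-(x⁻¹ ^ n * aeval x⁻¹ p)) = -(x⁻¹ ^ n * aeval x⁻¹ p) :=
    fun n p => by rw [map_neg, map_mul, (M.infinity hm).map_aeval, map_pow, (M.infinity hm).map_x]
  obtain ⟨h1, h3⟩ := M.add_mul_y_inj (M.map_aeval α) (M.map_aeval β) (hfix (2 - m) γ) (hfix 2 δ) (by
    rw [← h]
    have hn : x ^ 2 = x ^ m * x ^ (2 - m) := by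
      rw [← pow_add]
      congr 1
      omega
    have hxm := pow_ne_zero m hx
    have hxn := pow_ne_zero (2 - m) hx
    have h4 : 2 * y * M.quot ω = -(x ^ m / x ^ 2) * (2 * (y / x ^ m) * (-x ^ 2 * M.quot ω)) := by
      field_simp
    rw [h4, h', inv_pow, inv_pow, hn]
    field_simp
    ring)
  have hα : α = 0 := eq_zero_of_aeval_eq_inv_mul (q := -(X ^ (1 - m) * γ)) M.transc (by
    rw [h1, show 2 - m = 1 - m + 1 by omega]
    simp only [map_neg, map_mul, map_pow, aeval_X]
    ring)
  have hβ : β = 0 := eq_zero_of_aeval_eq_inv_mul (q := -(X * δ)) M.transc (by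
    rw [h3]
    simp only [map_neg, map_mul, aeval_X]
    ring)
  rw [hα, hβ, map_zero, zero_mul, add_zero] at h
  exact (mul_eq_zero.1 h).resolve_left (mul_ne_zero h2 hy)

end DoubleCover

end
end GenusOne

/-! ### Smoothness of the curve makes `f` separable -/

namespace GenusOne
noncomputable section
open Polynomial IsLocalRing

variable {K F : Type*} [Field K] [Field F] [Algebra K F]

namespace DoubleCover

variable {w : F ≃ₐ[K] F} {x y : F} {f : K[X]} (M : DoubleCover w x y f)
include M

/-- At a point where `y` vanishes, the involution preserves the local ring and
`g ↦ (g - w g) / 2y` as well. -/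
theorem map_mem_and_div_mem {V : ValuationSubring F} (hV : ∀ a, algebraMap K F a ∈ V)
    (hx : x ∈ V) (Y : V) (hYy : (Y : F) = y) (hY : residue V Y = 0) {g : F} (hg : g ∈ V) :
    w g ∈ V ∧ (g - w g) / (2 * y) ∈ V := by
  have hp : ∀ p : K[X], aeval x p ∈ V := fun p =>
    mem_of_isIntegralElem hV hx (isIntegralElem_aeval x p)
  have hy : y ∈ V := hYy ▸ Y.2
  obtain ⟨α, β, γ, δ, h0, hs, rfl⟩ := M.exists_eq_div hV hx hg
  let S : V := ⟨aeval x γ, hp γ⟩ + ⟨aeval x δ, hp δ⟩ * Y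
  let T : V := ⟨aeval x γ, hp γ⟩ - ⟨aeval x δ, hp δ⟩ * Y
  have hS : (S : F) = aeval x γ + aeval x δ * y := by simp [S, hYy]
  have hT : (T : F) = aeval x γ - aeval x δ * y := by simp [T, hYy]
  have hSu : IsUnit S := .of_mul_eq_one ⟨_, hs⟩ (Subtype.ext (by
    simp only [MulMemClass.coe_mul, hS]
    exact mul_inv_cancel₀ h0))
  -- `S` and `T = w S` have the same residue, because `y` vanishes there.
  have hTu : IsUnit T := by
    rw [← residue_ne_zero_iff_isUnit] at hSu ⊢
    simpa [S, T, hY] using hSu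
  obtain ⟨T', hT'⟩ := hTu.exists_right_inv
  have hTT : (aeval x γ - aeval x δ * y) * T' = 1 := by
    rw [← hT]
    exact congrArg Subtype.val hT'
  have hTm : (aeval x γ - aeval x δ * y)⁻¹ ∈ V := by
    rw [← eq_inv_of_mul_eq_one_right hTT]
    exact T'.2
  have hT0 := left_ne_zero_of_mul_eq_one hTT
  have h1 : w ((aeval x α + aeval x β * y) / (aeval x γ + aeval x δ * y)) =
      (aeval x α - aeval x β * y) / (aeval x γ - aeval x δ * y) := by
    simp only [map_div₀, map_add, map_mul, M.map_aeval, M.map_y]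
    ring
  have h2 := M.two'
  have hy0 := M.y_ne_zero
  rw [h1]
  constructor
  · rw [div_eq_mul_inv]
    exact V.mul_mem _ _ (V.sub_mem (hp _) (V.mul_mem _ _ (hp _) hy)) hTm
  · have h3 : ((aeval x α + aeval x β * y) / (aeval x γ + aeval x δ * y) -
        (aeval x α - aeval x β * y) / (aeval x γ - aeval x δ * y)) / (2 * y) =
        (aeval x β * aeval x γ - aeval x α * aeval x δ) * (aeval x γ + aeval x δ * y)⁻¹ *
          (aeval x γ - aeval x δ * y)⁻¹ := by
      rw [div_sub_div _ _ h0 hT0, div_div, mul_assoc (_ - _), ← mul_inv, ← div_eq_mul_inv,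
        div_eq_div_iff (mul_ne_zero (mul_ne_zero h0 hT0) (mul_ne_zero h2 hy0)) (mul_ne_zero h0 hT0)]
      ring
    rw [h3]
    exact V.mul_mem _ _ (V.mul_mem _ _ (V.sub_mem (V.mul_mem _ _ (hp _) (hp _))
      (V.mul_mem _ _ (hp _) (hp _))) hs) hTm

/-- At a branch point `y` serves as a parameter: the derivation is the residue of `(g - w g) / 2y`,
a substitute for `d/dy`. -/
theorem exists_residue_derivation {V : ValuationSubring F} (hV : ∀ a, algebraMap K F a ∈ V)
    (hx : x ∈ V) (Y : V) (hYy : (Y : F) = y) (hY : residue V Y = 0) :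
    letI : Algebra K V := ((algebraMap K F).codRestrict V.toSubring hV).toAlgebra
    ∃ δ : Derivation K V (ResidueField V), δ ⟨x, hx⟩ = 0 ∧ δ Y = 1 := by
  let : Algebra K V := ((algebraMap K F).codRestrict V.toSubring hV).toAlgebra
  have h2 := M.two'
  have hy0 := M.y_ne_zero
  let ν : V → V := fun g => ⟨_, (M.map_mem_and_div_mem hV hx Y hYy hY g.2).2⟩
  have hν : ∀ g : V, (ν g : F) = ((g : F) - w g) / (2 * y) := fun _ => rfl
  let δ : V →ₗ[K] ResidueField V :=
    { toFun := fun g => residue V (ν g)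
      map_add' := fun g h => by
        rw [← map_add]
        congr 1
        apply Subtype.ext
        push_cast
        rw [hν, hν, hν]
        push_cast
        rw [map_add]
        ring
      map_smul' := fun c g => by
        have : ν (c • g) = c • ν g := by
          apply Subtype.ext
          rw [Algebra.smul_def, Algebra.smul_def, hν]
          push_cast
          rw [hν]
          have : ((algebraMap K V c : V) : F) = algebraMap K F c := rfl
          rw [this, map_mul, AlgEquiv.commutes]
          ring
        rw [this]
        rfl }
  have hδ : ∀ g, δ g = residue V (ν g) := fun _ => rfl
  refine ⟨Derivation.mk' δ fun g h => ?_, ?_, ?_⟩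
  · let wh : V := ⟨_, (M.map_mem_and_div_mem hV hx Y hYy hY h.2).1⟩
    have h3 : ν (g * h) = g * ν h + wh * ν g := by
      apply Subtype.ext
      push_cast
      rw [hν, hν, hν]
      push_cast
      rw [map_mul]
      change _ = _ + w h * _
      ring
    -- Since `h - w h = 2y ν(h)`, the involution is trivial on residues; this turns the twisted
    -- product rule `h3` into the Leibniz rule.
    have h4 : h = wh + (Y + Y) * ν h := by
      apply Subtype.ext
      push_cast
      rw [hν, hYy]
      change _ = w h + _
      rw [← two_mul, mul_div_cancel₀ _ (mul_ne_zero h2 hy0)]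
      ring
    have h5 : residue V h = residue V wh := by
      conv_lhs => rw [h4]
      rw [map_add, map_mul, map_add, hY, add_zero, zero_mul, add_zero]
    rw [hδ, hδ, hδ, h3, map_add, map_mul, map_mul, ← h5]
    rfl
  · change residue V (ν _) = 0
    have : ν ⟨x, hx⟩ = 0 := by
      apply Subtype.ext
      rw [hν]
      simp [M.map_x]
    rw [this, map_zero]
  · change residue V (ν _) = 1
    have : ν Y = 1 := by
      apply Subtype.ext
      rw [hν, hYy, M.map_y]
      field_simp
      push_cast
      ring
    rw [this, map_one]

/-- A common irreducible factor `q` of `f = q r` and `f'` is inseparable: `q' = 0`. At a place where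
`q` vanishes `r` is a unit, and `y² = q r` gives `2y dy = q r' dx = y² r⁻¹ r' dx`. Formal smoothness
makes the module of differentials of `V` projective, hence torsion-free, so `y` cancels: `2 dy = y
r⁻¹ r' dx`. The residue derivation, which sends `x` to `0` and `y` to `1`, yields `2 = 0`. -/
theorem isCoprime_derivative (hF : ∀ (V : ValuationSubring F) (hV : ∀ a, algebraMap K F a ∈ V),
    ((algebraMap K F).codRestrict V.toSubring hV).FormallySmooth) :
    IsCoprime f (derivative f) := by
  refine isCoprime_of_irreducible_dvd (fun h => M.squarefree.ne_zero h.1) fun q hq hqf hqf' => ?_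
  obtain ⟨r, rfl⟩ := hqf
  have hqr : ¬ q ∣ r := fun ⟨s, hs⟩ => hq.not_isUnit
    (M.squarefree q ⟨s, by rw [hs, mul_assoc]⟩)
  have hq' : derivative q = 0 := by
    rw [derivative_mul, dvd_add_left (Dvd.intro _ rfl)] at hqf'
    have h := (hq.prime.dvd_or_dvd hqf').resolve_right hqr
    by_contra h0
    have h1 := natDegree_le_of_dvd h h0
    have h3 : q.natDegree ≠ 0 := fun h3 => by
      rw [eq_C_of_natDegree_eq_zero h3] at h0
      simp at h0
    have := natDegree_derivative_lt h3
    omega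
  -- If `q(x)` were invertible at every finite place, its inverse would lie in `K[x, y]` and `q`
  -- would be a unit.
  obtain ⟨V, hV, hx, hqV⟩ : ∃ V : ValuationSubring F, (∀ a, algebraMap K F a ∈ V) ∧ x ∈ V ∧
      (aeval x q)⁻¹ ∉ V := by
    by_contra! h
    obtain ⟨α, β, h⟩ := M.exists_eq_of_forall_mem h
    obtain ⟨h1, -⟩ := M.eq_of_eq (p := 1) (q := 0) (r := q * α) (s := q * β) (by
      rw [map_mul, map_mul, map_one, map_zero, zero_mul, add_zero, mul_assoc, ← mul_add, ← h,
        mul_inv_cancel₀ (M.aeval_ne_zero hq.ne_zero)])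
    exact hq.not_isUnit (.of_mul_eq_one _ h1.symm)
  let : Algebra K V := ((algebraMap K F).codRestrict V.toSubring hV).toAlgebra
  have : Algebra.FormallySmooth K V := hF V hV
  have : Module.Projective V Ω[V⁄K] := Algebra.FormallySmooth.projective_kaehlerDifferential
  let Y : V := ⟨y, mem_of_isIntegralElem hV hx M.isIntegralElem_y⟩
  let ξ : V := ⟨x, hx⟩
  have hξ : ∀ p : K[X], ((aeval ξ p : V) : F) = aeval x p := fun p =>
    (aeval_algHom_apply (⟨V.subtype, fun _ => rfl⟩ : V →ₐ[K] F) ξ p).symm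
  have hsq : Y ^ 2 = aeval ξ q * aeval ξ r := by
    apply Subtype.ext
    push_cast
    rw [hξ, hξ, ← map_mul]
    exact M.sq
  have hqm : residue V (aeval ξ q) = 0 := by
    by_contra h
    obtain ⟨t, ht⟩ := ((residue_ne_zero_iff_isUnit _).1 h).exists_right_inv
    have ht' : aeval x q * t = 1 := by
      rw [← hξ]
      exact congrArg Subtype.val ht
    rw [← eq_inv_of_mul_eq_one_right ht'] at hqV
    exact hqV t.2
  have hY : residue V Y = 0 := by
    have := congrArg (residue V) hsq
    rw [map_pow, map_mul, hqm, zero_mul] at this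
    exact pow_eq_zero_iff two_ne_zero |>.1 this
  obtain ⟨R, hR⟩ : ∃ R, aeval ξ r * R = 1 := by
    refine IsUnit.exists_right_inv ((residue_ne_zero_iff_isUnit _).1 fun h => ?_)
    obtain ⟨a, b, hab⟩ := (hq.coprime_iff_not_dvd.2 hqr)
    have := congrArg (fun p => residue V (aeval ξ p)) hab
    simp [hqm, h] at this
  obtain ⟨δ, hδx, hδy⟩ := M.exists_residue_derivation hV hx Y rfl hY
  have hrel : Y • ((2 : V) • KaehlerDifferential.D K V Y -
      (Y * R * aeval ξ (derivative r)) • KaehlerDifferential.D K V ξ) = 0 := by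
    have h := congrArg (KaehlerDifferential.D K V) hsq
    rw [← map_mul, Derivation.map_aeval, derivative_mul, hq', zero_mul, zero_add, map_mul,
      Derivation.leibniz_pow] at h
    have h1 : Y * (Y * R * aeval ξ (derivative r)) = aeval ξ q * aeval ξ (derivative r) := by
      linear_combination (R * aeval ξ (derivative r)) * hsq +
        (aeval ξ q * aeval ξ (derivative r)) * hR
    rw [smul_sub, smul_smul, smul_smul, h1, ← h]
    simp [mul_comm, mul_smul, two_smul]
  have hY0 : Y ≠ 0 := fun h => M.y_ne_zero (congrArg Subtype.val h)
  have h3 := congrArg δ.liftKaehlerDifferential ((smul_eq_zero.1 hrel).resolve_left hY0)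
  rw [map_sub, map_smul, map_smul, Derivation.liftKaehlerDifferential_comp_D,
    Derivation.liftKaehlerDifferential_comp_D, hδy] at h3
  have h4 : δ ξ = 0 := hδx
  rw [h4, smul_zero, sub_zero, map_zero, Algebra.smul_def, mul_one] at h3
  have h5 : algebraMap K (ResidueField V) 2 = 0 := by
    rw [map_ofNat] at h3 ⊢
    exact h3
  exact M.two ((map_eq_zero _).1 h5)

end DoubleCover

end
end GenusOne

/-! ### Genus one: `deg f = 4`, and the action on `dx/y` -/

namespace GenusOne
noncomputable section
open Polynomial

variable {K F : Type*} [Field K] [Field F] [Algebra K F]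

namespace DoubleCover

variable {w : F ≃ₐ[K] F} {x y : F} {f : K[X]} (M : DoubleCover w x y f)
include M

/-- From `a f + b f' = 1`, `f = y²` and `f' dx = 2y dy` one gets `dx/y = a y dx + 2b dy`, visibly
regular. -/
theorem div_y_smul_mem_span (hf : IsCoprime f (derivative f)) {V : ValuationSubring F}
    (hV : ∀ a, algebraMap K F a ∈ V) (hx : x ∈ V) {g : F} (hg : g ∈ V) :
    (g / y) • KaehlerDifferential.D K F x ∈ Submodule.span K
      {ω | ∃ a ∈ V, ∃ b ∈ V, ω = a • KaehlerDifferential.D K F b} := by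
  have hp : ∀ p : K[X], aeval x p ∈ V := fun p =>
    mem_of_isIntegralElem hV hx (isIntegralElem_aeval x p)
  have hy : y ∈ V := mem_of_isIntegralElem hV hx M.isIntegralElem_y
  have h2 : (2 : F) ∈ V := by simpa only [map_ofNat] using hV 2
  obtain ⟨a, b, hab⟩ := hf
  have key : (g / y) • KaehlerDifferential.D K F x =
      (g * aeval x a * y) • KaehlerDifferential.D K F x +
        (2 * g * aeval x b) • KaehlerDifferential.D K F y := by
    apply M.quot_injective
    simp only [map_add, map_smul, quot_D, M.diff_x, smul_eq_mul, mul_one]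
    have h := congrArg (aeval x) hab
    rw [map_add, map_mul, map_mul, map_one, ← M.two_mul_y_mul_diff_y, ← M.sq] at h
    rw [div_eq_iff M.y_ne_zero]
    linear_combination -g * h
  rw [key]
  exact add_mem
    (Submodule.subset_span ⟨_, V.mul_mem _ _ (V.mul_mem _ _ hg (hp _)) hy, _, hx, rfl⟩)
    (Submodule.subset_span ⟨_, V.mul_mem _ _ (V.mul_mem _ _ h2 hg) (hp _), _, hy, rfl⟩)

/-- At infinity `x^n dx / y = -(1/x)^(m-n-2) d(1/x) / (y/x^m)`, which is the finite case for the
other chart. -/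
theorem pow_div_y_smul_mem_regDiff
    (hF : ∀ (V : ValuationSubring F) (hV : ∀ a, algebraMap K F a ∈ V),
      ((algebraMap K F).codRestrict V.toSubring hV).FormallySmooth)
    {m n : ℕ} (hm : f.natDegree = 2 * m) (hn : n + 2 ≤ m) :
    (x ^ n / y) • KaehlerDifferential.D K F x ∈ regDiff K F := by
  refine (Submodule.mem_iInf _).2 fun V => (Submodule.mem_iInf _).2 fun hV => ?_
  obtain hx | hx := V.mem_or_inv_mem x
  · exact M.div_y_smul_mem_span (M.isCoprime_derivative hF) hV hx (V.toSubring.pow_mem hx n)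
  · have h := (M.infinity hm).div_y_smul_mem_span ((M.infinity hm).isCoprime_derivative hF) hV hx
      (V.toSubring.neg_mem (V.toSubring.pow_mem hx (m - (n + 2))))
    convert! h using 1
    apply M.quot_injective
    have hx0 := M.x_ne_zero
    have hy0 := M.y_ne_zero
    rw [map_smul, map_smul, quot_D, quot_D, M.diff_x, Derivation.leibniz_inv, M.diff_x]
    obtain ⟨k, rfl⟩ := Nat.exists_eq_add_of_le hn
    simp only [smul_eq_mul, mul_one, Nat.add_sub_cancel_left, pow_add, inv_pow]
    field_simp

theorem natDegree_eq_four (hrank : Module.rank K (regDiff K F) = 1)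
    (hF : ∀ (V : ValuationSubring F) (hV : ∀ a, algebraMap K F a ∈ V),
      ((algebraMap K F).codRestrict V.toSubring hV).FormallySmooth)
    {m : ℕ} (hm : f.natDegree = 2 * m) : m = 2 := by
  obtain h | rfl | h := lt_trichotomy m 2
  · rw [M.regDiff_eq_bot hm (by omega), rank_bot] at hrank
    exact absurd hrank zero_ne_one
  · rfl
  · obtain ⟨ω, -, -, hω⟩ := (rank_submodule_eq_one_iff _).1 hrank
    obtain ⟨a, ha⟩ := Submodule.mem_span_singleton.1
      (hω (M.pow_div_y_smul_mem_regDiff hF hm (n := 0) (by omega)))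
    obtain ⟨b, hb⟩ := Submodule.mem_span_singleton.1
      (hω (M.pow_div_y_smul_mem_regDiff hF hm (n := 1) (by omega)))
    have ha' := congrArg M.quot ha
    have hb' := congrArg M.quot hb
    rw [← algebraMap_smul F, map_smul, map_smul, quot_D, M.diff_x, smul_eq_mul, smul_eq_mul,
      pow_zero, mul_one] at ha'
    rw [← algebraMap_smul F, map_smul, map_smul, quot_D, M.diff_x, smul_eq_mul, smul_eq_mul,
      pow_one, mul_one] at hb'
    have hy0 := M.y_ne_zero
    have ha0 : a ≠ 0 := by
      rintro rfl
      rw [map_zero, zero_mul] at ha'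
      exact one_div_ne_zero hy0 ha'.symm
    refine absurd ?_ (M.aeval_ne_zero (p := C a * X - C b) fun h => ha0 (by
      simpa using congrArg (coeff · 1) h))
    have hq : M.quot ω ≠ 0 := right_ne_zero_of_mul (ha'.trans_ne (one_div_ne_zero hy0))
    refine mul_right_cancel₀ hq ?_
    simp only [map_sub, map_mul, aeval_C, aeval_X, zero_mul]
    linear_combination x * ha' - hb'

omit M in
theorem _root_.GenusOne.map_mem_regDiff {E : Type*} [Field E] [Algebra K E] [Algebra E F]
    [IsScalarTower K E F] {ω : Ω[E⁄K]} (hω : ω ∈ regDiff K E) :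
    KaehlerDifferential.map K K E F ω ∈ regDiff K F := by
  refine (Submodule.mem_iInf _).2 fun V => (Submodule.mem_iInf _).2 fun hV => ?_
  have h := (Submodule.mem_iInf _).1 ((Submodule.mem_iInf _).1 hω (V.comap (algebraMap E F)))
    fun a => by
      rw [ValuationSubring.mem_comap, ← IsScalarTower.algebraMap_apply]
      exact hV a
  clear hω
  induction h using Submodule.span_induction with
  | mem ω h =>
    obtain ⟨a, ha, b, hb, rfl⟩ := h
    refine Submodule.subset_span ⟨algebraMap E F a, ha, algebraMap E F b, hb, ?_⟩
    rw [map_smul, KaehlerDifferential.map_D, algebraMap_smul]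
  | zero => rw [map_zero]; exact zero_mem _
  | add ω η _ _ h h' => rw [map_add]; exact add_mem h h'
  | smul c ω _ h =>
    rw [← algebraMap_smul E c ω, map_smul, algebraMap_smul]
    exact Submodule.smul_mem _ c h

omit M in
-- A separable extension is formally étale, so `Ω[F⁄K]` is the base change of `Ω[E⁄K]`, and field
-- extensions are faithfully flat.
theorem _root_.GenusOne.map_kaehlerDifferential_ne_zero {E : Type*} [Field E] [Algebra K E]
    [Algebra E F] [IsScalarTower K E F] [Algebra.IsSeparable E F] {ω : Ω[E⁄K]} (hω : ω ≠ 0) :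
    KaehlerDifferential.map K K E F ω ≠ 0 := by
  have : Algebra.FormallyEtale E F := .of_isSeparable E F
  intro h
  apply hω
  apply (Module.FaithfullyFlat.one_tmul_eq_zero_iff E _ (A := F) ω).1
  apply (KaehlerDifferential.tensorKaehlerEquivOfFormallyEtale K E F).injective
  rw [KaehlerDifferential.tensorKaehlerEquivOfFormallyEtale_apply, map_zero,
    KaehlerDifferential.mapBaseChange_tmul, h, smul_zero]

/-- A nonzero regular differential of the fixed field `E` of `τ` pulls back to `c dx/y` with `c` a
nonzero constant. The hypothesis `hκ` says that `τ` multiplies the dual vector field `y d/dx` by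
`κ`. Pairing that field with a differential coming from `E` gives a function that `τ` multiplies by
`κ`; here it is the constant `c`, so `κ = 1`. -/
theorem eq_one_of_quotient_regDiff_ne_bot (hrank : Module.rank K (regDiff K F) = 1)
    (hF : ∀ (V : ValuationSubring F) (hV : ∀ a, algebraMap K F a ∈ V),
      ((algebraMap K F).codRestrict V.toSubring hV).FormallySmooth)
    (hf : f.natDegree = 4)
    {E : Type*} [Field E] [Algebra K E] (ψ : E →ₐ[K] F) (τ : F ≃ₐ[K] F) (hτ : ∀ g, τ (τ g) = g)
    (hψ : ∀ g, g ∈ Set.range ψ ↔ τ g = g) (hE : regDiff K E ≠ ⊥) {κ : K}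
    (hκ : τ (y * M.diff (τ x)) = algebraMap K F κ * y) : κ = 1 := by
  let : Algebra E F := ψ.toRingHom.toAlgebra
  have : IsScalarTower K E F := .of_algebraMap_eq fun a => (ψ.commutes a).symm
  have : Algebra.IsSeparable E F :=
    isSeparable_of_involution τ.toRingEquiv.toRingHom hτ fun g hg => (hψ g).2 hg
  obtain ⟨ω, hω, hω0⟩ := (Submodule.ne_bot_iff _).1 hE
  have hη0 := map_kaehlerDifferential_ne_zero (F := F) hω0
  have hη := map_mem_regDiff (F := F) hω
  have hy0 := M.y_ne_zero
  obtain ⟨c, hc⟩ : ∃ c : K, M.quot (KaehlerDifferential.map K K E F ω) * y = algebraMap K F c := by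
    obtain ⟨ω₀, -, -, hω₀⟩ := (rank_submodule_eq_one_iff _).1 hrank
    obtain ⟨a, ha⟩ := Submodule.mem_span_singleton.1
      (hω₀ (M.pow_div_y_smul_mem_regDiff hF (m := 2) hf (n := 0) (by omega)))
    obtain ⟨b, hb⟩ := Submodule.mem_span_singleton.1 (hω₀ hη)
    have ha' := congrArg M.quot ha
    rw [← algebraMap_smul F, map_smul, map_smul, quot_D, M.diff_x, smul_eq_mul, smul_eq_mul,
      pow_zero, mul_one] at ha'
    have ha0 : algebraMap K F a ≠ 0 := left_ne_zero_of_mul (ha'.trans_ne (one_div_ne_zero hy0))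
    refine ⟨b / a, ?_⟩
    rw [← hb, ← algebraMap_smul F, map_smul, smul_eq_mul, map_div₀, eq_div_iff ha0]
    rw [eq_div_iff hy0] at ha'
    linear_combination algebraMap K F b * ha'
  have hc0 : algebraMap K F c ≠ 0 := by
    rw [← hc]
    exact mul_ne_zero ((map_ne_zero_iff _ M.quot_injective).2 hη0) hy0
  -- The conjugate of `y d/dx` by `τ`; being a derivation, it is determined by its value on `x`.
  let D : Derivation K F F := Derivation.mk' (τ.toLinearMap ∘ₗ (y • M.diff : Derivation K F F).toLinearMap
    ∘ₗ τ.toLinearMap) fun g h => by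
      change τ (y * M.diff (τ (g * h))) = g * τ (y * M.diff (τ h)) + h * τ (y * M.diff (τ g))
      rw [map_mul τ g h, Derivation.leibniz]
      simp only [smul_eq_mul, map_mul, map_add, hτ]
      ring
  have hD : ∀ g, D g = τ (y * M.diff (τ g)) := fun g => rfl
  have hDκ : ∀ g, D g = algebraMap K F κ * (y * M.diff g) := fun g => by
    rw [M.derivation_apply D g, hD, hκ, mul_assoc]
  have hE : ∀ e : E, τ (algebraMap E F e) = algebraMap E F e := fun e => (hψ _).1 ⟨e, rfl⟩
  have key : ∀ η : Ω[E⁄K], τ (M.quot (KaehlerDifferential.map K K E F η) * y) =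
      algebraMap K F κ * (M.quot (KaehlerDifferential.map K K E F η) * y) := by
    intro η
    have : η ∈ Submodule.span E (Set.range (KaehlerDifferential.D K E)) := by
      rw [KaehlerDifferential.span_range_derivation]
      trivial
    induction this using Submodule.span_induction with
    | mem η h =>
      obtain ⟨b, rfl⟩ := h
      have h1 := hDκ (algebraMap E F b)
      rw [hD, hE] at h1
      rw [KaehlerDifferential.map_D, quot_D, mul_comm, h1]
    | zero => simp
    | add η₁ η₂ _ _ h₁ h₂ => simp only [map_add, add_mul, h₁, h₂, mul_add]
    | smul a η _ h =>
      rw [map_smul, ← algebraMap_smul F, map_smul, smul_eq_mul, mul_assoc, map_mul, h, hE]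
      ring
  have h := key ω
  rw [hc, AlgEquiv.commutes] at h
  have h1 : algebraMap K F κ = 1 := by
    refine mul_right_cancel₀ hc0 ?_
    rw [one_mul, ← h]
  exact (algebraMap K F).injective (h1.trans (map_one _).symm)

end DoubleCover

end
end GenusOne

/-! ### A coordinate with a pole at the place, and the leading coefficient `d` -/

namespace GenusOne
noncomputable section
open Polynomial

variable {K F L : Type*} [Field K] [Field F] [Field L] [Algebra K F] [Algebra K L]

theorem Place.exists_val_of_isAlgebraic (P : Place K F L) {g : F} (hg : IsAlgebraic K g) :
    ∃ c, P.Val g c := by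
  obtain ⟨p, hp, h⟩ := hg.isIntegral
  let j : K →+* P.ring := (algebraMap K F).codRestrict P.ring.toSubring P.algebraMap_mem_ring
  have hi : IsIntegral P.ring g := ⟨p.map j, hp.map j, by
    rw [eval₂_map]
    exact h⟩
  obtain ⟨v, rfl⟩ := IsIntegrallyClosed.isIntegral_iff.1 hi
  exact v.2

/-- A place is finite on all algebraic elements, hence embeds `F` in the separable extension `L`,
and the differentials vanish. Genus one thus makes the generator `t` transcendental. -/
theorem regDiff_eq_bot_of_isAlgebraic [Algebra.IsSeparable K L] [Algebra.IsAlgebraic K F]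
    (P : Place K F L) : regDiff K F = ⊥ := by
  choose φ hφ using fun g => P.exists_val_of_isAlgebraic (Algebra.IsAlgebraic.isAlgebraic g)
  let ψ : F →ₐ[K] L :=
    { toFun := φ
      map_zero' := P.unique (hφ 0) P.zero
      map_one' := P.unique (hφ 1) P.one
      map_add' := fun g h => P.unique (hφ _) (P.add (hφ g) (hφ h))
      map_mul' := fun g h => P.unique (hφ _) (P.mul (hφ g) (hφ h))
      commutes' := fun a => P.unique (hφ _) (P.const a) }
  have : Algebra.IsSeparable K F := .of_algHom K L ψ
  have : Algebra.FormallyEtale K F := .of_isSeparable K F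
  rw [_root_.eq_bot_iff]
  intro ω _
  exact Subsingleton.elim _ _

theorem isAlgebraic_of_involution {w : F ≃ₐ[K] F} (hw : ∀ g, w (w g) = g) {t : F}
    (ht : IsAlgebraic K t) (hwt : ∀ g, w g = g → g ∈ IntermediateField.adjoin K {t}) :
    Algebra.IsAlgebraic K F := by
  have h1 : Algebra.IsAlgebraic K (IntermediateField.adjoin K {t}) :=
    IntermediateField.isAlgebraic_adjoin_simple ht.isIntegral
  have h2 : Algebra.IsAlgebraic (IntermediateField.adjoin K {t}) F := by
    have := isSeparable_of_involution (E := IntermediateField.adjoin K {t})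
      w.toRingEquiv.toRingHom hw fun g hg => ⟨⟨g, hwt g hg⟩, rfl⟩
    infer_instance
  exact Algebra.IsAlgebraic.trans K (IntermediateField.adjoin K {t}) F

/-- `x` generates the field of invariants of `w`, and has a pole at the place `P`. -/
structure PoleCoordinate (w : F ≃ₐ[K] F) (P : Place K F L) (x : F) : Prop where
  transc : Transcendental K x
  map_x : w x = x
  fixed : ∀ g, w g = g → ∃ p q : K[X], q ≠ 0 ∧ g = aeval x p / aeval x q
  val : P.Val x⁻¹ 0

theorem PoleCoordinate.of_mem_adjoin {w : F ≃ₐ[K] F} {P : Place K F L} {x : F}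
    (transc : Transcendental K x) (map_x : w x = x)
    (fixed : ∀ g, w g = g → g ∈ IntermediateField.adjoin K {x}) (val : P.Val x⁻¹ 0) :
    PoleCoordinate w P x := by
  refine ⟨transc, map_x, fun g hg => ?_, val⟩
  obtain ⟨p, q, rfl⟩ := (IntermediateField.mem_adjoin_simple_iff K _).1 (fixed g hg)
  by_cases hq : q = 0
  · exact ⟨0, 1, one_ne_zero, by simp [hq]⟩
  · exact ⟨p, q, hq, rfl⟩

/-- If `t` has a finite value at `P`, that value is some `a` in `K`, and `1/(t - a)` is the required
coordinate. -/
theorem exists_poleCoordinate {w : F ≃ₐ[K] F} {P : Place K F L} {t : F}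
    (ht : Transcendental K t) (hwt : w t = t)
    (fixed : ∀ g, w g = g → g ∈ IntermediateField.adjoin K {t})
    (hP : ∀ g c, w g = g → P.Val g c → c ∈ Set.range (algebraMap K L)) :
    ∃ x, PoleCoordinate w P x := by
  obtain ⟨c, hc⟩ | h0 := P.total t
  · obtain ⟨a, rfl⟩ := hP t c hwt hc
    have hta : t - algebraMap K F a ≠ 0 := fun h => ht (by
      rw [sub_eq_zero.1 h]
      exact isAlgebraic_algebraMap a)
    refine ⟨(t - algebraMap K F a)⁻¹, .of_mem_adjoin (fun h => ht ?_) ?_ (fun g hg => ?_) ?_⟩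
    · have := h.inv.add (isAlgebraic_algebraMap a)
      rwa [inv_inv, sub_add_cancel] at this
    · rw [map_inv₀, map_sub, hwt, AlgEquiv.commutes]
    · refine (IntermediateField.adjoin_simple_le_iff.2 ?_) (fixed g hg)
      have := add_mem (inv_mem (IntermediateField.mem_adjoin_simple_self K
        (t - algebraMap K F a)⁻¹)) (algebraMap_mem (IntermediateField.adjoin K
          {(t - algebraMap K F a)⁻¹}) a)
      rwa [inv_inv, sub_add_cancel] at this
    · rw [inv_inv]
      simpa using P.sub hc (P.const a)
  · exact ⟨t, .of_mem_adjoin ht hwt fixed h0⟩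

namespace PoleCoordinate

variable {w : F ≃ₐ[K] F} {P : Place K F L} {x : F} (H : PoleCoordinate w P x)
include H

theorem ne_zero : x ≠ 0 := fun h => H.transc (h ▸ isAlgebraic_zero)

theorem aeval_ne_zero {p : K[X]} (hp : p ≠ 0) : aeval x p ≠ 0 :=
  fun h => H.transc ⟨p, hp, h⟩

theorem map_aeval (p : K[X]) : w (aeval x p) = aeval x p := by
  rw [← aeval_algHom_apply, H.map_x]

theorem sub (a : K) : PoleCoordinate w P (x - algebraMap K F a) := by
  have hx := H.ne_zero
  have h1 : P.Val (1 - algebraMap K F a * x⁻¹) 1 := by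
    simpa using P.sub P.one (P.mul (P.const a) H.val)
  refine ⟨fun h => H.transc ?_, ?_, fun g hg => ?_, ?_⟩
  · have := h.add (isAlgebraic_algebraMap a)
    rwa [sub_add_cancel] at this
  · rw [map_sub, H.map_x, AlgEquiv.commutes]
  · obtain ⟨p, q, hq, rfl⟩ := H.fixed g hg
    have h : ∀ p : K[X], aeval (x - algebraMap K F a) (p.comp (X + C a)) = aeval x p := fun p => by
      rw [aeval_comp]
      simp
    refine ⟨p.comp (X + C a), q.comp (X + C a), fun h0 => H.aeval_ne_zero hq ?_, ?_⟩
    · rw [← h, h0, map_zero]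
    · rw [h, h]
  · have := P.div H.val h1 one_ne_zero
    have h2 := P.ne_zero h1 one_ne_zero
    have h3 : x - algebraMap K F a = (1 - algebraMap K F a * x⁻¹) * x := by
      field_simp
    rw [zero_div] at this
    convert! this using 1
    rw [h3, mul_inv, mul_comm, div_eq_mul_inv]

/-- The quotient is the reversed polynomial in `1/x`, evaluated at `0`: leading coefficients are
read off at the pole. -/
theorem val_aeval_div (p : K[X]) :
    P.Val (aeval x p / x ^ p.natDegree) (algebraMap K L p.leadingCoeff) := by
  have h := P.aeval H.val p.reverse
  have h1 := aeval_inv_reverse H.ne_zero p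
  rw [← eq_div_iff (pow_ne_zero _ H.ne_zero)] at h1
  rwa [h1, ← coeff_zero_eq_aeval_zero', coeff_zero_reverse] at h

omit H in
theorem _root_.GenusOne.exists_sq_mul_squarefree {h : K[X]} (h0 : h ≠ 0) :
    ∃ s f : K[X], Squarefree f ∧ h = s ^ 2 * f := by
  induction hn : h.natDegree using Nat.strong_induction_on generalizing h with
  | _ n ih =>
    by_cases hs : Squarefree h
    · exact ⟨1, h, hs, by simp⟩
    · simp only [Squarefree, not_forall] at hs
      obtain ⟨a, ⟨b, rfl⟩, ha⟩ := hs
      have hb0 := right_ne_zero_of_mul h0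
      have ha0 := left_ne_zero_of_mul (left_ne_zero_of_mul h0)
      have hda : a.natDegree ≠ 0 := fun h => ha (by
        rw [eq_C_of_natDegree_eq_zero h] at ha0 ⊢
        exact isUnit_C.2 (isUnit_iff_ne_zero.2 (C_ne_zero.1 ha0)))
      rw [natDegree_mul (mul_ne_zero ha0 ha0) hb0, natDegree_mul ha0 ha0] at hn
      obtain ⟨s, f, hf, rfl⟩ := ih b.natDegree (by omega) hb0 rfl
      exact ⟨a * s, f, hf, by ring⟩

/-- Write `g² = p/q` and `p q = A² f` with `f` squarefree; then `g q / A` has square `f`. As `g²`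
has the nonzero finite value `d` at `P`, the degrees balance and `deg f` is even. A constant factor
then makes the value of `y / x^m` exactly `r`, so the leading coefficient becomes `r² = d`. -/
theorem exists_doubleCover (two : (2 : K) ≠ 0) (hw : ∀ g, w (w g) = g) {d : K} (hd : d ≠ 0) {r : L}
    (hr : r ^ 2 = algebraMap K L d) {g : F} (hg : w g = -g) (hgr : P.Val g r) :
    ∃ (y : F) (f : K[X]) (m : ℕ), DoubleCover w x y f ∧ f.natDegree = 2 * m ∧
      f.leadingCoeff = d ∧ P.Val (y / x ^ m) r := by
  have hx := H.ne_zero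
  have hd' : algebraMap K L d ≠ 0 := (_root_.map_ne_zero _).2 hd
  have hr0 : r ≠ 0 := by
    rintro rfl
    exact hd' (by rw [← hr]; simp)
  have hg0 := P.ne_zero hgr hr0
  obtain ⟨p, q, hq, hpq⟩ := H.fixed (g ^ 2) (by rw [map_pow, hg, neg_sq])
  have hq' := H.aeval_ne_zero hq
  rw [eq_div_iff hq'] at hpq
  have hp : p ≠ 0 := by
    rintro rfl
    rw [map_zero] at hpq
    exact mul_ne_zero (pow_ne_zero 2 hg0) hq' hpq
  obtain ⟨A, f, hf, hAf⟩ := exists_sq_mul_squarefree (mul_ne_zero hp hq)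
  have hA : A ≠ 0 := by
    rintro rfl
    simp [hp, hq] at hAf
  have hA' := H.aeval_ne_zero hA
  have hsq : g ^ 2 * aeval x (q ^ 2) = aeval x (A ^ 2 * f) := by
    rw [← hAf, map_mul, ← hpq, map_pow]
    ring
  have h1 := H.val_aeval_div (q ^ 2)
  have h2 := H.val_aeval_div (A ^ 2 * f)
  rw [leadingCoeff_mul, leadingCoeff_pow, natDegree_mul (pow_ne_zero 2 hA) hf.ne_zero,
    natDegree_pow] at h2
  rw [leadingCoeff_pow, natDegree_pow] at h1
  have hlead : ∀ {p : K[X]}, p ≠ 0 → algebraMap K L p.leadingCoeff ≠ 0 := fun hp =>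
    (_root_.map_ne_zero _).2 (leadingCoeff_ne_zero.2 hp)
  have h3 := P.mul (P.pow hgr 2) h1
  rw [← mul_div_assoc, hsq, hr] at h3
  have hz : ∀ {n k : ℕ} {h : F} {c : L}, P.Val (h / x ^ n) c → n < k → P.Val (h / x ^ k) 0 := by
    intro n k h c hc hnk
    obtain ⟨j, rfl⟩ := Nat.exists_eq_add_of_lt hnk
    have := P.mul hc (P.pow H.val (j + 1))
    rw [zero_pow (Nat.succ_ne_zero j), mul_zero] at this
    convert! this using 1
    rw [inv_pow, add_assoc, pow_add]
    field_simp
  have hdeg : 2 * A.natDegree + f.natDegree = 2 * q.natDegree := by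
    by_contra hne
    obtain h | h := lt_or_gt_of_ne hne
    · have := P.unique h3 (hz h2 h)
      rw [map_pow] at this
      exact mul_ne_zero hd' (pow_ne_zero 2 (hlead hq)) this
    · have := P.unique h2 (hz h3 h)
      rw [map_mul, map_pow] at this
      exact mul_ne_zero (pow_ne_zero 2 (hlead hA)) (hlead hf.ne_zero) this
  set m := q.natDegree - A.natDegree with hm
  -- The factor by which `q(x) / (A(x) x^m)` changes the value at `P`; dividing by it restores `r`.
  set l : K := q.leadingCoeff / A.leadingCoeff with hl
  have hl0 : l ≠ 0 := div_ne_zero (leadingCoeff_ne_zero.2 hq) (leadingCoeff_ne_zero.2 hA)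
  have hl' : algebraMap K F l ≠ 0 := (_root_.map_ne_zero _).2 hl0
  let y := g * aeval x q / (aeval x A * algebraMap K F l)
  have hval : P.Val (y / x ^ m) r := by
    have := P.div (P.div (P.mul hgr (H.val_aeval_div q)) (H.val_aeval_div A) (hlead hA))
      (P.const l) ((_root_.map_ne_zero _).2 hl0)
    convert! this using 1
    · have hqA : q.natDegree = m + A.natDegree := by omega
      rw [hqA, pow_add]
      simp only [y]
      field_simp
    · rw [hl, map_div₀]
      have := hlead hq
      have := hlead hA
      field_simp
  have hysq : y ^ 2 = aeval x (C (l ^ 2)⁻¹ * f) := by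
    simp only [y]
    rw [map_mul, aeval_C, map_inv₀, map_pow, div_pow, mul_pow, mul_pow, ← map_pow (aeval x) q, hsq,
      map_mul, map_pow]
    field_simp
  have hC : (C (l ^ 2)⁻¹ : K[X]) ≠ 0 := C_ne_zero.2 (inv_ne_zero (pow_ne_zero 2 hl0))
  have hfm : (C (l ^ 2)⁻¹ * f).natDegree = 2 * m := by
    rw [natDegree_C_mul (inv_ne_zero (pow_ne_zero 2 hl0))]
    omega
  refine ⟨y, C (l ^ 2)⁻¹ * f, m, ⟨two, H.transc, hysq, ?_, hw, H.map_x, ?_, H.fixed⟩, hfm, ?_, hval⟩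
  · have hu : IsUnit (C (l ^ 2)⁻¹ : K[X]) := isUnit_C.2 (isUnit_iff_ne_zero.2 (C_ne_zero.1 hC))
    exact hf.squarefree_of_dvd ((hu.dvd_mul_left).1 (dvd_refl _))
  · simp only [y]
    rw [map_div₀, map_mul, map_mul, hg, H.map_aeval, H.map_aeval, AlgEquiv.commutes, neg_mul,
      neg_div]
  · have h4 := H.val_aeval_div (C (l ^ 2)⁻¹ * f)
    have h5 := P.pow hval 2
    rw [div_pow, hysq, ← pow_mul, mul_comm m, ← hfm, hr] at h5
    exact (algebraMap K L).injective (P.unique h4 h5)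

end PoleCoordinate

end
end GenusOne

/-! ### Normal form of the second involution on the projective line -/

namespace GenusOne
noncomputable section
open Polynomial

variable {K F L : Type*} [Field K] [Field F] [Field L] [Algebra K F] [Algebra K L]

/-- An element `p(x)/q(x)` generating `K(x)` is a fractional linear transform of `x`. -/
theorem exists_fractional_linear {x : F} (hx : Transcendental K x) {p q r s : K[X]} {x' : F}
    (h : x' = aeval x p / aeval x q) (h' : x = aeval x' r / aeval x' s) :
    ∃ a b c e : K, algebraMap K F c * x + algebraMap K F e ≠ 0 ∧
      x' = (algebraMap K F a * x + algebraMap K F b) /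
        (algebraMap K F c * x + algebraMap K F e) := by
  let φ : RatFunc K →ₐ[K] F := RatFunc.liftAlgHom (aeval x : K[X] →ₐ[K] F)
    (nonZeroDivisors_le_comap_nonZeroDivisors_of_injective _ (transcendental_iff_injective.1 hx))
  have hφ : ∀ p q : K[X], φ (algebraMap _ _ p / algebraMap _ _ q) = aeval x p / aeval x q :=
    fun p q => RatFunc.liftAlgHom_apply_div _ _ p q
  obtain ⟨ρ, hρ⟩ : ∃ ρ, φ ρ = x' := ⟨_, (hφ p q).trans h.symm⟩
  have hX : φ RatFunc.X = x := by
    have := hφ X 1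
    rwa [map_one, div_one, RatFunc.algebraMap_X, aeval_X, map_one, div_one] at this
  have htop : IntermediateField.adjoin K {ρ} = ⊤ := by
    rw [_root_.eq_top_iff, ← RatFunc.adjoin_X, IntermediateField.adjoin_simple_le_iff,
      IntermediateField.mem_adjoin_simple_iff]
    have hinj : Function.Injective φ := φ.toRingHom.injective
    refine ⟨r, s, hinj ?_⟩
    rw [map_div₀, ← aeval_algHom_apply, ← aeval_algHom_apply, hρ, hX]
    exact h'
  -- The degree of `K(x)` over `K(ρ)` is the larger of the degrees of numerator and denominator;
  -- here it is `1`.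
  have hdeg := RatFunc.finrank_eq_max_natDegree ρ
  rw [htop, IntermediateField.finrank_top] at hdeg
  have hn : ρ.num.natDegree ≤ 1 := hdeg ▸ le_max_left _ _
  have hd : ρ.denom.natDegree ≤ 1 := hdeg ▸ le_max_right _ _
  obtain ⟨a, b, hab⟩ := exists_eq_X_add_C_of_natDegree_le_one hn
  obtain ⟨c, e, hce⟩ := exists_eq_X_add_C_of_natDegree_le_one hd
  have h1 := hφ ρ.num ρ.denom
  rw [RatFunc.num_div_denom, hρ] at h1
  have h2 : aeval x ρ.denom ≠ 0 := fun h => hx ⟨_, ρ.denom_ne_zero, h⟩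
  refine ⟨a, b, c, e, ?_, ?_⟩
  · rw [hce] at h2
    simpa using h2
  · rw [h1, hab, hce]
    simp

namespace PoleCoordinate

variable {w : F ≃ₐ[K] F} {P : Place K F L}

/-- `u` acts on `K(x)`, nontrivially since otherwise `u` would be `1` or `w`. A nontrivial
fractional linear involution has trace zero, so `u x = (a x + b)/(c x - a)`. For `c = 0` the
coordinate is centred at the finite fixed point `-b/(2a)`, otherwise at the pole `a/c`. -/
theorem exists_normalized {x : F} (H : PoleCoordinate w P x)
    (two : (2 : K) ≠ 0) (hw : ∀ g, w (w g) = g) {g : F} (hg : w g = -g) (hg0 : g ≠ 0)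
    {u : F ≃ₐ[K] F} (hu : ∀ g, u (u g) = g) (huw : ∀ g, u (w g) = w (u g)) (hu1 : u ≠ 1)
    (huw1 : u ≠ w) :
    ∃ x, PoleCoordinate w P x ∧
      (u x = -x ∨ ∃ ε : K, ε ≠ 0 ∧ u x = algebraMap K F ε / x) := by
  have h2 : (2 : F) ≠ 0 := by simpa only [map_ofNat] using (_root_.map_ne_zero (algebraMap K F)).2 two
  have hux : u x ≠ x := by
    intro hux
    have hfix : ∀ a, w a = a → u a = a := fun a ha => by
      obtain ⟨p, q, -, rfl⟩ := H.fixed a ha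
      rw [map_div₀, ← aeval_algHom_apply, ← aeval_algHom_apply, hux]
    have hd : ∀ a, ∃ b c, w b = b ∧ w c = c ∧ a = b + c * g := fun a => by
      refine ⟨(a + w a) / 2, (a - w a) / (2 * g), ?_, ?_, ?_⟩
      · rw [map_div₀, map_add, hw, map_ofNat, add_comm]
      · rw [map_div₀, map_sub, hw, map_mul, map_ofNat, hg, mul_neg, div_neg, ← neg_div, neg_sub]
      · field_simp
        ring
    have hsq : u g ^ 2 = g ^ 2 := by
      rw [← map_pow]
      exact hfix _ (by rw [map_pow, hg, neg_sq])
    obtain h | h := sq_eq_sq_iff_eq_or_eq_neg.1 hsq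
    · refine hu1 (AlgEquiv.ext fun a => ?_)
      obtain ⟨b, c, hb, hc, rfl⟩ := hd a
      rw [map_add, map_mul, hfix b hb, hfix c hc, h]
      rfl
    · refine huw1 (AlgEquiv.ext fun a => ?_)
      obtain ⟨b, c, hb, hc, rfl⟩ := hd a
      rw [map_add, map_mul, hfix b hb, hfix c hc, h, map_add, map_mul, hb, hc, hg]
  obtain ⟨p, q, -, hpq⟩ := H.fixed (u x) (by rw [← huw, H.map_x])
  obtain ⟨a, b, c, e, h0, h⟩ := exists_fractional_linear H.transc (r := p) (s := q) hpq (by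
    have := congrArg u hpq
    rwa [hu, map_div₀, ← aeval_algHom_apply, ← aeval_algHom_apply] at this)
  rw [eq_div_iff h0] at h
  have h' := congrArg u h
  simp only [map_mul, map_add, hu, AlgEquiv.commutes] at h'
  have hea : algebraMap K F e = -algebraMap K F a := by
    have : (algebraMap K F e + algebraMap K F a) * (u x - x) = 0 := by
      linear_combination h - h'
    exact eq_neg_of_add_eq_zero_left ((mul_eq_zero.1 this).resolve_right (sub_ne_zero.2 hux))
  rw [hea] at h h0
  by_cases hc : c = 0
  · subst hc
    rw [map_zero, zero_mul, zero_add] at h h0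
    have ha : algebraMap K F a ≠ 0 := neg_ne_zero.1 h0
    refine ⟨x - algebraMap K F (-b / (2 * a)), H.sub _, Or.inl ?_⟩
    simp only [map_sub, map_div₀, map_mul, map_neg, AlgEquiv.commutes, map_ofNat]
    field_simp
    linear_combination (-2) * h
  · have hc' : algebraMap K F c ≠ 0 := (_root_.map_ne_zero _).2 hc
    have H' := H.sub (a / c)
    have hx' := H'.ne_zero
    have key : u (x - algebraMap K F (a / c)) =
        algebraMap K F ((b * c + a ^ 2) / c ^ 2) / (x - algebraMap K F (a / c)) := by
      rw [eq_div_iff hx']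
      simp only [map_sub, map_div₀, map_mul, map_add, map_pow, AlgEquiv.commutes]
      field_simp
      linear_combination algebraMap K F c * h
    refine ⟨x - algebraMap K F (a / c), H', Or.inr ⟨_, fun h => ?_, key⟩⟩
    rw [h, map_zero, zero_div, map_eq_zero_iff u u.injective] at key
    exact hx' key

end PoleCoordinate

/-- A place is determined by its values on the two coordinates of the chart at infinity. -/
theorem DoubleCover.place_eq {w : F ≃ₐ[K] F} {x y : F} {f : K[X]} (M : DoubleCover w x y f)
    {P P' : Place K F L} {a b : L} (hx : P.Val x a) (hy : P.Val y b) (hx' : P'.Val x a)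
    (hy' : P'.Val y b) : P = P' := by
  refine Place.ext_of_le fun g c hg => ?_
  obtain ⟨α, β, γ, δ, h0, hs, rfl⟩ := M.exists_eq_div P.algebraMap_mem_ring ⟨a, hx⟩ ⟨c, hg⟩
  have h : ∀ {R : Place K F L}, R.Val x a → R.Val y b → ∀ p q : K[X],
      R.Val (aeval x p + aeval x q * y) (aeval a p + aeval a q * b) := fun hx hy p q =>
    Place.add _ (Place.aeval _ hx p) (Place.mul _ (Place.aeval _ hx q) hy)
  have h1 := ((P.inv_mem_ring (h hx hy γ δ)).1 hs).resolve_right h0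
  rw [P.unique hg (P.div (h hx hy α β) (h hx hy γ δ) h1)]
  exact P'.div (h hx' hy' α β) (h hx' hy' γ δ) h1

/-- If `s² ∈ M` and `τ s = -s`, `τ` fixes `M`, and `M + M s` generates `F`, then `M` is the fixed
field of `τ`. -/
theorem mem_of_fixed (two : (2 : K) ≠ 0) (M : IntermediateField K F) (τ : F ≃ₐ[K] F)
    (hτ : ∀ a ∈ M, τ a = a) {s : F} (hs : τ s = -s) (hs2 : s ^ 2 ∈ M) {S : Set F}
    (hS : IntermediateField.adjoin K S = ⊤) (hSM : ∀ g ∈ S, ∃ a ∈ M, ∃ b ∈ M, g = a + b * s)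
    {g : F} (hg : τ g = g) : g ∈ M := by
  have h2 : (2 : F) ≠ 0 := by simpa only [map_ofNat] using (_root_.map_ne_zero (algebraMap K F)).2 two
  let N : IntermediateField K F :=
    { carrier := {g | ∃ a ∈ M, ∃ b ∈ M, g = a + b * s}
      mul_mem' := by
        rintro _ _ ⟨a, ha, b, hb, rfl⟩ ⟨c, hc, e, he, rfl⟩
        exact ⟨a * c + b * e * s ^ 2, add_mem (mul_mem ha hc) (mul_mem (mul_mem hb he) hs2),
          a * e + b * c, add_mem (mul_mem ha he) (mul_mem hb hc), by ring⟩
      add_mem' := by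
        rintro _ _ ⟨a, ha, b, hb, rfl⟩ ⟨c, hc, e, he, rfl⟩
        exact ⟨a + c, add_mem ha hc, b + e, add_mem hb he, by ring⟩
      algebraMap_mem' := fun a => ⟨_, algebraMap_mem M a, 0, zero_mem M, by ring⟩
      inv_mem' := by
        rintro _ ⟨a, ha, b, hb, rfl⟩
        by_cases h0 : a + b * s = 0
        · exact ⟨0, zero_mem M, 0, zero_mem M, by rw [h0]; simp⟩
        -- `a - b s` is the conjugate `τ(a + b s)`, so the norm can be inverted.
        have h1 : a - b * s ≠ 0 := fun h => h0 (τ.injective (by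
          rw [map_add, map_mul, hτ a ha, hτ b hb, hs, map_zero, mul_neg, ← sub_eq_add_neg, h]))
        have h3 : a ^ 2 - b ^ 2 * s ^ 2 = (a + b * s) * (a - b * s) := by ring
        have hm : (a ^ 2 - b ^ 2 * s ^ 2)⁻¹ ∈ M :=
          inv_mem (sub_mem (pow_mem ha 2) (mul_mem (pow_mem hb 2) hs2))
        refine ⟨a * (a ^ 2 - b ^ 2 * s ^ 2)⁻¹, mul_mem ha hm, -b * (a ^ 2 - b ^ 2 * s ^ 2)⁻¹,
          mul_mem (neg_mem hb) hm, ?_⟩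
        refine inv_eq_of_mul_eq_one_right ?_
        have hD : a ^ 2 - b ^ 2 * s ^ 2 ≠ 0 := h3 ▸ mul_ne_zero h0 h1
        linear_combination mul_inv_cancel₀ hD }
  have hN : N = ⊤ := by
    rw [_root_.eq_top_iff, ← hS, IntermediateField.adjoin_le_iff]
    exact hSM
  obtain ⟨a, ha, b, hb, rfl⟩ : g ∈ N := hN ▸ IntermediateField.mem_top
  rw [map_add, map_mul, hτ a ha, hτ b hb, hs] at hg
  have : b * s = 0 := by
    refine mul_left_cancel₀ h2 ?_
    linear_combination -hg
  rw [this, add_zero]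
  exact ha

end
end GenusOne

/-! ### Equations of the curve and of its quotient by `uw` -/

namespace GenusOne
noncomputable section
open Polynomial

variable {K F L : Type*} [Field K] [Field F] [Field L] [Algebra K F] [Algebra K L]

namespace DoubleCover

variable {w : F ≃ₐ[K] F} {x y : F} {f : K[X]} (M : DoubleCover w x y f)
include M

/-- `g` is integral over `K[x]` and anti-invariant, so `g = β(x) y` and `h = β² f`; the degree bound
leaves only constant `β`. -/
theorem exists_eq_const_mul_y {g : F} {h : K[X]} (hg : w g = -g) (hsq : g ^ 2 = aeval x h)
    (hdeg : h.natDegree ≤ f.natDegree) :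
    ∃ κ : K, g = algebraMap K F κ * y ∧ h = C (κ ^ 2) * f := by
  have hi : (aeval x : K[X] →ₐ[K] F).toRingHom.IsIntegralElem g := by
    refine ⟨X ^ 2 - C h, monic_X_pow_sub_C h two_ne_zero, ?_⟩
    simp [hsq]
  obtain ⟨α, β, rfl⟩ := M.isIntegralElem_iff.1 hi
  rw [map_add, map_mul, M.map_aeval, M.map_aeval, M.map_y] at hg
  obtain ⟨hα, -⟩ := M.eq_of_eq (p := α) (q := -β) (r := -α) (s := -β) (by
    simp only [map_neg]
    linear_combination hg)
  have hα' : aeval x α = 0 := by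
    have := congrArg (aeval x) hα
    rw [map_neg] at this
    refine mul_left_cancel₀ M.two' ?_
    linear_combination this
  rw [hα', zero_add] at hsq ⊢
  have hβ : h = β ^ 2 * f := M.aeval_inj (by rw [← hsq, mul_pow, M.sq, map_mul, map_pow])
  obtain ⟨κ, rfl⟩ : ∃ κ, β = C κ := by
    by_cases hβ0 : β = 0
    · exact ⟨0, by simp [hβ0]⟩
    · rw [hβ, natDegree_mul (pow_ne_zero 2 hβ0) M.squarefree.ne_zero, natDegree_pow] at hdeg
      exact ⟨_, eq_C_of_natDegree_eq_zero (by omega)⟩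
  exact ⟨κ, by rw [aeval_C], by rw [hβ, C_pow]⟩

theorem adjoin_eq_top : IntermediateField.adjoin K {x, y} = ⊤ := by
  rw [_root_.eq_top_iff]
  rintro g -
  obtain ⟨α, β, γ, -, rfl⟩ := M.exists_eq g
  have hx : x ∈ IntermediateField.adjoin K {x, y} := IntermediateField.subset_adjoin K _ (by simp)
  have hy : y ∈ IntermediateField.adjoin K {x, y} := IntermediateField.subset_adjoin K _ (by simp)
  have hp : ∀ p : K[X], aeval x p ∈ IntermediateField.adjoin K {x, y} := fun p => by
    induction p using Polynomial.induction_on' with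
    | add p q hp hq => rw [map_add]; exact add_mem hp hq
    | monomial n a =>
      rw [aeval_monomial]
      exact mul_mem (algebraMap_mem _ a) (pow_mem hx n)
  exact div_mem (add_mem (hp _) (mul_mem (hp _) hy)) (hp _)

end DoubleCover

/-- The quartic polynomial with given coefficients. -/
def quartic (e₄ e₃ e₂ e₁ e₀ : K) : K[X] :=
  C e₄ * X ^ 4 + C e₃ * X ^ 3 + C e₂ * X ^ 2 + C e₁ * X + C e₀

theorem aeval_quartic (x : F) (e₄ e₃ e₂ e₁ e₀ : K) : aeval x (quartic e₄ e₃ e₂ e₁ e₀) =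
    algebraMap K F e₄ * x ^ 4 + algebraMap K F e₃ * x ^ 3 + algebraMap K F e₂ * x ^ 2 +
      algebraMap K F e₁ * x + algebraMap K F e₀ := by
  simp [quartic]

theorem eq_quartic {f : K[X]} (hf : f.natDegree = 4) :
    ∃ e₃ e₂ e₁ e₀, f = quartic (f.leadingCoeff) e₃ e₂ e₁ e₀ := by
  refine ⟨f.coeff 3, f.coeff 2, f.coeff 1, f.coeff 0, ?_⟩
  conv_lhs => rw [f.as_sum_range_C_mul_X_pow, hf]
  rw [leadingCoeff, hf, quartic]
  simp only [Finset.sum_range_succ, Finset.sum_range_zero]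
  ring

theorem natDegree_quartic_le (e₄ e₃ e₂ e₁ e₀ : K) : (quartic e₄ e₃ e₂ e₁ e₀).natDegree ≤ 4 := by
  rw [quartic]
  compute_degree

theorem quartic_eq_C_mul {e₄ e₃ e₂ e₁ e₀ g₄ g₃ g₂ g₁ g₀ c : K}
    (h : quartic e₄ e₃ e₂ e₁ e₀ = C c * quartic g₄ g₃ g₂ g₁ g₀) :
    e₄ = c * g₄ ∧ e₃ = c * g₃ ∧ e₂ = c * g₂ ∧ e₁ = c * g₁ ∧ e₀ = c * g₀ := by
  have key : ∀ i, (quartic e₄ e₃ e₂ e₁ e₀).coeff i = c * (quartic g₄ g₃ g₂ g₁ g₀).coeff i :=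
    fun i => by rw [h, coeff_C_mul]
  have h0 := key 0
  have h1 := key 1
  have h2 := key 2
  have h3 := key 3
  have h4 := key 4
  simp [quartic, coeff_X, coeff_C] at h0 h1 h2 h3 h4
  exact ⟨h4, h3, h2, h1, h0⟩

/-- The equation of a quartic double cover on which an involution acts by `x ↦ -x`. -/
theorem exists_biquadratic {w u τ : F ≃ₐ[K] F} {P : Place K F L} {x : F} (H : PoleCoordinate w P x)
    (hu : ∀ g, u (u g) = g) (huw : ∀ g, u (w g) = w (u g)) (hτ : ∀ g, τ g = w (u g))
    {d : K} (hd : d ≠ 0) {y : F} {f : K[X]} (M : DoubleCover w x y f) (hf : f.natDegree = 4)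
    (hfd : f.leadingCoeff = d) {r : L} (hval : P.Val (y / x ^ 2) r)
    (hG : ∀ κ : K, τ (y * M.diff (τ x)) = algebraMap K F κ * y → κ = 1) (hux : u x = -x) :
    P.comap u = P ∧ ∃ b c : K, u y = y ∧ y ^ 2 = algebraMap K F d *
      (x ^ 4 + algebraMap K F b * x ^ 2 + algebraMap K F c) := by
  have hy := M.y_ne_zero
  have two := M.two
  obtain ⟨e₃, e₂, e₁, e₀, hfq⟩ := eq_quartic hf
  rw [hfd] at hfq
  obtain ⟨κ, hκ, hκf⟩ := M.exists_eq_const_mul_y (g := u y)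
    (h := quartic d (-e₃) (e₂) (-e₁) (e₀))
    (by rw [← huw, M.map_y, map_neg])
    (by
      rw [← map_pow, M.sq, ← aeval_algHom_apply, hux, hfq, aeval_quartic, aeval_quartic,
        map_neg, map_neg]
      ring)
    ((natDegree_quartic_le _ _ _ _ _).trans hf.ge)
  have hκ2 : κ ^ 2 = 1 := by
    have h := congrArg u hκ
    rw [hu, map_mul, AlgEquiv.commutes, hκ] at h
    have : algebraMap K F (κ ^ 2) = 1 := mul_right_cancel₀ hy (by
      rw [map_pow]
      linear_combination -h)
    exact (algebraMap K F).injective (this.trans (map_one _).symm)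
  -- For `κ = -1`, `uw` would fix `y` and negate `x`, hence negate `dx/y`.
  have hκ1 : κ = 1 := by
    obtain rfl | rfl := mul_self_eq_one_iff.1 ((sq κ).symm.trans hκ2)
    · rfl
    · refine hG (-1) ?_
      rw [hτ x, hux, map_neg, M.map_x, map_neg, M.diff_x, hτ, map_mul u, hκ]
      simp [M.map_y]
  subst hκ1
  rw [map_one, one_mul] at hκ
  rw [hfq, hκ2] at hκf
  obtain ⟨-, h3, -, h1, -⟩ := quartic_eq_C_mul hκf
  have hzero : ∀ {a : K}, -a = 1 * a → a = 0 := fun {a} h =>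
    (mul_eq_zero.1 (show 2 * a = 0 by linear_combination -h)).resolve_left two
  rw [hzero h3, hzero h1] at hfq
  constructor
  -- At infinity `u` negates `1/x`, whose value is `0`, and fixes `y/x²`, so the place is unchanged.
  · refine (M.infinity (m := 2) hf).place_eq (a := 0) (b := r) ?_ ?_ H.val hval
    · change P.Val (u x⁻¹) 0
      rw [map_inv₀, hux, inv_neg]
      simpa using P.neg H.val
    · change P.Val (u (y / x ^ 2)) r
      rwa [map_div₀, map_pow, hκ, hux, neg_sq]
  · refine ⟨e₂ / d, e₀ / d, hκ, ?_⟩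
    have hd' : algebraMap K F d ≠ 0 := (_root_.map_ne_zero _).2 hd
    rw [M.sq, hfq, aeval_quartic, map_div₀, map_div₀, map_zero]
    field_simp
    ring

/-- The equation of a quartic double cover on which an involution acts by `x ↦ ε / x`. -/
theorem exists_reciprocal {w u τ : F ≃ₐ[K] F} {P : Place K F L} {x : F} (H : PoleCoordinate w P x)
    (hu : ∀ g, u (u g) = g) (huw : ∀ g, u (w g) = w (u g)) (hτ : ∀ g, τ g = w (u g))
    {d : K} (hd : d ≠ 0) {y : F} {f : K[X]} (M : DoubleCover w x y f) (hf : f.natDegree = 4)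
    (hfd : f.leadingCoeff = d)
    (hG : ∀ κ : K, τ (y * M.diff (τ x)) = algebraMap K F κ * y → κ = 1)
    {ε : K} (hε : ε ≠ 0) (hux : u x = algebraMap K F ε / x) :
    P.comap u ≠ P ∧ ∃ b c : K, u y = algebraMap K F ε * y / x ^ 2 ∧ y ^ 2 = algebraMap K F d *
      (x ^ 4 + algebraMap K F b * x ^ 3 + algebraMap K F c * x ^ 2 + algebraMap K F (b * ε) * x +
        algebraMap K F (ε ^ 2)) := by
  have hx := M.x_ne_zero
  have hy := M.y_ne_zero
  have hε' : algebraMap K F ε ≠ 0 := (_root_.map_ne_zero _).2 hε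
  obtain ⟨e₃, e₂, e₁, e₀, hfq⟩ := eq_quartic hf
  rw [hfd] at hfq
  -- The quartic is `x⁴ f(ε/x)`, the square of `x² u(y)`.
  obtain ⟨κ, hκ, hκf⟩ := M.exists_eq_const_mul_y (g := x ^ 2 * u y)
    (h := quartic (e₀) (e₁ * ε) (e₂ * ε ^ 2) (e₃ * ε ^ 3) (d * ε ^ 4))
    (by rw [map_mul, map_pow, M.map_x, ← huw, M.map_y, map_neg, mul_neg])
    (by
      rw [mul_pow, ← map_pow, M.sq, ← aeval_algHom_apply, hux, hfq, aeval_quartic, aeval_quartic]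
      simp only [map_mul, map_pow]
      field_simp
      ring)
    ((natDegree_quartic_le _ _ _ _ _).trans hf.ge)
  have huy : u y = algebraMap K F κ * y / x ^ 2 := by
    rw [eq_div_iff (pow_ne_zero 2 hx), ← hκ, mul_comm]
  have hκ2 : κ ^ 2 = ε ^ 2 := by
    have h := congrArg u huy
    rw [hu, map_div₀, map_mul, AlgEquiv.commutes, map_pow, huy, hux] at h
    apply (algebraMap K F).injective
    rw [map_pow, map_pow]
    field_simp at h
    exact h.symm
  -- The vector field `y d/dx` is multiplied by `κ/ε` under `uw`.
  have hκε : κ = ε := by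
    have h := hG (κ / ε) (by
      have h1 : τ x = algebraMap K F ε / x := by
        rw [hτ, hux, map_div₀, AlgEquiv.commutes, M.map_x]
      have h2 : M.diff (algebraMap K F ε / x) = -(algebraMap K F ε / x ^ 2) := by
        rw [Derivation.leibniz_div, Derivation.map_algebraMap, M.diff_x]
        simp only [smul_eq_mul]
        field_simp
        ring
      have h3 : τ y = -(algebraMap K F κ * y / x ^ 2) := by
        rw [hτ, huy, map_div₀, map_mul, AlgEquiv.commutes, M.map_y, map_pow, M.map_x]
        ring
      rw [h1, h2, map_mul, h3, map_neg, map_div₀, AlgEquiv.commutes, map_pow, h1, map_div₀]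
      field_simp)
    exact (div_eq_one_iff_eq hε).1 h
  subst hκε
  rw [hfq] at hκf
  obtain ⟨h4, h3, -, -, -⟩ := quartic_eq_C_mul hκf
  constructor
  -- If `u` fixed the place, `x/ε` and `1/x` would both vanish there, although their product is the
  -- nonzero constant `1/ε`.
  · intro h
    have h1 : (P.comap u).Val x⁻¹ 0 := by
      rw [h]
      exact H.val
    have h2 : P.Val (x / algebraMap K F κ) 0 := by
      have : P.Val (u x⁻¹) 0 := h1
      rwa [map_inv₀, hux, inv_div] at this
    have h3 := P.mul h2 H.val
    have h4 := P.const κ⁻¹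
    have h5 : x / algebraMap K F κ * x⁻¹ = algebraMap K F κ⁻¹ := by
      rw [map_inv₀]
      field_simp
    rw [h5] at h3
    have h6 := P.unique h4 h3
    rw [mul_zero, map_eq_zero] at h6
    exact inv_ne_zero hε h6
  · refine ⟨e₃ / d, e₂ / d, huy, ?_⟩
    have h1 : e₁ = κ * e₃ := mul_right_cancel₀ hε (by linear_combination h3)
    have hd' : algebraMap K F d ≠ 0 := (_root_.map_ne_zero _).2 hd
    rw [M.sq, hfq, aeval_quartic, h4, h1]
    simp only [map_div₀, map_mul, map_pow]
    field_simp

theorem eq_of_mem_adjoin {τ : F ≃ₐ[K] F} {S : Set F} (hS : ∀ g ∈ S, τ g = g) {g : F}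
    (hg : g ∈ IntermediateField.adjoin K S) : τ g = g := by
  induction hg using IntermediateField.adjoin_induction with
  | mem g hg => exact hS g hg
  | algebraMap a => exact τ.commutes a
  | add g h _ _ hg hh => rw [map_add, hg, hh]
  | inv g _ hg => rw [map_inv₀, hg]
  | mul g h _ _ hg hh => rw [map_mul, hg, hh]

/-- Generators of the fixed field of `τ`, transported to an abstract copy of it. -/
theorem exists_generators {E : Type*} [Field E] [Algebra K E] (ψ : E →ₐ[K] F) {τ : F ≃ₐ[K] F}
    (hψ : ∀ g, g ∈ Set.range ψ ↔ τ g = g) {X' Y' : F} (hX : τ X' = X') (hY : τ Y' = Y')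
    (hgen : ∀ g, τ g = g → g ∈ IntermediateField.adjoin K {X', Y'}) :
    ∃ X Y : E, ψ X = X' ∧ ψ Y = Y' ∧ IntermediateField.adjoin K {X, Y} = ⊤ := by
  obtain ⟨X, rfl⟩ := (hψ _).2 hX
  obtain ⟨Y, rfl⟩ := (hψ _).2 hY
  refine ⟨X, Y, rfl, rfl, ?_⟩
  rw [_root_.eq_top_iff]
  rintro g -
  have h := hgen (ψ g) ((hψ _).1 ⟨g, rfl⟩)
  rw [← Set.image_pair, ← IntermediateField.adjoin_map] at h
  obtain ⟨g', hg', h'⟩ := h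
  rwa [← ψ.toRingHom.injective h']

/-- Take `X = x²` and `Y = x y`. With `x` as anti-invariant element, `y = (Y/X) x`, so `F` is
generated over `K(X, Y)` by `x`. -/
theorem exists_cubic_quotient {E : Type*} [Field E] [Algebra K E] (ψ : E →ₐ[K] F) {τ : F ≃ₐ[K] F}
    (hψ : ∀ g, g ∈ Set.range ψ ↔ τ g = g) (two : (2 : K) ≠ 0) {x y : F}
    (hxy : IntermediateField.adjoin K {x, y} = ⊤) (hx0 : x ≠ 0) (hx : τ x = -x) (hy : τ y = -y)
    {b c d : K} (h : y ^ 2 = algebraMap K F d *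
      (x ^ 4 + algebraMap K F b * x ^ 2 + algebraMap K F c)) :
    ∃ X Y : E, IntermediateField.adjoin K {X, Y} = ⊤ ∧ Y ^ 2 = algebraMap K E d *
      (X ^ 3 + algebraMap K E b * X ^ 2 + algebraMap K E c * X) := by
  have hX : τ (x ^ 2) = x ^ 2 := by rw [map_pow, hx, neg_sq]
  have hY : τ (x * y) = x * y := by rw [map_mul, hx, hy, neg_mul_neg]
  have hXm : x ^ 2 ∈ IntermediateField.adjoin K {x ^ 2, x * y} :=
    IntermediateField.subset_adjoin K _ (by simp)
  have hYm : x * y ∈ IntermediateField.adjoin K {x ^ 2, x * y} :=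
    IntermediateField.subset_adjoin K _ (by simp)
  obtain ⟨X, Y, h1, h2, h3⟩ := exists_generators ψ hψ hX hY fun g hg => by
    refine mem_of_fixed two _ τ (fun a ha => ?_) hx hXm hxy ?_ hg
    · refine eq_of_mem_adjoin ?_ ha
      rintro g (rfl | rfl)
      exacts [hX, hY]
    · rintro g (rfl | rfl)
      · exact ⟨0, zero_mem _, 1, one_mem _, by ring⟩
      · refine ⟨0, zero_mem _, x * g / x ^ 2, div_mem hYm hXm, ?_⟩
        field_simp
        ring
  refine ⟨X, Y, h3, ψ.toRingHom.injective ?_⟩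
  change ψ _ = ψ _
  simp only [map_mul, map_add, map_pow, AlgHom.commutes, h1, h2]
  linear_combination x ^ 2 * h

/-- Take `s = x - ε/x`, which is anti-invariant, `X = x + ε/x` and `Y = (y/x) s`. Then `s² = X² -
4ε`, and dividing the equation by `x²` gives `(y/x)² = d (X² + b X + c - 2ε)`. -/
theorem exists_quartic_quotient {E : Type*} [Field E] [Algebra K E] (ψ : E →ₐ[K] F) {τ : F ≃ₐ[K] F}
    (hψ : ∀ g, g ∈ Set.range ψ ↔ τ g = g) (two : (2 : K) ≠ 0) {x y : F}
    (hxy : IntermediateField.adjoin K {x, y} = ⊤) (hx0 : x ≠ 0) {ε b c d : K}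
    (hε : ε ≠ 0) (hx : τ x = algebraMap K F ε / x) (hy : τ y = -(algebraMap K F ε * y / x ^ 2))
    (hs0 : x ^ 2 ≠ algebraMap K F ε)
    (h : y ^ 2 = algebraMap K F d * (x ^ 4 + algebraMap K F b * x ^ 3 + algebraMap K F c * x ^ 2 +
      algebraMap K F (b * ε) * x + algebraMap K F (ε ^ 2))) :
    ∃ X Y : E, IntermediateField.adjoin K {X, Y} = ⊤ ∧ Y ^ 2 = algebraMap K E d *
      (X ^ 2 - algebraMap K E (4 * ε)) *
        (X ^ 2 + algebraMap K E b * X + algebraMap K E (c - 2 * ε)) := by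
  have hε' : algebraMap K F ε ≠ 0 := (_root_.map_ne_zero _).2 hε
  have two' : (2 : F) ≠ 0 := by
    simpa only [map_ofNat] using (_root_.map_ne_zero (algebraMap K F)).2 two
  set s := x - algebraMap K F ε / x with hs
  set X' := x + algebraMap K F ε / x with hX'
  set Y' := y / x * s with hY'
  have hτs : τ s = -s := by
    rw [hs, map_sub, map_div₀, AlgEquiv.commutes, hx]
    field_simp
    ring
  have hX : τ X' = X' := by
    rw [hX', map_add, map_div₀, AlgEquiv.commutes, hx]
    field_simp
    ring
  have hY : τ Y' = Y' := by
    rw [hY', map_mul, map_div₀, hτs, hx, hy]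
    field_simp
  have hXm : X' ∈ IntermediateField.adjoin K {X', Y'} :=
    IntermediateField.subset_adjoin K _ (by simp)
  have hYm : Y' ∈ IntermediateField.adjoin K {X', Y'} :=
    IntermediateField.subset_adjoin K _ (by simp)
  have hs2 : s ^ 2 = X' ^ 2 - algebraMap K F (4 * ε) := by
    rw [hs, hX', map_mul, map_ofNat]
    field_simp
    ring
  have hs2m : s ^ 2 ∈ IntermediateField.adjoin K {X', Y'} := by
    rw [hs2]
    exact sub_mem (pow_mem hXm 2) (algebraMap_mem _ _)
  have hsne : s ≠ 0 := by
    rw [hs, sub_ne_zero]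
    intro h
    rw [eq_div_iff hx0, ← sq] at h
    exact hs0 h
  obtain ⟨X, Y, h1, h2, h3⟩ := exists_generators ψ hψ hX hY fun g hg => by
    refine mem_of_fixed two _ τ (fun a ha => ?_) hτs hs2m hxy ?_ hg
    · refine eq_of_mem_adjoin ?_ ha
      rintro g (rfl | rfl)
      exacts [hX, hY]
    · have hxe : x = X' / 2 + 1 / 2 * s := by
        rw [hX', hs]
        field_simp
        ring
      have h2m : (2 : F) ∈ IntermediateField.adjoin K {X', Y'} := by
        simpa only [map_ofNat] using algebraMap_mem (IntermediateField.adjoin K {X', Y'}) 2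
      rintro g (rfl | rfl)
      · exact ⟨_, div_mem hXm h2m, _, div_mem (one_mem _) h2m, hxe⟩
      · refine ⟨Y' / 2, div_mem hYm h2m, X' * Y' / (2 * s ^ 2),
          div_mem (mul_mem hXm hYm) (mul_mem h2m hs2m), ?_⟩
        have : g = Y' / s * x := by
          rw [hY']
          field_simp
        rw [this]
        conv_lhs => rw [hxe]
        field_simp
        ring
  refine ⟨X, Y, h3, ψ.toRingHom.injective ?_⟩
  change ψ _ = ψ _
  simp only [map_mul, map_add, map_sub, map_pow, AlgHom.commutes, h1, h2]
  rw [hY', mul_pow, div_pow, h, hs2, hX']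
  simp only [map_mul, map_ofNat, map_pow]
  field_simp
  ring

end
end GenusOne

/-! ### Using the quadratic point -/

namespace GenusOne
noncomputable section
open Polynomial

section

variable {K L : Type*} [Field K] [Field L] [Algebra K L]

theorem conj_sqrt {r : L} {d : K} (hr : r ^ 2 = algebraMap K L d)
    (hL : IntermediateField.adjoin K {r} = ⊤) {σ : L ≃ₐ[K] L} (hσ : σ ≠ 1) : σ r = -r := by
  have h : σ r ^ 2 = r ^ 2 := by rw [← map_pow, hr, AlgEquiv.commutes]
  refine (sq_eq_sq_iff_eq_or_eq_neg.1 h).resolve_left fun h => hσ (AlgEquiv.ext fun c => ?_)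
  refine eq_of_mem_adjoin (S := {r}) ?_ (hL ▸ IntermediateField.mem_top)
  rintro _ rfl
  exact h

theorem mem_range_of_conj_eq (two : (2 : K) ≠ 0) {r : L} {d : K} (hr : r ^ 2 = algebraMap K L d)
    (hL : IntermediateField.adjoin K {r} = ⊤) {σ : L ≃ₐ[K] L} (hσ : σ ≠ 1) {c : L}
    (hc : σ c = c) : c ∈ Set.range (algebraMap K L) := by
  refine IntermediateField.mem_bot.1 (mem_of_fixed two ⊥ σ ?_ (conj_sqrt hr hL hσ) ?_ hL ?_ hc)
  · rintro a ha
    obtain ⟨b, rfl⟩ := IntermediateField.mem_bot.1 ha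
    exact σ.commutes b
  · rw [hr]
    exact algebraMap_mem _ d
  · rintro g rfl
    exact ⟨0, zero_mem _, 1, one_mem _, by ring⟩

theorem conj_conj {r : L} {d : K} (hr : r ^ 2 = algebraMap K L d)
    (hL : IntermediateField.adjoin K {r} = ⊤) {σ : L ≃ₐ[K] L} (hσ : σ ≠ 1) (c : L) :
    σ (σ c) = c := by
  refine eq_of_mem_adjoin (τ := σ.trans σ) (S := {r}) ?_ (hL ▸ IntermediateField.mem_top)
  rintro _ rfl
  simp [conj_sqrt hr hL hσ]

variable {F : Type*} [Field F] [Algebra K F]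

/-- The value of `g - w g` at `P` is `c - σ c`, a nonzero `K`-multiple of `r`; divide by the factor.
-/
theorem exists_anti_invariant (two : (2 : K) ≠ 0) {r : L} {d : K} (hd : d ≠ 0)
    (hr : r ^ 2 = algebraMap K L d) (hL : IntermediateField.adjoin K {r} = ⊤) {σ : L ≃ₐ[K] L}
    (hσ : σ ≠ 1) {w : F ≃ₐ[K] F} (hw : ∀ g, w (w g) = g) {P : Place K F L}
    (hP : ∀ g c, P.Val g c → P.Val (w g) (σ c)) {g : F} {c : L} (hg : P.Val g c)
    (hc : c ∉ (algebraMap K L).range) : ∃ g, w g = -g ∧ P.Val g r := by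
  have hr0 : r ≠ 0 := by
    rintro rfl
    rw [zero_pow two_ne_zero] at hr
    exact (_root_.map_ne_zero (algebraMap K L)).2 hd hr.symm
  have hne : c - σ c ≠ 0 := fun h => hc (mem_range_of_conj_eq two hr hL hσ (sub_eq_zero.1 h).symm)
  obtain ⟨b, hb⟩ := mem_range_of_conj_eq two hr hL hσ (c := (c - σ c) / r) (by
    rw [map_div₀, map_sub, conj_conj hr hL hσ, conj_sqrt hr hL hσ, div_neg, ← neg_div, neg_sub])
  have hb0 : algebraMap K L b ≠ 0 := hb ▸ div_ne_zero hne hr0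
  refine ⟨(g - w g) / algebraMap K F b, ?_, ?_⟩
  · rw [map_div₀, map_sub, hw, AlgEquiv.commutes, ← neg_div, neg_sub]
  · convert! P.div (P.sub hg (hP g c hg)) (P.const b) hb0 using 1
    rw [hb]
    field_simp

/-- The data extracted from a point `P` with `w(P) = ᵟP`: a coordinate on which the involution `u`
acts by `x ↦ -x` or `x ↦ ε / x`. -/
theorem exists_coordinates (two : (2 : K) ≠ 0) {r : L} {d : K} (hd : d ≠ 0)
    (hr : r ^ 2 = algebraMap K L d) (hL : IntermediateField.adjoin K {r} = ⊤) {σ : L ≃ₐ[K] L}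
    (hσ : σ ≠ 1) {w u τ : F ≃ₐ[K] F} (hw : ∀ g, w (w g) = g) (hu : ∀ g, u (u g) = g)
    (huw : ∀ g, u (w g) = w (u g)) (hτ : ∀ g, τ g = w (u g)) (hne : u ≠ w) {P : Place K F L}
    (hP : ∀ g c, P.Val g c → P.Val (w g) (σ c)) {g : F} {c : L} (hg : P.Val g c)
    (hc : c ∉ (algebraMap K L).range) (hrank : Module.rank K (regDiff K F) = 1)
    (hF : ∀ (V : ValuationSubring F) (hV : ∀ a, algebraMap K F a ∈ V),
      ((algebraMap K F).codRestrict V.toSubring hV).FormallySmooth)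
    (hG : ∀ {x y f} (M : DoubleCover w x y f), f.natDegree = 4 → ∀ κ : K,
      τ (y * M.diff (τ x)) = algebraMap K F κ * y → κ = 1)
    {t : F} (hwt : w t = t) (ht : ∀ g, w g = g → g ∈ IntermediateField.adjoin K {t}) :
    ∃ (x y : F) (f : K[X]), PoleCoordinate w P x ∧ DoubleCover w x y f ∧ f.natDegree = 4 ∧
      f.leadingCoeff = d ∧ P.Val (y / x ^ 2) r ∧
      (u x = -x ∨ ∃ ε : K, ε ≠ 0 ∧ u x = algebraMap K F ε / x) := by
  have hsep : Algebra.IsSeparable K L := isSeparable_of_involution σ.toRingEquiv.toRingHom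
    (conj_conj hr hL hσ) fun g hg => mem_range_of_conj_eq two hr hL hσ hg
  have htrans : Transcendental K t := fun h => by
    have := isAlgebraic_of_involution hw h ht
    rw [regDiff_eq_bot_of_isAlgebraic P, rank_bot] at hrank
    exact zero_ne_one hrank
  obtain ⟨x, H⟩ := exists_poleCoordinate (P := P) htrans hwt ht fun g c hwg hgc =>
    mem_range_of_conj_eq two hr hL hσ (P.unique (hwg ▸ hP g c hgc) hgc)
  obtain ⟨g, hwg, hgr⟩ := exists_anti_invariant two hd hr hL hσ hw hP hg hc
  have hr0 : r ≠ 0 := by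
    rintro rfl
    rw [zero_pow two_ne_zero] at hr
    exact (_root_.map_ne_zero (algebraMap K L)).2 hd hr.symm
  have key : ∀ {x}, PoleCoordinate w P x → ∃ (y : F) (f : K[X]), DoubleCover w x y f ∧
      f.natDegree = 4 ∧ f.leadingCoeff = d ∧ P.Val (y / x ^ 2) r := fun H => by
    obtain ⟨y, f, m, M, hm, hl, hv⟩ := H.exists_doubleCover two hw hd hr hwg hgr
    obtain rfl := M.natDegree_eq_four hrank hF hm
    exact ⟨y, f, M, hm, hl, hv⟩
  -- For `u = 1` the product `uw` is `w`, which negates `dx/y`, against the genus of the quotient.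
  have hu1 : u ≠ 1 := by
    rintro rfl
    obtain ⟨y, f, M, hf, -, -⟩ := key H
    have h := hG M hf (-1) (by
      rw [hτ x, AlgEquiv.one_apply, M.map_x, M.diff_x, mul_one, hτ, AlgEquiv.one_apply, M.map_y]
      simp)
    exact two (by linear_combination -h)
  obtain ⟨x, H, hux⟩ := H.exists_normalized two hw hwg (P.ne_zero hgr hr0) hu huw hu1 hne
  obtain ⟨y, f, M, hf, hl, hv⟩ := key H
  exact ⟨x, y, f, H, M, hf, hl, hv, hux⟩

end

end
end GenusOne

/-! ### The theorem for curves -/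

theorem mainTheorem7 {K : Type u} [Field K] (hK2 : (2 : K) ≠ 0) (hK3 : (3 : K) ≠ 0)
    (C : Over (Spec (.of K))) [GenusOne.IsCurve C] (hC : GenusOne.HasGenus C 1)
    (w u : Aut C) (hwu : u ≠ w)
    (hw : w ∈ GenusOne.involutions C 0) (hu : u ∈ GenusOne.involutions C 0)
    (hwP : ∃ π : C ⟶ GenusOne.projectiveLine K, GenusOne.IsQuotient w π)
    (huw : u * w ∈ GenusOne.involutions C 1)
    {L : Type u} [Field L] [Algebra K L] (d : K) (hd : ¬ IsSquare d)
    (hL : ∃ r : L, r ^ 2 = algebraMap K L d ∧ IntermediateField.adjoin K {r} = ⊤)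
    (σ : L ≃ₐ[K] L) (hσ : σ ≠ 1)
    (P : GenusOne.Points C L)
    (hPK : ¬ ∃ P₀ : GenusOne.Points C K, P = GenusOne.Points.map (Algebra.ofId K L) P₀)
    (hP : P ≫ w.hom = GenusOne.Points.map σ.toAlgHom P) :
    (P ≫ u.hom = P →
      ∃ (x y : GenusOne.FunctionField C) (b c : K),
        IntermediateField.adjoin K {x, y} = ⊤ ∧
        (GenusOne.pullback w x = x ∧ GenusOne.pullback w y = -y) ∧
        (GenusOne.pullback u x = -x ∧ GenusOne.pullback u y = y) ∧
        y ^ 2 = algebraMap K _ d *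
          (x ^ 4 + algebraMap K _ b * x ^ 2 + algebraMap K _ c) ∧
        ∀ (Q : Over (Spec (.of K))) [GenusOne.IsCurve Q] (π : C ⟶ Q),
          GenusOne.IsQuotient (u * w) π →
          ∃ X Y : GenusOne.FunctionField Q,
            IntermediateField.adjoin K {X, Y} = ⊤ ∧
            Y ^ 2 = algebraMap K _ d *
              (X ^ 3 + algebraMap K _ b * X ^ 2 + algebraMap K _ c * X)) ∧
    (P ≫ u.hom ≠ P →
      ∃ (x y : GenusOne.FunctionField C) (ε b c : K), ε ≠ 0 ∧
        IntermediateField.adjoin K {x, y} = ⊤ ∧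
        (GenusOne.pullback w x = x ∧ GenusOne.pullback w y = -y) ∧
        (GenusOne.pullback u x = algebraMap K _ ε / x ∧
          GenusOne.pullback u y = algebraMap K _ ε * y / x ^ 2) ∧
        y ^ 2 = algebraMap K _ d *
          (x ^ 4 + algebraMap K _ b * x ^ 3 + algebraMap K _ c * x ^ 2
            + algebraMap K _ (b * ε) * x + algebraMap K _ (ε ^ 2)) ∧
        ∀ (Q : Over (Spec (.of K))) [GenusOne.IsCurve Q] (π : C ⟶ Q),
          GenusOne.IsQuotient (u * w) π →
          ∃ X Y : GenusOne.FunctionField Q,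
            IntermediateField.adjoin K {X, Y} = ⊤ ∧
            Y ^ 2 = algebraMap K _ d * (X ^ 2 - algebraMap K _ (4 * ε)) *
              (X ^ 2 + algebraMap K _ b * X + algebraMap K _ (c - 2 * ε))) := by
  obtain ⟨r, hr, hLr⟩ := hL
  have hd0 : d ≠ 0 := by
    rintro rfl
    exact hd (IsSquare.zero)
  have hww : w * w = 1 := hw.1
  have huu : u * u = 1 := hu.1
  have hτ2 : (u * w) * (u * w) = 1 := huw.1
  -- Two involutions whose product is an involution commute.
  have hcomm : w * u = u * w := by
    have h : u * w * u = w := by rw [eq_comm, ← mul_left_inj w, hww, mul_assoc (u * w), hτ2]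
    rw [← mul_left_inj u, h, mul_assoc, huu, mul_one]
  have hcon (v : Aut C) (hv : v * v = 1) (g) :
      GenusOne.pullbackAlgEquiv v (GenusOne.pullbackAlgEquiv v g) = g := by
    rw [← GenusOne.pullbackAlgEquiv_mul, hv, GenusOne.pullbackAlgEquiv_one]
  have hw' := hcon w hww
  have hu' := hcon u huu
  have hτ' := GenusOne.pullbackAlgEquiv_mul u w
  have huw' (g) : GenusOne.pullbackAlgEquiv u (GenusOne.pullbackAlgEquiv w g) =
      GenusOne.pullbackAlgEquiv w (GenusOne.pullbackAlgEquiv u g) := by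
    rw [← GenusOne.pullbackAlgEquiv_mul, ← GenusOne.pullbackAlgEquiv_mul, hcomm]
  have hψ {Q : Over (Spec (.of K))} [GenusOne.IsCurve Q] {π : C ⟶ Q}
      (hπ : GenusOne.IsQuotient (u * w) π) (g) :
      g ∈ Set.range (GenusOne.comapFunctionAlgHom π hπ.genericPoint) ↔
        GenusOne.pullbackAlgEquiv (u * w) g = g := hπ.range_comapFunction hτ2 g
  have hrank : Module.rank K (GenusOne.regDiff K (GenusOne.FunctionField C)) = 1 := by
    rw [← GenusOne.regularDifferentials_eq, hC, Nat.cast_one]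
  have hF := GenusOne.formallySmooth_valuationSubring C
  have hG {x y f} (M : GenusOne.DoubleCover (GenusOne.pullbackAlgEquiv w) x y f)
      (hf : f.natDegree = 4) (κ : K) (hκ : GenusOne.pullbackAlgEquiv (u * w)
        (y * M.diff (GenusOne.pullbackAlgEquiv (u * w) x)) = algebraMap K _ κ * y) : κ = 1 := by
    obtain ⟨-, Q, _, π, hπ, hQ⟩ := huw
    refine M.eq_one_of_quotient_regDiff_ne_bot hrank hF hf _ _ (hcon _ hτ2) (hψ hπ) ?_ hκ
    intro h
    rw [GenusOne.HasGenus, GenusOne.regularDifferentials_eq, h, rank_bot, Nat.cast_one] at hQ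
    exact zero_ne_one hQ
  obtain ⟨g, c, hg, hc⟩ := GenusOne.Points.exists_val_notMem_range P hPK
  obtain ⟨π, hπ⟩ := hwP
  obtain ⟨t, hwt, ht⟩ := GenusOne.exists_fixed_eq_adjoin hww hπ
  obtain ⟨x, y, f, H, M, hf, hl, hv, hux⟩ := GenusOne.exists_coordinates (P := P.toPlace) hK2 hd0
    hr hLr hσ hw' hu' huw' hτ' (GenusOne.pullbackAlgEquiv_injective.ne hwu)
    (fun g c h => by
      have := GenusOne.Points.val_map σ.toAlgHom P h
      rw [← hP, GenusOne.Points.toPlace_comp] at this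
      exact this)
    hg hc hrank hF hG hwt ht
  have hPu : P.toPlace.comap (GenusOne.pullbackAlgEquiv u) = P.toPlace ↔ P ≫ u.hom = P := by
    rw [← GenusOne.Points.toPlace_comp, GenusOne.Points.toPlace_injective.eq_iff]
  have hτx : GenusOne.pullbackAlgEquiv (u * w) x = GenusOne.pullbackAlgEquiv u x := by
    rw [hτ', ← huw', M.map_x]
  have hτy : GenusOne.pullbackAlgEquiv (u * w) y = -GenusOne.pullbackAlgEquiv u y := by
    rw [hτ', ← huw', M.map_y, map_neg]
  -- Each normal form decides whether `u` fixes `P`, so it proves one case and makes the other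
  -- vacuous.
  rcases hux with hux | ⟨ε, hε, hux⟩
  · obtain ⟨h1, b, c, huy, h⟩ := GenusOne.exists_biquadratic H hu' huw' hτ' hd0 M hf hl hv
      (hG M hf) hux
    refine ⟨fun _ => ⟨x, y, b, c, M.adjoin_eq_top, ⟨M.map_x, M.map_y⟩, ⟨hux, huy⟩, h, ?_⟩,
      fun hne => absurd (hPu.1 h1) hne⟩
    intro Q _ π hπ
    exact GenusOne.exists_cubic_quotient _ (hψ hπ) hK2 M.adjoin_eq_top M.x_ne_zero
      (hτx.trans hux) (hτy.trans (congrArg _ huy)) h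
  · obtain ⟨h1, b, c, huy, h⟩ := GenusOne.exists_reciprocal H hu' huw' hτ' hd0 M hf hl
      (hG M hf) hε hux
    refine ⟨fun heq => absurd (hPu.2 heq) h1, fun _ => ⟨x, y, ε, b, c, hε, M.adjoin_eq_top,
      ⟨M.map_x, M.map_y⟩, ⟨hux, huy⟩, h, ?_⟩⟩
    intro Q _ π hπ
    refine GenusOne.exists_quartic_quotient _ (hψ hπ) hK2 M.adjoin_eq_top M.x_ne_zero hε
      (hτx.trans hux) (hτy.trans (congrArg _ huy)) (fun hx => ?_) h
    exact M.transc ⟨Polynomial.X ^ 2 - Polynomial.C ε, Polynomial.X_pow_sub_C_ne_zero two_pos ε,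
      by simp [hx]⟩
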